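/- Setting. Let $U\subset\mathbb C$ be open. Call a function $u$ holomorphic on $U$ and a compact (open or closed) oriented piecewise $C^1$ contour $\mathcal C_u\subset U$, with nowhere vanishing one-sided tangent vectors, admissible if $v=\mathrm{Re}\,u$ has exactly two zeros $Q_-\neq Q_+$ on $\mathcal C_u$, both interior points of the contour (for a closed contour the starting point of the parametrization is chosen where $v>0$), such that $Q_-$ comes before $Q_+$, $v<0$ on the part $\mathcal C_u^-$ of $\mathcal C_u$ between $Q_-$ and $Q_+$, and $v>0$ on the remaining part; if $u'(Q_\pm)\neq0$; and if no other point of $\mathcal C_u$ differs from $Q_-$ or $Q_+$ by an element of $\pi i\mathbb Z$. For every temperature $T$ in a set $\mathcal T\subset(0,\infty)$ let $u=u_T$, $\mathcal C_u=\mathcal C_{u_T}$ be admissible, with $\mathrm{Im}\,u_T(Q_-)=\mathrm{Im}\,u_T(Q_+)=2\pi p_TT$ for some $p_T\in\mathbb Z$. As $T\to0$ in $\mathcal T$ let $u_T$ converge uniformly on $U$ and $\mathcal C_{u_T}$ converge in (piecewise) $C^1$, with fixed parameters of the break points and of $Q_\pm$, to an admissible pair $u_0,\mathcal C_{u_0}$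 (in particular $u$ and $\mathcal C_u$ may be independent of $T$). Put $\bar u=u-2\pi i\,p_TT$. "Above" ("below") $\mathcal C_u$ means on the left-hand (right-hand) side of the oriented contour. All integrals below are along $\mathcal C_u$, those from $Q_-$ to $Q_+$ along $\mathcal C_u^-$. $\ln\Gamma$ is the holomorphic branch on $\mathbb C\setminus(-\infty,0]$ that vanishes at $1$; $\ln\frac{\sinh(Q_+-\lambda_\pm)}{\sinh(Q_--\lambda_\pm)}$ is the value at $\lambda=Q_+$ of the logarithm of $\frac{\sinh(\lambda-\lambda_\pm)}{\sinh(Q_--\lambda_\pm)}$ that is continuous in $\lambda$ along $\mathcal C_u^-$ and vanishes at $\lambda=Q_-$; all other logarithms outside $I_u$ are principal. Claim. For each $T\in\mathcal T$ there is a branch of $\ln(1+e^{-u/T})$, continuous along $\mathcal C_u$, such that the Cauchy type integral $$I_u(\lambda_\pm)=\int_{\mathcal C_u}d\lambda\,\coth(\lambda-\lambda_\pm)\ln\bigl(1+e^{-u(\lambda)/T}\bigr),$$ with $\lambda_+$ above and $\lambda_-$ below $\mathcal C_u$, has the following expansions for $T\to0$, $T\in\mathcal T$. (i) For every $r>0$,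 uniformly in all $\lambda_\pm\notin\mathcal C_u+\pi i\mathbb Z$ whose distance from $\{Q_-,Q_+\}+\pi i\mathbb Z$ (and, if $\mathcal C_u$ is not closed, also from its end points modulo $\pi i\mathbb Z$) is at least $r$, $$I_u(\lambda_\pm)=-\int_{Q_-}^{Q_+}d\lambda\,\coth(\lambda-\lambda_\pm)\frac{\bar u(\lambda)}T+O(T).$$ For $\delta>0$ let $V_\pm$ be the connected component of $Q_\pm$ in $\{z\in U:|\bar u(z)|<\delta/2\}$. There is a $\delta>0$, independent of $T$ and $\lambda_\pm$, such that (ii) and (iii) hold uniformly in $\lambda_\pm$. (ii) If $\lambda_\pm\in V_+$, with $\lambda_+$ above and $\lambda_-$ below $\mathcal C_u$ inside $V_+$, then $$I_u(\lambda_\pm)=-\int_{Q_-}^{Q_+}d\lambda\,\coth(\lambda-\lambda_\pm)\frac{\bar u(\lambda)-\bar u(\lambda_\pm)}T\mp2\pi i\ln\Gamma\Bigl(\frac12\pm\frac{\bar u(\lambda_\pm)}{2\pi iT}\Bigr)\pm\pi i\ln(2\pi)+\frac{\bar u(\lambda_\pm)}T\Bigl\{\ln\Bigl(\frac{\bar u(\lambda_\pm)}{\pm2\pi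 iT}\Bigr)-1-\ln\Bigl(\frac{\sinh(Q_+-\lambda_\pm)}{\sinh(Q_--\lambda_\pm)}\Bigr)\Bigr\}+O(T).$$ (iii) If $\lambda_\pm\in V_-$, with $\lambda_+$ above and $\lambda_-$ below $\mathcal C_u$ inside $V_-$, then $$I_u(\lambda_\pm)=-\int_{Q_-}^{Q_+}d\lambda\,\coth(\lambda-\lambda_\pm)\frac{\bar u(\lambda)-\bar u(\lambda_\pm)}T\mp2\pi i\ln\Gamma\Bigl(\frac12\mp\frac{\bar u(\lambda_\pm)}{2\pi iT}\Bigr)\pm\pi i\ln(2\pi)-\frac{\bar u(\lambda_\pm)}T\Bigl\{\ln\Bigl(\frac{\bar u(\lambda_\pm)}{\mp2\pi iT}\Bigr)-1+\ln\Bigl(\frac{\sinh(Q_+-\lambda_\pm)}{\sinh(Q_--\lambda_\pm)}\Bigr)\Bigr\}+O(T).$$ -/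

import Mathlib

open Complex Set Filter Topology

noncomputable section

namespace Sommerfeld

/-- The hyperbolic cotangent on `ℂ`. -/
def coth (z : ℂ) : ℂ := cosh z / sinh z

/-- The holomorphic logarithm of the Gamma function on `ℂ \ (-∞, 0]` that vanishes at `1`:
the primitive of the digamma function `Γ' / Γ` along the segment from `1` to `z`. -/
def logGamma (z : ℂ) : ℂ := ∫ t in (0 : ℝ)..1, digamma (1 + t * (z - 1)) * (z - 1)

/-- `L` is a continuous logarithm of `F` on the parameter interval `[a, b]`. -/
def IsContinuousLog (F : ℝ → ℂ) (a b : ℝ) (L : ℝ → ℂ) : Prop :=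
  ContinuousOn L (Icc a b) ∧ ∀ t ∈ Icc a b, exp (L t) = F t

/-- The contour integral of `F` (given as a function of the parameter, since the integrand may
be multivalued on the complex plane) over the part `[a, b]` of the path `γ`. -/
def contourIntegral (γ : ℝ → ℂ) (F : ℝ → ℂ) (a b : ℝ) : ℂ :=
  ∫ t in a..b, F t * deriv γ t

/-- Parameter data of a piecewise `C¹` path: its knots, of which `knot 0` and `knot n` are the
two ends of the parameter interval, and the parameters at which it passes through
`Q₋` and `Q₊`. -/
structure Mesh where
  n : ℕ
  knot : ℕ → ℝ
  knot_lt : ∀ i < n, knot i < knot (i + 1)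
  tMinus : ℝ
  tPlus : ℝ
  first_lt : knot 0 < tMinus
  minus_lt_plus : tMinus < tPlus
  lt_last : tPlus < knot n

namespace Mesh

/-- The first parameter. -/
def first (m : Mesh) : ℝ := m.knot 0

/-- The last parameter. -/
def last (m : Mesh) : ℝ := m.knot m.n

/-- The `i`-th piece of the parameter interval. -/
def piece (m : Mesh) (i : ℕ) : Set ℝ := Icc (m.knot i) (m.knot (i + 1))

/-- The whole parameter interval. -/
def domain (m : Mesh) : Set ℝ := Icc m.first m.last

end Mesh

/-- The function `u`, holomorphic on the open set `U`, and the contour `γ` in `U` (open or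
closed, piecewise `C¹` with nowhere vanishing one-sided derivatives) fit together:
`Re u` has exactly two zeros `Q₋ = γ tMinus`, `Q₊ = γ tPlus` on the contour, is negative between
them and positive on the remaining part; they are simple zeros of `u - u(Q₋)`, `u - u(Q₊)`; and
no other point of the contour is congruent to `Q₋` or `Q₊` modulo the period `π i` of `coth`. -/
structure IsAdmissible (m : Mesh) (U : Set ℂ) (u : ℂ → ℂ) (γ : ℝ → ℂ) : Prop where
  isOpen : IsOpen U
  holomorphic : DifferentiableOn ℂ u U
  mapsTo : MapsTo γ m.domain U
  contDiffOn : ∀ i < m.n, ContDiffOn ℝ 1 γ (m.piece i)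
  deriv_ne_zero : ∀ i < m.n, ∀ t ∈ m.piece i, derivWithin γ (m.piece i) t ≠ 0
  re_minus : (u (γ m.tMinus)).re = 0
  re_plus : (u (γ m.tPlus)).re = 0
  re_neg : ∀ t ∈ Ioo m.tMinus m.tPlus, (u (γ t)).re < 0
  re_pos_left : ∀ t ∈ Ico m.first m.tMinus, 0 < (u (γ t)).re
  re_pos_right : ∀ t ∈ Ioc m.tPlus m.last, 0 < (u (γ t)).re
  simple_minus : deriv u (γ m.tMinus) ≠ 0
  simple_plus : deriv u (γ m.tPlus) ≠ 0
  incongruent_minus : ∀ t ∈ m.domain, sinh (γ t - γ m.tMinus) = 0 → t = m.tMinus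
  incongruent_plus : ∀ t ∈ m.domain, sinh (γ t - γ m.tPlus) = 0 → t = m.tPlus

/-- Piecewise `C¹` convergence of the paths `γ T` to `γ₀` along the filter `l`. -/
def TendstoC1 (m : Mesh) (γ : ℝ → ℝ → ℂ) (γ₀ : ℝ → ℂ) (l : Filter ℝ) : Prop :=
  TendstoUniformlyOn γ γ₀ l m.domain ∧
    ∀ i < m.n, TendstoUniformlyOn (fun T => derivWithin (γ T) (m.piece i))
      (derivWithin γ₀ (m.piece i)) l (m.piece i)

/-- `ū = u - 2 π i p T`. -/
def uBar (u : ℂ → ℂ) (p : ℤ) (T : ℝ) (z : ℂ) : ℂ := u z - 2 * Real.pi * I * p * T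

/-- The neighbourhood `{|ū| < δ / 2, z close to Q}` of `Q`: the connected component of `Q`
in the set of all `z ∈ U` with `|ū z| < δ / 2`. -/
def nbhd (U : Set ℂ) (ubar : ℂ → ℂ) (δ : ℝ) (Q : ℂ) : Set ℂ :=
  connectedComponentIn {z ∈ U | ‖ubar z‖ < δ / 2} Q

/-- For a neighbourhood `V` of a point of the contour, the point `z` of `V` lies off the contour
and on its left-hand side (`σ = 1`: `z` is above the contour) or on its right-hand side
(`σ = -1`: `z` is below the contour): inside `V` and without crossing the contour, `z` can be
joined to the points of the left (right) normal at a point of the contour in `V`. -/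
def IsOnSide (m : Mesh) (γ : ℝ → ℂ) (V : Set ℂ) (σ : ℝ) (z : ℂ) : Prop :=
  ∃ s ∈ Ioo m.first m.last, γ s ∈ V ∧ DifferentiableAt ℝ γ s ∧ deriv γ s ≠ 0 ∧
    ∀ᶠ ε : ℝ in 𝓝[>] 0, JoinedIn (V \ γ '' m.domain) (γ s + ε * σ * I * deriv γ s) z

/-- The Cauchy type integral `I_u(z)`; `L` is the branch of `ln(1 + exp(-u/T))` on the contour. -/
def cauchyIntegral (m : Mesh) (γ L : ℝ → ℂ) (z : ℂ) : ℂ :=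
  contourIntegral γ (fun t => coth (γ t - z) * L t) m.first m.last

/-- `-∫_{Q₋}^{Q₊} coth(μ - z) ū(μ) / T dμ`, along the contour. -/
def farExpansion (m : Mesh) (γ : ℝ → ℂ) (ubar : ℂ → ℂ) (T : ℝ) (z : ℂ) : ℂ :=
  -contourIntegral γ (fun t => coth (γ t - z) * (ubar (γ t) / T)) m.tMinus m.tPlus

/-- `-∫_{Q₋}^{Q₊} coth(μ - z) (ū(μ) - ū(z)) / T dμ`, along the contour. -/
def regularPart (m : Mesh) (γ : ℝ → ℂ) (ubar : ℂ → ℂ) (T : ℝ) (z : ℂ) : ℂ :=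
  -contourIntegral γ (fun t => coth (γ t - z) * ((ubar (γ t) - ubar z) / T)) m.tMinus m.tPlus

/-- The expansion close to `Q₊`; the number `ℓ` is the value of
`ln(sinh(Q₊ - z) / sinh(Q₋ - z))`. -/
def nearPlusExpansion (m : Mesh) (γ : ℝ → ℂ) (ubar : ℂ → ℂ) (T σ : ℝ) (z ℓ : ℂ) : ℂ :=
  regularPart m γ ubar T z
    - σ * (2 * Real.pi * I) * logGamma (1 / 2 + σ * (ubar z / (2 * Real.pi * I * T)))
    + σ * (Real.pi * I) * Real.log (2 * Real.pi)
    + ubar z / T * (log (ubar z / (σ * (2 * Real.pi * I * T))) - 1 - ℓ)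

/-- The expansion close to `Q₋`; the number `ℓ` is the value of
`ln(sinh(Q₊ - z) / sinh(Q₋ - z))`. -/
def nearMinusExpansion (m : Mesh) (γ : ℝ → ℂ) (ubar : ℂ → ℂ) (T σ : ℝ) (z ℓ : ℂ) : ℂ :=
  regularPart m γ ubar T z
    - σ * (2 * Real.pi * I) * logGamma (1 / 2 - σ * (ubar z / (2 * Real.pi * I * T)))
    + σ * (Real.pi * I) * Real.log (2 * Real.pi)
    - ubar z / T * (log (ubar z / (-σ * (2 * Real.pi * I * T))) - 1 + ℓ)

/-- `ℓ` is the value at `Q₊` of the logarithm of `sinh(μ - z) / sinh(Q₋ - z)` that is continuous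
in `μ` along the contour from `Q₋` to `Q₊` and vanishes at `μ = Q₋`. -/
def IsLogSinhRatio (m : Mesh) (γ : ℝ → ℂ) (z ℓ : ℂ) : Prop :=
  ∃ L : ℝ → ℂ,
    IsContinuousLog (fun t => sinh (γ t - z) / sinh (γ m.tMinus - z)) m.tMinus m.tPlus L ∧
      L m.tMinus = 0 ∧ L m.tPlus = ℓ

/-- `z` has distance at least `r` from all the points `w + k π i`, `k ∈ ℤ`. -/
def IsAwayFrom (r : ℝ) (z w : ℂ) : Prop := ∀ k : ℤ, r ≤ ‖z - (w + k * (Real.pi * I))‖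

end Sommerfeld

end

open Sommerfeld

/-! Let `x = ū/T`. Where `Re u < 0` one has `ln(1 + e^{-x}) = -x + ln(1 + e^{x})`, so the branch can
be taken as `-x` on the part of the contour between the zeros plus the even function `E(x) = ln(1 +
e^{-|x|})` on all of it (`thermalLog`). Since `ū` vanishes at both zeros, this is continuous, and
the first summand yields `farExpansion` exactly (`IsPinned.cauchyIntegral_branch`). What remains is
the integral of `coth (λ - z) E(ū/T)`.

Let `R(w) = ln Γ(1/2 + w) - w ln w + w - ln(2π)/2`. Euler's reflection formula gives `E(x) =
-R(x/(2πi)) - R(-x/(2πi))` (`thermalLog_eq`). Each summand is holomorphic off one half of the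
imaginary axis, and Stirling's formula bounds it by `O(T)` at fixed distance from that cut
(`norm_stirlingRemainder_div_le`).

Near a zero of `Re u` the function `±ū` is a local coordinate in which the contour crosses the
imaginary axis at `0` from left to right. The path of integration for each summand is moved away
from its cut. If the kernel is regular this shows that the crossing contributes `O(T)`. If the
kernel has a pole `ζ = ±ū(z)`, exactly one of the two deformations sweeps over it, namely the one
towards the side on which `z` lies, and the residue is `-σ 2πi R(σζ/(2πiT))`
(`IsCrossing.norm_integral_inv_sub_mul_thermalLog_le`). By an exact identity this residue is what
distinguishes the near expansions from `farExpansion` (`IsPinned.nearPlusExpansion_eq`,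
`IsPinned.nearMinusExpansion_eq`). The topological definition of the sides is tied to the residue by
a winding function that is constant along paths off the contour
(`IsCrossing.integral_inv_sub_of_side`).

Away from the zeros `E(ū/T)` and its Lipschitz constant are exponentially small, but `z` may be
arbitrarily close to the contour. On almost straight arcs the Cauchy integral is therefore estimated
up to logarithmic boundary terms, which cancel between consecutive arcs
(`norm_integral_coth_mul_sub_le`, `IsFamily.exists_norm_boundaryError_le`). All radii, arcs and
constants are taken from the limiting pair, hence do not depend on `T`. -/

namespace Sommerfeld

/-! ### The logarithm of the Gamma function -/

/-- The integral along segments starting at the centre of a star-shaped open set is a primitive. -/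
theorem hasDerivAt_integral_segment {S : Set ℂ} (hS : IsOpen S) {a : ℂ} (hstar : StarConvex ℝ a S)
    {f : ℂ → ℂ} (hf : DifferentiableOn ℂ f S) {z : ℂ} (hz : z ∈ S) :
    HasDerivAt (fun z => ∫ t in (0 : ℝ)..1, f (a + t * (z - a)) * (z - a)) (f z) z := by
  have hmem : ∀ x ∈ S, ∀ t ∈ Icc (0 : ℝ) 1, a + (t : ℂ) * (x - a) ∈ S := by
    intro x hx t ht
    have := hstar.add_smul_sub_mem hx ht.1 ht.2
    simpa [real_smul] using this
  obtain ⟨ε, hε, hball⟩ := Metric.isOpen_iff.1 hS z hz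
  have hsub : Metric.closedBall z (ε / 2) ⊆ S :=
    (Metric.closedBall_subset_ball (by linarith)).trans hball
  have hf' : DifferentiableOn ℂ (deriv f) S := hf.deriv hS
  have hcont : ∀ g : ℂ → ℂ, DifferentiableOn ℂ g S →
      ContinuousOn (fun p : ℂ × ℝ => g (a + p.2 * (p.1 - a)))
        (Metric.closedBall z (ε / 2) ×ˢ Icc (0 : ℝ) 1) := by
    intro g hg
    refine hg.continuousOn.comp (by fun_prop) ?_
    rintro ⟨x, t⟩ ⟨hx, ht⟩
    exact hmem x (hsub hx) t ht
  have hcont' : ∀ g : ℂ → ℂ, DifferentiableOn ℂ g S → ∀ x ∈ Metric.closedBall z (ε / 2),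
      ContinuousOn (fun t : ℝ => g (a + t * (x - a))) (Icc 0 1) := by
    intro g hg x hx
    refine hg.continuousOn.comp (by fun_prop) fun t ht => hmem x (hsub hx) t ht
  let F' : ℂ → ℝ → ℂ := fun x t =>
    deriv f (a + t * (x - a)) * t * (x - a) + f (a + t * (x - a))
  have hF'c : ContinuousOn (fun p : ℂ × ℝ => F' p.1 p.2)
      (Metric.closedBall z (ε / 2) ×ˢ Icc (0 : ℝ) 1) :=
    (((hcont _ hf').mul (by fun_prop)).mul (by fun_prop)).add (hcont _ hf)
  obtain ⟨C, hC⟩ := ((isCompact_closedBall z (ε / 2)).prod isCompact_Icc).exists_bound_of_continuousOn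
    hF'c
  have hzm : z ∈ Metric.closedBall z (ε / 2) := Metric.mem_closedBall_self (by linarith)
  have hF'z : ContinuousOn (F' z) (Icc 0 1) :=
    (((hcont' _ hf' z hzm).mul (by fun_prop)).mul (by fun_prop)).add (hcont' _ hf z hzm)
  have hFc : ∀ x ∈ Metric.closedBall z (ε / 2),
      ContinuousOn (fun t : ℝ => f (a + t * (x - a)) * (x - a)) (Icc 0 1) := fun x hx =>
    (hcont' _ hf x hx).mul continuousOn_const
  have hIoc : uIoc (0 : ℝ) 1 = Ioc 0 1 := uIoc_of_le zero_le_one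
  have key := intervalIntegral.hasDerivAt_integral_of_dominated_loc_of_deriv_le
    (μ := MeasureTheory.volume) (a := 0) (b := 1) (bound := fun _ => C) (x₀ := z)
    (F := fun x t => f (a + t * (x - a)) * (x - a)) (F' := F')
    (Metric.closedBall_mem_nhds z (by linarith : 0 < ε / 2)) ?_ ?_ ?_ ?_ ?_ ?_
  -- The differentiated integrand is the `t`-derivative of `t * f (a + t (z - a))`, so it integrates
  -- to `f z`.
  · have h1 : ∫ t in (0 : ℝ)..1, F' z t = f z := by
      have hd : ∀ t ∈ uIcc (0 : ℝ) 1,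
          HasDerivAt (fun t : ℝ => (t : ℂ) * f (a + t * (z - a))) (F' z t) t := by
        intro t ht
        rw [uIcc_of_le zero_le_one] at ht
        have h := (hf.differentiableAt (hS.mem_nhds (hmem z hz t ht))).hasDerivAt
        have hin : HasDerivAt (fun t : ℝ => a + (t : ℂ) * (z - a)) (1 * (z - a)) t :=
          ((hasDerivAt_id t).ofReal_comp.mul_const (z - a)).const_add a
        have hid : HasDerivAt (fun t : ℝ => (t : ℂ)) 1 t := (hasDerivAt_id t).ofReal_comp
        have := hid.mul (HasDerivAt.comp t h hin)
        refine this.congr_deriv ?_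
        simp only [F', Function.comp]
        ring
      rw [intervalIntegral.integral_eq_sub_of_hasDerivAt hd]
      · simp
      · exact (hF'z.mono (by rw [uIcc_of_le zero_le_one])).intervalIntegrable
    rw [← h1]
    exact key.2
  · filter_upwards [Metric.closedBall_mem_nhds z (by linarith : 0 < ε / 2)] with x hx
    rw [hIoc]
    exact ((hFc x hx).mono Ioc_subset_Icc_self).aestronglyMeasurable measurableSet_Ioc
  · exact ((hFc z hzm).mono (by rw [uIcc_of_le zero_le_one])).intervalIntegrable
  · rw [hIoc]
    exact (hF'z.mono Ioc_subset_Icc_self).aestronglyMeasurable measurableSet_Ioc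
  · refine Eventually.of_forall fun t ht x hx => hC (x, t) ⟨hx, ?_⟩
    rw [hIoc] at ht
    exact Ioc_subset_Icc_self ht
  · exact intervalIntegrable_const
  · refine Eventually.of_forall fun t ht x hx => ?_
    rw [hIoc] at ht
    have h := (hf.differentiableAt
      (hS.mem_nhds (hmem x (hsub hx) t (Ioc_subset_Icc_self ht)))).hasDerivAt
    have hin : HasDerivAt (fun x : ℂ => a + (t : ℂ) * (x - a)) (t * 1) x :=
      (((hasDerivAt_id x).sub_const a).const_mul (t : ℂ)).const_add a
    have := (HasDerivAt.comp x h hin).mul ((hasDerivAt_id x).sub_const a)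
    refine this.congr_deriv ?_
    simp only [F', Function.comp, id]
    ring

theorem ne_neg_natCast_of_mem_slitPlane {z : ℂ} (hz : z ∈ slitPlane) (m : ℕ) : z ≠ -m := by
  rintro rfl
  rcases hz with h | h
  · simp at h
    have : (0 : ℝ) ≤ m := m.cast_nonneg
    linarith
  · simp at h

theorem differentiableOn_Gamma_slitPlane : DifferentiableOn ℂ Gamma slitPlane := fun z hz =>
  (differentiableAt_Gamma z (ne_neg_natCast_of_mem_slitPlane hz)).differentiableWithinAt

theorem hasDerivAt_logGamma {z : ℂ} (hz : z ∈ slitPlane) :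
    HasDerivAt logGamma (digamma z) z := by
  have hd : DifferentiableOn ℂ digamma slitPlane := by
    have : digamma = fun z => deriv Gamma z / Gamma z := by
      ext z
      rw [digamma_def, logDeriv_apply]
    rw [this]
    exact (differentiableOn_Gamma_slitPlane.deriv isOpen_slitPlane).div
      differentiableOn_Gamma_slitPlane
      fun z hz => Gamma_ne_zero (ne_neg_natCast_of_mem_slitPlane hz)
  exact hasDerivAt_integral_segment isOpen_slitPlane starConvex_one_slitPlane hd hz

theorem logGamma_one : logGamma 1 = 0 := by
  simp [logGamma]

theorem continuousOn_logGamma : ContinuousOn logGamma slitPlane := fun _ hz =>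
  (hasDerivAt_logGamma hz).continuousAt.continuousWithinAt

/-- Two continuous logarithms of the same function on a connected set that agree at one point
agree everywhere. -/
theorem eqOn_of_exp_eqOn {X : Type*} [TopologicalSpace X] {S : Set X} (hS : IsPreconnected S)
    {f g : X → ℂ} (hf : ContinuousOn f S) (hg : ContinuousOn g S)
    (h : ∀ x ∈ S, exp (f x) = exp (g x)) {a : X} (ha : a ∈ S) (hfg : f a = g a) :
    ∀ x ∈ S, f x = g x := by
  -- The difference divided by `2πi` takes integer values; rounding merely names the integer. A
  -- continuous function on a preconnected set with values in the discrete set of integers is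
  -- constant.
  let n : X → ℤ := fun x => round ((f x - g x) / (2 * Real.pi * I)).re
  have hpi : (2 * Real.pi * I : ℂ) ≠ 0 := two_pi_I_ne_zero
  have hn : ∀ x ∈ S, (f x - g x) / (2 * Real.pi * I) = n x := by
    intro x hx
    obtain ⟨k, hk⟩ := exp_eq_exp_iff_exists_int.1 (h x hx)
    have : (f x - g x) / (2 * Real.pi * I) = k := by
      rw [hk]; field_simp; ring
    simp [n, this]
  have hq : ContinuousOn (fun x => ((f x - g x) / (2 * Real.pi * I)).re) S :=
    continuous_re.comp_continuousOn ((hf.sub hg).div_const _)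
  have hmaps : MapsTo (fun x => ((f x - g x) / (2 * Real.pi * I)).re) S
      (range ((↑) : ℤ → ℝ)) := fun x hx => ⟨n x, by
    show (n x : ℝ) = ((f x - g x) / (2 * Real.pi * I)).re
    rw [hn x hx]; simp⟩
  intro x hx
  have hdisc : IsDiscrete (range ((↑) : ℤ → ℝ)) := by
    have : Topology.IsEmbedding ((↑) : ℤ → ℝ) := Int.isClosedEmbedding_coe_real.isEmbedding
    refine ⟨?_⟩
    exact (this.toHomeomorph.discreteTopology_iff).1 inferInstance
  have hconst := hS.constant_of_mapsTo hdisc hq hmaps hx ha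
  simp only [hn x hx, hfg, sub_self, zero_div, zero_re, intCast_re] at hconst
  have h0 := hn x hx
  rw [show (n x : ℂ) = 0 by exact_mod_cast hconst, div_eq_zero_iff] at h0
  exact sub_eq_zero.1 (h0.resolve_right hpi)

theorem isPreconnected_slitPlane : IsPreconnected slitPlane :=
  (starConvex_one_slitPlane.isPathConnected one_mem_slitPlane).isConnected.isPreconnected

/-- The product of `Γ` and `exp (-logGamma)` has derivative zero on the connected slit plane and
equals `1` at `1`. -/
theorem exp_logGamma {z : ℂ} (hz : z ∈ slitPlane) : exp (logGamma z) = Gamma z := by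
  have hd : ∀ w ∈ slitPlane, HasDerivAt (fun w => Gamma w * exp (-logGamma w)) 0 w := by
    intro w hw
    have h1 := (differentiableAt_Gamma w (ne_neg_natCast_of_mem_slitPlane hw)).hasDerivAt
    have h2 := (hasDerivAt_logGamma hw).neg.cexp
    have h3 := h1.mul h2
    refine h3.congr_deriv ?_
    have h0 : Gamma w ≠ 0 := Gamma_ne_zero (ne_neg_natCast_of_mem_slitPlane hw)
    rw [digamma_def, logDeriv_apply]
    field_simp
    simp
  have := isOpen_slitPlane.is_const_of_deriv_eq_zero isPreconnected_slitPlane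
    (fun w hw => (hd w hw).differentiableAt.differentiableWithinAt)
    (fun w hw => (hd w hw).deriv) hz one_mem_slitPlane
  simp only [logGamma_one, neg_zero, exp_zero, Gamma_one, mul_one, exp_neg] at this
  exact (mul_inv_eq_one₀ (exp_ne_zero _)).1 this |>.symm

theorem add_mem_slitPlane {z : ℂ} (hz : z ∈ slitPlane) {x : ℝ} (hx : 0 ≤ x) :
    z + x ∈ slitPlane := by
  rcases hz with h | h
  · left; simp; linarith
  · right; simpa using h

/-- This makes `logGamma` real on the positive axis, which is how the `2πi` ambiguity is removed
both at `2` and in the limit of Stirling's remainder. -/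
theorem conj_logGamma {z : ℂ} (hz : z ∈ slitPlane) :
    (starRingEnd ℂ) (logGamma ((starRingEnd ℂ) z)) = logGamma z := by
  have hc : ∀ z ∈ slitPlane, (starRingEnd ℂ) z ∈ slitPlane := fun z hz => by
    simpa [slitPlane] using hz
  refine eqOn_of_exp_eqOn (S := slitPlane)
    (f := fun z => (starRingEnd ℂ) (logGamma ((starRingEnd ℂ) z)))
    (g := logGamma) isPreconnected_slitPlane
    (continuous_conj.comp_continuousOn
      (continuousOn_logGamma.comp continuous_conj.continuousOn hc))
    continuousOn_logGamma ?_ one_mem_slitPlane ?_ z hz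
  · intro w hw
    rw [exp_conj, exp_logGamma hw, exp_logGamma (hc w hw), Gamma_conj, conj_conj]
  · simp [logGamma_one]

theorem logGamma_two : logGamma 2 = 0 := by
  have h2 : (2 : ℂ) ∈ slitPlane := by simp [slitPlane]
  have h := conj_logGamma h2
  have h3 : (starRingEnd ℂ) (2 : ℂ) = 2 := map_ofNat _ 2
  rw [h3, conj_eq_iff_real] at h
  obtain ⟨r, hr⟩ := h
  have he := exp_logGamma h2
  rw [hr, show (2 : ℂ) = 1 + 1 by norm_num, Gamma_add_one 1 one_ne_zero, Gamma_one, mul_one,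
    ← ofReal_exp, ← ofReal_one, ofReal_inj, Real.exp_eq_one_iff] at he
  simp [hr, he]

/-- Both sides are continuous logarithms of `Γ(z + 1)` on the slit plane, and both vanish at `1`. -/
theorem logGamma_add_one {z : ℂ} (hz : z ∈ slitPlane) :
    logGamma (z + 1) = logGamma z + log z := by
  have h1 : ∀ z ∈ slitPlane, z + 1 ∈ slitPlane := fun z hz => by
    simpa using add_mem_slitPlane hz zero_le_one
  refine eqOn_of_exp_eqOn (S := slitPlane) (f := fun z => logGamma (z + 1))
    (g := fun z => logGamma z + log z) isPreconnected_slitPlane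
    (continuousOn_logGamma.comp (by fun_prop) h1)
    (continuousOn_logGamma.add fun z hz => (continuousAt_clog hz).continuousWithinAt) ?_
    one_mem_slitPlane ?_ z hz
  · intro w hw
    show exp (logGamma (w + 1)) = exp (logGamma w + log w)
    rw [exp_add, exp_logGamma hw, exp_logGamma (h1 w hw), exp_log (slitPlane_ne_zero hw),
      Gamma_add_one w (slitPlane_ne_zero hw), mul_comm]
  · rw [show (1 : ℂ) + 1 = 2 by norm_num, logGamma_two, logGamma_one, log_one, add_zero]

/-! ### Stirling's formula in the closed right half-plane -/

/-- The remainder in Stirling's formula for `ln Γ(1/2 + w)`. -/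
noncomputable def stirlingRemainder (w : ℂ) : ℂ :=
  logGamma (1 / 2 + w) - w * log w + w - Real.log (2 * Real.pi) / 2

theorem half_add_mem_slitPlane {w : ℂ} (hw : w ∈ slitPlane) : 1 / 2 + w ∈ slitPlane := by
  have := add_mem_slitPlane hw (x := 1 / 2) (by norm_num)
  rw [add_comm] at this
  simpa using this

theorem differentiableAt_stirlingRemainder {w : ℂ} (hw : w ∈ slitPlane) :
    DifferentiableAt ℂ stirlingRemainder w := by
  have h1 : DifferentiableAt ℂ (fun w => logGamma (1 / 2 + w)) w :=
    DifferentiableAt.comp (f := fun w : ℂ => 1 / 2 + w) w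
      (hasDerivAt_logGamma (half_add_mem_slitPlane hw)).differentiableAt (by fun_prop)
  have h2 : DifferentiableAt ℂ log w := differentiableAt_log hw
  unfold stirlingRemainder
  fun_prop

theorem tendsto_mul_log_zero : Tendsto (fun w : ℂ => w * log w) (𝓝 0) (𝓝 0) := by
  rw [tendsto_zero_iff_norm_tendsto_zero]
  have h1 : Tendsto (fun w : ℂ => |Real.log ‖w‖ * ‖w‖| + Real.pi * ‖w‖) (𝓝 0) (𝓝 0) := by
    have : ContinuousAt (fun w : ℂ => |Real.log ‖w‖ * ‖w‖| + Real.pi * ‖w‖) 0 := by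
      have hc : Continuous fun x : ℝ => Real.log x * x := by
        simpa [mul_comm] using Real.continuous_mul_log
      exact ((hc.comp continuous_norm).abs.add (continuous_const.mul continuous_norm)).continuousAt
    simpa [ContinuousAt] using this
  refine squeeze_zero (fun _ => norm_nonneg _) (fun w => ?_) h1
  rw [norm_mul, abs_mul, abs_norm, mul_comm, ← add_mul]
  refine mul_le_mul_of_nonneg_right ?_ (norm_nonneg _)
  refine (norm_le_abs_re_add_abs_im _).trans ?_
  rw [log_re, log_im]
  gcongr
  exact abs_arg_le_pi w

theorem continuousAt_mul_log_zero : ContinuousAt (fun w : ℂ => w * log w) 0 := by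
  simpa [ContinuousAt] using tendsto_mul_log_zero

/-- The contour runs through the branch point `0` itself; continuity there allows it to be cut into
its two halves at the zero. -/
theorem continuousAt_stirlingRemainder_zero : ContinuousAt stirlingRemainder 0 := by
  have h1 : ContinuousAt (fun w => logGamma (1 / 2 + w)) 0 := by
    have h2 : (1 / 2 + 0 : ℂ) ∈ slitPlane := by simp [slitPlane]
    exact ContinuousAt.comp (x := (0 : ℂ)) (f := fun w : ℂ => 1 / 2 + w)
      (hasDerivAt_logGamma h2).continuousAt (by fun_prop)
  exact ((h1.sub continuousAt_mul_log_zero).add continuousAt_id).sub continuousAt_const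

theorem stirlingRemainder_sub_add_one {w : ℂ} (hw : w ∈ slitPlane) :
    stirlingRemainder w - stirlingRemainder (w + 1) =
      (w + 1) * log (w + 1) - w * log w - 1 - log (1 / 2 + w) := by
  have := logGamma_add_one (half_add_mem_slitPlane hw)
  rw [stirlingRemainder, stirlingRemainder, ← add_assoc (1 / 2 : ℂ), this]
  ring

/-- This is the error of the midpoint rule for `log` on `[m - 1/2, m + 1/2]`, since `w log w - w` is
a primitive of `log`. With a variable half-length `s`, the error `e` and its derivative `e1` vanish
at `s = 0`, and `e1' = -2s/((m+s)(m-s))`; two applications of the mean value inequality suffice. -/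
theorem norm_midpoint_log_le {m : ℂ} {r : ℝ} (hr : 0 < r)
    (h : ∀ s ∈ Icc (-(1 / 2) : ℝ) (1 / 2), 0 < (m + s).re ∧ r ≤ ‖m + s‖) :
    ‖(m + 1 / 2) * log (m + 1 / 2) - (m - 1 / 2) * log (m - 1 / 2) - 1 - log m‖
      ≤ 1 / r ^ 2 := by
  have hsl : ∀ s ∈ Icc (-(1 / 2) : ℝ) (1 / 2), m + s ∈ slitPlane := fun s hs => Or.inl (h s hs).1
  have hsl' : ∀ s ∈ Icc (-(1 / 2) : ℝ) (1 / 2), m - s ∈ slitPlane := fun s hs => by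
    have := hsl (-s) ⟨by linarith [hs.2], by linarith [hs.1]⟩
    simpa [sub_eq_add_neg] using this
  have hm : m ∈ slitPlane := by simpa using hsl 0 (by norm_num)
  have hd0 : ∀ s : ℝ, HasDerivAt (fun s : ℝ => m + s) 1 s := fun s =>
    ((hasDerivAt_id s).ofReal_comp.const_add m)
  have hd0' : ∀ s : ℝ, HasDerivAt (fun s : ℝ => m - s) (-1) s := fun s =>
    ((hasDerivAt_id s).ofReal_comp.const_sub m)
  have hr' : ∀ s ∈ Icc (0 : ℝ) (1 / 2), r ≤ ‖m + s‖ ∧ r ≤ ‖m - s‖ := by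
    intro s hs
    refine ⟨(h s ⟨by linarith [hs.1], hs.2⟩).2, ?_⟩
    have := (h (-s) ⟨by linarith [hs.2], by linarith [hs.1]⟩).2
    simpa [sub_eq_add_neg] using this
  have hI : ∀ s ∈ Icc (0 : ℝ) (1 / 2), s ∈ Icc (-(1 / 2) : ℝ) (1 / 2) := fun s hs =>
    ⟨by linarith [hs.1], hs.2⟩
  let e1 : ℝ → ℂ := fun s => log (m + s) + log (m - s) - 2 * log m
  let e : ℝ → ℂ := fun s =>
    (m + s) * log (m + s) - (m - s) * log (m - s) - 2 * s - 2 * s * log m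
  have he1d : ∀ s ∈ Icc (0 : ℝ) (1 / 2), HasDerivAt e1 (1 / (m + s) + -1 / (m - s)) s := by
    intro s hs
    exact (((hd0 s).clog_real (hsl s (hI s hs))).add
      ((hd0' s).clog_real (hsl' s (hI s hs)))).sub_const _
  have hed : ∀ s ∈ Icc (0 : ℝ) (1 / 2), HasDerivAt e (e1 s) s := by
    intro s hs
    have h1 := (hd0 s).mul ((hd0 s).clog_real (hsl s (hI s hs)))
    have h2 := (hd0' s).mul ((hd0' s).clog_real (hsl' s (hI s hs)))
    have h3 : HasDerivAt (fun s : ℝ => 2 * (s : ℂ)) (2 * 1) s :=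
      (hasDerivAt_id s).ofReal_comp.const_mul 2
    refine (((h1.sub h2).sub h3).sub (h3.mul_const (log m))).congr_deriv ?_
    have n1 := slitPlane_ne_zero (hsl s (hI s hs))
    have n2 := slitPlane_ne_zero (hsl' s (hI s hs))
    simp only [e1]
    field_simp
    ring
  have hb1 : ∀ s ∈ Icc (0 : ℝ) (1 / 2), ‖e1 s‖ ≤ 1 / r ^ 2 := by
    intro s hs
    have h0 : e1 0 = 0 := by simp [e1]; ring
    have := norm_image_sub_le_of_norm_deriv_le_segment' (f := e1) (C := 1 / r ^ 2)
      (fun x hx => (he1d x hx).hasDerivWithinAt) ?_ s hs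
    · rw [h0, sub_zero, sub_zero] at this
      refine this.trans ?_
      exact mul_le_of_le_one_right (by positivity) (by linarith [hs.2])
    · intro x hx
      have hx' : x ∈ Icc (0 : ℝ) (1 / 2) := Ico_subset_Icc_self hx
      have n1 := slitPlane_ne_zero (hsl x (hI x hx'))
      have n2 := slitPlane_ne_zero (hsl' x (hI x hx'))
      have : 1 / (m + x) + -1 / (m - x) = -(2 * x) / ((m + x) * (m - x)) := by
        field_simp
        ring
      rw [this, norm_div, norm_mul]
      have hx2 : ‖-(2 * (x : ℂ))‖ ≤ 1 := by
        rw [norm_neg, norm_mul, norm_real, Real.norm_of_nonneg hx'.1]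
        norm_num
        linarith [hx'.2]
      rw [sq]
      exact div_le_div₀ zero_le_one hx2 (by positivity)
        (mul_le_mul (hr' x hx').1 (hr' x hx').2 hr.le (norm_nonneg _))
  have := norm_image_sub_le_of_norm_deriv_le_segment' (f := e) (C := 1 / r ^ 2)
    (fun x hx => (hed x hx).hasDerivWithinAt) (fun x hx => hb1 x (Ico_subset_Icc_self hx))
    (1 / 2) (by norm_num)
  have h0 : e 0 = 0 := by simp [e]
  have h12 : e (1 / 2) = (m + 1 / 2) * log (m + 1 / 2) - (m - 1 / 2) * log (m - 1 / 2) - 1 - log m := by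
    simp [e]
  rw [h0, sub_zero, h12] at this
  refine this.trans ?_
  exact mul_le_of_le_one_right (by positivity) (by norm_num)

theorem norm_stirlingRemainder_sub_add_one_le {w : ℂ} (hw : 0 < w.re) :
    ‖stirlingRemainder w - stirlingRemainder (w + 1)‖ ≤ 1 / ‖w‖ ^ 2 := by
  rw [stirlingRemainder_sub_add_one (Or.inl hw)]
  have h0 : w ≠ 0 := by rintro rfl; simp at hw
  -- The midpoint of `w` and `w + 1`; moving to the right from `w` only increases the modulus.
  have := norm_midpoint_log_le (m := 1 / 2 + w) (norm_pos_iff.2 h0) ?_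
  · convert this using 3
    ring_nf
  · intro s hs
    have hre : 0 < (1 / 2 + w + s).re := by
      simp
      linarith [hs.1]
    refine ⟨hre, ?_⟩
    rw [norm_def, norm_def]
    refine Real.sqrt_le_sqrt ?_
    simp only [normSq_apply]
    simp
    nlinarith [hs.1]

/-- In the right half-plane `|w + n|² ≥ |w|² + n² ≥ (|w| + n)²/2`. With `|w| ≥ 1` each step is at
most `4/(|w| + n) - 4/(|w| + n + 1)`, and the sum telescopes. -/
theorem norm_stirlingRemainder_sub_add_nat_le {w : ℂ} (hw : 0 < w.re) (h1 : 1 ≤ ‖w‖) (N : ℕ) :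
    ‖stirlingRemainder w - stirlingRemainder (w + N)‖ ≤ 4 / ‖w‖ - 4 / (‖w‖ + N) := by
  induction N with
  | zero => simp
  | succ n ih =>
    have hre : 0 < (w + n).re := by
      simp
      positivity
    have h2 := norm_stirlingRemainder_sub_add_one_le hre
    have hlow : (‖w‖ + n) ^ 2 ≤ 2 * ‖w + n‖ ^ 2 := by
      have : ‖w‖ ^ 2 + (n : ℝ) ^ 2 ≤ ‖w + n‖ ^ 2 := by
        rw [← normSq_eq_norm_sq, ← normSq_eq_norm_sq, normSq_apply, normSq_apply]
        simp
        nlinarith [mul_nonneg hw.le (n.cast_nonneg : (0 : ℝ) ≤ n)]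
      nlinarith [sq_nonneg (‖w‖ - n)]
    have hn : (0 : ℝ) ≤ n := n.cast_nonneg
    have h3 : 1 / ‖w + n‖ ^ 2 ≤ 4 / (‖w‖ + n) - 4 / (‖w‖ + (n + 1 : ℕ)) := by
      have hp : 0 < ‖w‖ + n := by linarith
      have : 4 / (‖w‖ + n) - 4 / (‖w‖ + (n + 1 : ℕ)) = 4 / ((‖w‖ + n) * (‖w‖ + n + 1)) := by
        push_cast
        field_simp
        ring
      rw [this, div_le_div_iff₀ (by nlinarith) (by positivity)]
      nlinarith
    calc ‖stirlingRemainder w - stirlingRemainder (w + (n + 1 : ℕ))‖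
        = ‖(stirlingRemainder w - stirlingRemainder (w + n)) +
          (stirlingRemainder (w + n) - stirlingRemainder (w + n + 1))‖ := by
          push_cast
          rw [add_assoc w]
          ring_nf
      _ ≤ _ := (norm_add_le _ _).trans (by linarith)

theorem exp_stirlingRemainder {w : ℂ} (hw : w ∈ slitPlane) :
    exp (stirlingRemainder w) =
      Gamma (1 / 2 + w) * exp (w - w * log w) / (Real.sqrt (2 * Real.pi) : ℝ) := by
  have h1 : exp (Real.log (2 * Real.pi) / 2 : ℂ) = (Real.sqrt (2 * Real.pi) : ℝ) := by
    have : (Real.log (2 * Real.pi) / 2 : ℂ) = (Real.log (2 * Real.pi) / 2 : ℝ) := by push_cast; rfl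
    rw [this, ← Real.log_sqrt (by positivity), ← ofReal_exp, Real.exp_log (by positivity)]
  rw [← h1, ← exp_logGamma (half_add_mem_slitPlane hw), ← exp_add, ← exp_sub, stirlingRemainder]
  ring_nf

theorem Gamma_add_nat (s : ℂ) (hs : s ∈ slitPlane) (n : ℕ) :
    Gamma (s + n) = Gamma s * ∏ j ∈ Finset.range n, (s + j) := by
  induction n with
  | zero => simp
  | succ n ih =>
    have : s + n ∈ slitPlane := by simpa using add_mem_slitPlane hs (n.cast_nonneg : (0 : ℝ) ≤ n)
    rw [Finset.prod_range_succ, ← mul_assoc, ← ih, Nat.cast_succ, ← add_assoc,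
      Gamma_add_one _ (slitPlane_ne_zero this), mul_comm]

theorem tendsto_mul_log_one_add_div (a b : ℂ) :
    Tendsto (fun n : ℕ => (n + b) * log (1 + a / n)) atTop (𝓝 a) := by
  have h0 : Tendsto (fun n : ℕ => a / (n : ℂ)) atTop (𝓝 0) := by
    have := (tendsto_inv_atTop_nhds_zero_nat (𝕜 := ℂ)).const_mul a
    simpa [div_eq_mul_inv] using this
  have h1 : Tendsto (fun n : ℕ => (n : ℂ) * log (1 + a / n)) atTop (𝓝 a) := by
    apply tendsto_nat_mul_log_one_add_of_tendsto
    refine tendsto_const_nhds.congr' ?_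
    filter_upwards [eventually_ne_atTop 0] with n hn
    have : (n : ℂ) ≠ 0 := by exact_mod_cast hn
    field_simp
  have h2 : Tendsto (fun n : ℕ => log (1 + a / n)) atTop (𝓝 0) := by
    have : Tendsto (fun n : ℕ => 1 + a / n) atTop (𝓝 1) := by
      simpa using h0.const_add (1 : ℂ)
    simpa using this.clog one_mem_slitPlane
  have := h1.add (h2.const_mul b)
  simp only [mul_zero, add_zero] at this
  refine this.congr fun n => ?_
  ring

/-- Euler's limit formula for `Γ` is compared with Stirling's formula for `n!`. With `s = 1/2 + w`
the exponential is the product of `Γ(s)/GammaSeq s n`, of `stirlingSeq n/√π` and of `exp (w + 1 - (n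
+ w + 1) log (1 + (w + 1)/n))`, each of which tends to `1`. This determines the limit of the
remainder only modulo `2πi`. -/
theorem tendsto_exp_stirlingRemainder {w : ℂ} (hw : 0 < w.re) :
    Tendsto (fun n : ℕ => exp (stirlingRemainder (w + 1 + n))) atTop (𝓝 1) := by
  set s : ℂ := 1 / 2 + w with hsdef
  have hs : s ∈ slitPlane := half_add_mem_slitPlane (Or.inl hw)
  have hG : Gamma s ≠ 0 := Gamma_ne_zero (ne_neg_natCast_of_mem_slitPlane hs)
  have hpi : (Real.sqrt Real.pi : ℂ) ≠ 0 := by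
    exact_mod_cast (Real.sqrt_pos.2 Real.pi_pos).ne'
  have l1 : Tendsto (fun n : ℕ => Gamma s / GammaSeq s n) atTop (𝓝 1) := by
    have := (tendsto_const_nhds (x := Gamma s)).div (GammaSeq_tendsto_Gamma s) hG
    simpa [hG, Pi.div_def] using this
  have l2 : Tendsto (fun n : ℕ => (Stirling.stirlingSeq n : ℂ) / (Real.sqrt Real.pi : ℂ)) atTop
      (𝓝 1) := by
    have := (continuous_ofReal.tendsto _).comp Stirling.tendsto_stirlingSeq_sqrt_pi
    have := this.div_const (Real.sqrt Real.pi : ℂ)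
    simpa [Function.comp_def, hpi] using this
  have l3 : Tendsto (fun n : ℕ => exp (w + 1 - (n + (w + 1)) * log (1 + (w + 1) / n))) atTop
      (𝓝 1) := by
    have := (continuous_exp.tendsto _).comp
      ((tendsto_mul_log_one_add_div (w + 1) (w + 1)).const_sub (w + 1))
    simpa [Function.comp_def] using this
  have l := (l1.mul l2).mul l3
  simp only [mul_one] at l
  refine l.congr' ?_
  filter_upwards [eventually_ne_atTop 0] with n hn
  have hn' : (n : ℂ) ≠ 0 := by exact_mod_cast hn
  have hnpos : (0 : ℝ) < n := by exact_mod_cast Nat.pos_of_ne_zero hn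
  have hre : 0 < (w + 1 + n).re := by simp; positivity
  have hprod : ∏ j ∈ Finset.range (n + 1), (s + j) ≠ 0 := by
    rw [Finset.prod_ne_zero_iff]
    intro j _
    have : s + j ∈ slitPlane := by simpa using add_mem_slitPlane hs (j.cast_nonneg : (0 : ℝ) ≤ j)
    exact slitPlane_ne_zero this
  have hfac : ((n.factorial : ℝ) : ℂ) ≠ 0 := by exact_mod_cast n.factorial_ne_zero
  have hst : Stirling.stirlingSeq n * (Real.sqrt 2 * Real.sqrt n * (n / Real.exp 1) ^ n)
      = n.factorial := by
    rw [Stirling.stirlingSeq, Real.sqrt_mul (by norm_num)]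
    have : 0 < Real.sqrt 2 * Real.sqrt n * (n / Real.exp 1) ^ n := by positivity
    field_simp
  have hpow : (((n / Real.exp 1) ^ n : ℝ) : ℂ) = exp (n * Real.log n - n) := by
    have : ((n : ℝ) / Real.exp 1) ^ n = Real.exp (n * Real.log n - n) := by
      rw [Real.exp_sub, div_pow, ← Real.exp_nat_mul, mul_one, mul_comm (n : ℝ), Real.exp_mul,
        Real.exp_log hnpos, Real.rpow_natCast]
    rw [this]
    push_cast
    rfl
  have hsq : ((Real.sqrt n : ℝ) : ℂ) = exp (Real.log n / 2) := by
    have : Real.sqrt n = Real.exp (Real.log n / 2) := by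
      rw [← Real.log_sqrt hnpos.le, Real.exp_log (Real.sqrt_pos.2 hnpos)]
    rw [this]
    push_cast
    rfl
  have hlog : log (w + 1 + n) = Real.log n + log (1 + (w + 1) / n) := by
    have h1 : (w + 1 + n : ℂ) = ((n : ℝ) : ℂ) * (1 + (w + 1) / n) := by
      push_cast
      field_simp
      ring
    rw [h1, log_ofReal_mul hnpos]
    intro h
    rw [h, mul_zero] at h1
    rw [h1] at hre
    simp at hre
  have hGam : Gamma (1 / 2 + (w + 1 + n)) = Gamma s * ∏ j ∈ Finset.range (n + 1), (s + j) := by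
    rw [← Gamma_add_nat s hs (n + 1)]
    congr 1
    rw [hsdef]
    push_cast
    ring
  have hcpow : (n : ℂ) ^ s = exp (Real.log n * s) := by
    rw [cpow_def_of_ne_zero hn', natCast_log]
  have hfac' : ((n.factorial : ℕ) : ℂ) = Stirling.stirlingSeq n *
      (Real.sqrt 2 * exp (Real.log n / 2) * exp (n * Real.log n - n)) := by
    rw [← hpow, ← hsq]
    exact_mod_cast hst.symm
  have hS0 : (Stirling.stirlingSeq n : ℂ) ≠ 0 := by
    intro h
    rw [h, zero_mul] at hfac'
    exact hfac (by exact_mod_cast hfac')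
  have h2 : (Real.sqrt 2 : ℂ) ≠ 0 := by
    exact_mod_cast (Real.sqrt_pos.2 two_pos).ne'
  rw [exp_stirlingRemainder (Or.inl hre), hGam, GammaSeq, Real.sqrt_mul (by norm_num), ofReal_mul,
    hlog, hcpow, hfac']
  have hE : exp (w + 1 + n - (w + 1 + n) * (Real.log n + log (1 + (w + 1) / n))) =
      exp (w + 1 - (n + (w + 1)) * log (1 + (w + 1) / n)) *
        (exp (Real.log n * s) * exp (Real.log n / 2) * exp (n * Real.log n - n))⁻¹ := by
    rw [← exp_add, ← exp_add, ← exp_neg, ← exp_add, hsdef]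
    ring_nf
  rw [hE]
  field_simp

theorem norm_stirlingRemainder_sub_tail_le {w : ℂ} (hw : 0 < w.re) {N M : ℕ} (h : N ≤ M) :
    ‖stirlingRemainder (w + 1 + N) - stirlingRemainder (w + 1 + M)‖ ≤ 4 / (N + 1) := by
  obtain ⟨k, rfl⟩ := Nat.exists_eq_add_of_le h
  have hre : 0 < (w + 1 + N).re := by simp; positivity
  have hn : (N + 1 : ℝ) ≤ ‖w + 1 + N‖ := by
    refine le_trans ?_ (re_le_norm _)
    simp
    linarith
  have h1 : (1 : ℝ) ≤ ‖w + 1 + N‖ := le_trans (by simp) hn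
  have := norm_stirlingRemainder_sub_add_nat_le hre h1 k
  have h2 : (0 : ℝ) ≤ 4 / (‖w + 1 + N‖ + k) := by positivity
  have h3 : 4 / ‖w + 1 + N‖ ≤ 4 / (N + 1 : ℝ) := by gcongr
  rw [Nat.cast_add, ← add_assoc]
  linarith

theorem stirlingRemainder_ofReal {x : ℝ} (hx : 0 < x) : (stirlingRemainder x).im = 0 := by
  have h := conj_logGamma (z := 1 / 2 + x) (half_add_mem_slitPlane (Or.inl (by simpa using hx)))
  have h3 : (starRingEnd ℂ) (1 / 2 + x : ℂ) = 1 / 2 + x := by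
    have : (1 / 2 + x : ℂ) = ((1 / 2 + x : ℝ) : ℂ) := by push_cast; rfl
    rw [this, conj_ofReal]
  rw [h3, conj_eq_iff_im] at h
  rw [stirlingRemainder, ← ofReal_log hx.le]
  have : (Real.log (2 * Real.pi) / 2 : ℂ) = (Real.log (2 * Real.pi) / 2 : ℝ) := by push_cast; rfl
  rw [this]
  simp only [sub_im, add_im, h, ← ofReal_mul, ofReal_im]
  simp

/-- The sequence is Cauchy uniformly in `w`, so its limit is continuous on the half-plane, with
exponential `1`. At `w = 1` the limit is real and hence zero; by connectedness it is zero
everywhere. -/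
theorem tendsto_stirlingRemainder {w : ℂ} (hw : 0 < w.re) :
    Tendsto (fun n : ℕ => stirlingRemainder (w + 1 + n)) atTop (𝓝 0) := by
  have hlim : ∀ w : ℂ, ∃ ℓ : ℂ, 0 < w.re →
      Tendsto (fun n : ℕ => stirlingRemainder (w + 1 + n)) atTop (𝓝 ℓ) := by
    intro w
    by_cases hw : 0 < w.re
    · have : CauchySeq (fun n : ℕ => stirlingRemainder (w + 1 + n)) := by
        refine cauchySeq_of_le_tendsto_0' (fun n : ℕ => 4 / ((n : ℝ) + 1)) ?_ ?_
        · intro n m hnm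
          rw [dist_eq_norm]
          exact norm_stirlingRemainder_sub_tail_le hw hnm
        · simpa [div_eq_mul_inv] using
            (tendsto_one_div_add_atTop_nhds_zero_nat (𝕜 := ℝ)).const_mul 4
      obtain ⟨ℓ, hℓ⟩ := cauchySeq_tendsto_of_complete this
      exact ⟨ℓ, fun _ => hℓ⟩
    · exact ⟨0, fun h => absurd h hw⟩
  choose ℓ hℓ using hlim
  have hbound : ∀ w : ℂ, 0 < w.re → ∀ n : ℕ,
      ‖stirlingRemainder (w + 1 + n) - ℓ w‖ ≤ 4 / ((n : ℝ) + 1) := by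
    intro w hw n
    refine le_of_tendsto ((hℓ w hw).const_sub _).norm ?_
    filter_upwards [eventually_ge_atTop n] with m hm
    exact norm_stirlingRemainder_sub_tail_le hw hm
  have hunif : TendstoUniformlyOn (fun (n : ℕ) w => stirlingRemainder (w + 1 + n)) ℓ atTop
      {w : ℂ | 0 < w.re} := by
    rw [Metric.tendstoUniformlyOn_iff]
    intro ε hε
    have : Tendsto (fun n : ℕ => 4 / ((n : ℝ) + 1)) atTop (𝓝 0) := by
      simpa [div_eq_mul_inv] using (tendsto_one_div_add_atTop_nhds_zero_nat (𝕜 := ℝ)).const_mul 4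
    filter_upwards [this.eventually (gt_mem_nhds hε)] with n hn w hw
    rw [dist_comm, dist_eq_norm]
    exact (hbound w hw n).trans_lt hn
  have hc : ContinuousOn ℓ {w : ℂ | 0 < w.re} := by
    refine hunif.continuousOn (Frequently.of_forall fun n w hw => ?_)
    have hre : 0 < (w + 1 + n).re := by
      have : 0 < w.re := hw
      simp; positivity
    exact (ContinuousAt.comp (f := fun w : ℂ => w + 1 + n) (x := w)
      (differentiableAt_stirlingRemainder (Or.inl hre)).continuousAt
      (by fun_prop)).continuousWithinAt
  have hexp : ∀ w ∈ {w : ℂ | 0 < w.re}, exp (ℓ w) = exp 0 := by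
    intro w hw
    rw [exp_zero]
    exact tendsto_nhds_unique ((continuous_exp.tendsto _).comp (hℓ w hw))
      (tendsto_exp_stirlingRemainder hw)
  have h1 : ℓ 1 = 0 := by
    have hre : (0 : ℝ) < (1 : ℂ).re := by simp
    have him : (ℓ 1).im = 0 := by
      refine tendsto_nhds_unique ((continuous_im.tendsto _).comp (hℓ 1 hre)) ?_
      refine tendsto_const_nhds.congr fun n => ?_
      have := stirlingRemainder_ofReal (x := 1 + 1 + n) (by positivity)
      push_cast at this
      exact this.symm
    have he := hexp 1 hre
    obtain ⟨r, hr⟩ : ∃ r : ℝ, ℓ 1 = r := ⟨(ℓ 1).re, by apply Complex.ext <;> simp [him]⟩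
    rw [hr, exp_zero, ← ofReal_exp, ← ofReal_one, ofReal_inj, Real.exp_eq_one_iff] at he
    simp [hr, he]
  have := eqOn_of_exp_eqOn (convex_halfSpace_re_gt 0).isPreconnected hc continuousOn_const hexp
    (a := 1) (by simp) h1 w hw
  rw [← this]
  exact hℓ w hw

/-- Stirling's formula in the right half-plane. -/
theorem norm_stirlingRemainder_le {w : ℂ} (hw : 0 ≤ w.re) (h1 : 1 ≤ ‖w‖) :
    ‖stirlingRemainder w‖ ≤ 4 / ‖w‖ := by
  -- In the open half-plane the telescoped bound is passed to the limit, in which the far remainder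
  -- disappears.
  have hpos : ∀ w : ℂ, 0 < w.re → 1 ≤ ‖w‖ → ‖stirlingRemainder w‖ ≤ 4 / ‖w‖ := by
    intro w hw h1
    have ht : Tendsto (fun n : ℕ => stirlingRemainder w - stirlingRemainder (w + 1 + n)) atTop
        (𝓝 (stirlingRemainder w - 0)) := (tendsto_stirlingRemainder hw).const_sub _
    rw [sub_zero] at ht
    refine le_of_tendsto ht.norm (Eventually.of_forall fun n => ?_)
    have := norm_stirlingRemainder_sub_add_nat_le hw h1 (n + 1)
    have h2 : (0 : ℝ) ≤ 4 / (‖w‖ + (n + 1 : ℕ)) := by positivity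
    have h3 : w + 1 + n = w + (n + 1 : ℕ) := by push_cast; ring
    rw [h3]
    linarith
  rcases hw.lt_or_eq with hw | hw
  · exact hpos w hw h1
  -- On the imaginary axis the bound is inherited from `w + x` as `x` decreases to `0`.
  have hsl : w ∈ slitPlane := by
    right
    intro him
    have : w = 0 := Complex.ext hw.symm him
    rw [this, norm_zero] at h1
    linarith
  have hpath : Tendsto (fun x : ℝ => w + x) (𝓝[>] 0) (𝓝 w) := by
    have : ContinuousAt (fun x : ℝ => w + x) 0 := by fun_prop
    have := this.tendsto
    simp only [ofReal_zero, add_zero] at this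
    exact this.mono_left nhdsWithin_le_nhds
  have hne : ‖w‖ ≠ 0 := by linarith
  refine le_of_tendsto_of_tendsto
    (((differentiableAt_stirlingRemainder hsl).continuousAt.tendsto.comp hpath).norm)
    ((tendsto_const_nhds (x := (4 : ℝ))).div hpath.norm hne) ?_
  filter_upwards [self_mem_nhdsWithin] with x hx
  have hx : 0 < x := hx
  refine hpos _ (by simp [← hw, hx]) (h1.trans ?_)
  rw [norm_def, norm_def]
  refine Real.sqrt_le_sqrt ?_
  simp [normSq_apply, ← hw]
  nlinarith

/-! ### The thermal logarithm and its splitting by the reflection formula -/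

/-- The even function `ln(1 + exp(-|x|))` of a real variable, continued analytically to the two
open half-planes. -/
noncomputable def thermalLog (x : ℂ) : ℂ :=
  if 0 ≤ x.re then log (1 + exp (-x)) else log (1 + exp x)

theorem thermalLog_of_nonneg {x : ℂ} (h : 0 ≤ x.re) : thermalLog x = log (1 + exp (-x)) :=
  if_pos h

theorem thermalLog_of_neg {x : ℂ} (h : x.re < 0) : thermalLog x = log (1 + exp x) :=
  if_neg (not_le.2 h)

theorem thermalLog_zero : thermalLog 0 = Real.log 2 := by
  rw [thermalLog_of_nonneg (by simp), neg_zero, exp_zero, ofReal_log (by norm_num)]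
  norm_num

/-- Nonzero points of the imaginary axis are excluded: there the definition uses the formula of the
right half-plane for both `x` and `-x`, and evenness fails in general. -/
theorem thermalLog_neg {x : ℂ} (h : x.re ≠ 0 ∨ x = 0) : thermalLog (-x) = thermalLog x := by
  rcases h with h | rfl
  · rcases lt_or_gt_of_ne h with h | h
    · rw [thermalLog_of_neg h, thermalLog_of_nonneg (by simpa using h.le), neg_neg]
    · rw [thermalLog_of_nonneg h.le, thermalLog_of_neg (by simpa using h)]
  · simp

theorem one_add_exp_neg_mem_slitPlane {x : ℂ} (h : 0 < x.re) : 1 + exp (-x) ∈ slitPlane := by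
  left
  have : ‖exp (-x)‖ < 1 := by
    rw [norm_exp, Real.exp_lt_one_iff]
    simpa using h
  have h2 := (abs_lt.1 ((abs_re_le_norm (exp (-x))).trans_lt this)).1
  simp only [add_re, one_re]
  linarith

/-- The argument of the Gamma function attached to the point `x` of the plane. -/
theorem div_two_pi_I_re (x : ℂ) : (x / (2 * Real.pi * I)).re = x.im / (2 * Real.pi) := by
  have : x / (2 * Real.pi * I) = x * (-I) / (2 * Real.pi : ℝ) := by
    have : (Real.pi : ℂ) ≠ 0 := by exact_mod_cast Real.pi_ne_zero
    push_cast
    field_simp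
    rw [I_sq]
    ring
  rw [this, div_ofReal_re]
  simp

theorem div_two_pi_I_im (x : ℂ) : (x / (2 * Real.pi * I)).im = -x.re / (2 * Real.pi) := by
  have : x / (2 * Real.pi * I) = x * (-I) / (2 * Real.pi : ℝ) := by
    have : (Real.pi : ℂ) ≠ 0 := by exact_mod_cast Real.pi_ne_zero
    push_cast
    field_simp
    rw [I_sq]
    ring
  rw [this, div_ofReal_im]
  simp

theorem div_two_pi_I_mem_slitPlane {x : ℂ} (h : x.re ≠ 0) : x / (2 * Real.pi * I) ∈ slitPlane := by
  right
  rw [div_two_pi_I_im]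
  have := Real.pi_pos
  exact div_ne_zero (neg_ne_zero.2 h) (by positivity)

theorem neg_div_two_pi_I_mem_slitPlane {x : ℂ} (h : x.re ≠ 0) :
    -(x / (2 * Real.pi * I)) ∈ slitPlane := by
  rw [← neg_div]
  exact div_two_pi_I_mem_slitPlane (by simpa using h)

/-- With `x = 2πi w`, the reflection formula gives `Γ(1/2 + w) Γ(1/2 - w) = π / cos(πw)`, and `2
cos(πw) = e^{iπw} (1 + e^{-x})`. The factor `e^{iπw}` is cancelled by the elementary terms of the
two remainders, because `log(-w) = log w + πi` for `Im w < 0`. -/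
theorem exp_stirlingRemainder_add_neg {x : ℂ} (h : 0 < x.re) :
    exp (stirlingRemainder (x / (2 * Real.pi * I)) + stirlingRemainder (-(x / (2 * Real.pi * I))))
      = exp (-log (1 + exp (-x))) := by
  have hpi : (Real.pi : ℂ) ≠ 0 := by exact_mod_cast Real.pi_ne_zero
  set w := x / (2 * Real.pi * I) with hw
  have hx : x = 2 * Real.pi * I * w := by
    rw [hw]
    field_simp
  have him : w.im < 0 := by
    rw [hw, div_two_pi_I_im]
    exact div_neg_of_neg_of_pos (by linarith) (by positivity)
  have h1 : w ∈ slitPlane := Or.inr him.ne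
  have h2 : -w ∈ slitPlane := Or.inr (by simpa using him.ne)
  have hlog : log (-w) = log w + Real.pi * I := by
    rw [log, log, norm_neg, arg_neg_eq_arg_add_pi_of_im_neg him]
    push_cast
    ring
  have hn := one_add_exp_neg_mem_slitPlane h
  rw [exp_add, exp_stirlingRemainder h1, exp_stirlingRemainder h2, exp_neg,
    exp_log (slitPlane_ne_zero hn), hlog]
  have hG : Gamma (1 / 2 + w) * Gamma (1 / 2 + -w) = Real.pi / cos (Real.pi * w) := by
    have := Gamma_mul_Gamma_one_sub (1 / 2 + w)
    rw [show 1 - (1 / 2 + w) = 1 / 2 + -w by ring] at this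
    rw [this, show (Real.pi : ℂ) * (1 / 2 + w) = Real.pi * w + Real.pi / 2 by ring,
      sin_add_pi_div_two]
  have hs : ((Real.sqrt (2 * Real.pi) : ℝ) : ℂ) * (Real.sqrt (2 * Real.pi) : ℝ) = 2 * Real.pi := by
    rw [← ofReal_mul, Real.mul_self_sqrt (by positivity)]
    push_cast
    rfl
  have hE : exp (w - w * log w) * exp (-w - -w * (log w + Real.pi * I)) = exp (Real.pi * w * I) := by
    rw [← exp_add]
    ring_nf
  have hcos : 2 * cos (Real.pi * w) = exp (Real.pi * w * I) * (1 + exp (-x)) := by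
    rw [cos, hx, mul_add, ← exp_add]
    ring_nf
  have hc : cos (Real.pi * w) ≠ 0 := by
    intro h0
    rw [h0, mul_zero] at hcos
    exact mul_ne_zero (exp_ne_zero _) (slitPlane_ne_zero hn) hcos.symm
  calc _ = (Gamma (1 / 2 + w) * Gamma (1 / 2 + -w)) *
        (exp (w - w * log w) * exp (-w - -w * (log w + Real.pi * I))) /
        (((Real.sqrt (2 * Real.pi) : ℝ) : ℂ) * (Real.sqrt (2 * Real.pi) : ℝ)) := by ring
    _ = exp (Real.pi * w * I) / (2 * cos (Real.pi * w)) := by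
        rw [hG, hE, hs]
        field_simp
    _ = (1 + exp (-x))⁻¹ := by
        rw [hcos]
        have := slitPlane_ne_zero hn
        have := exp_ne_zero (Real.pi * w * I)
        field_simp

theorem continuousOn_log_one_add_exp_neg :
    ContinuousOn (fun x : ℂ => log (1 + exp (-x))) {x | 0 < x.re} := by
  intro x hx
  have hc : ContinuousAt (fun x : ℂ => 1 + exp (-x)) x := by fun_prop
  exact (hc.clog (one_add_exp_neg_mem_slitPlane hx)).continuousWithinAt

theorem norm_log_one_add_exp_neg_le {x : ℂ} (h : 1 ≤ x.re) :
    ‖log (1 + exp (-x))‖ ≤ 2 * Real.exp (-x.re) := by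
  have h1 : ‖exp (-x)‖ = Real.exp (-x.re) := by rw [norm_exp, neg_re]
  have h2 : Real.exp (-x.re) ≤ 1 / 2 := by
    have : Real.exp (-x.re) ≤ Real.exp (-1) := Real.exp_le_exp.2 (by linarith)
    refine this.trans ?_
    rw [Real.exp_neg, ← one_div]
    exact one_div_le_one_div_of_le two_pos (by linarith [Real.add_one_le_exp 1])
  have := norm_log_one_add_half_le_self (z := exp (-x)) (by rw [h1]; exact h2)
  rw [h1] at this
  have := Real.exp_pos (-x.re)
  linarith

theorem norm_thermalLog_le {x : ℂ} (h : 1 ≤ |x.re|) :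
    ‖thermalLog x‖ ≤ 2 * Real.exp (-|x.re|) := by
  rcases lt_or_ge x.re 0 with h0 | h0
  · rw [abs_of_neg h0] at h ⊢
    have := norm_log_one_add_exp_neg_le (x := -x) (by simpa using h)
    rw [thermalLog_of_neg h0]
    simpa using this
  · rw [abs_of_nonneg h0] at h ⊢
    rw [thermalLog_of_nonneg h0]
    exact norm_log_one_add_exp_neg_le h

/-- The exponentials agree, so on the half-plane the two sides differ by a constant. Both tend to
`0` along the positive integers, by Stirling's formula on the imaginary `w`-axis, so the constant
vanishes. -/
theorem stirlingRemainder_add_neg_of_re_pos {x : ℂ} (h : 0 < x.re) :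
    stirlingRemainder (x / (2 * Real.pi * I)) + stirlingRemainder (-(x / (2 * Real.pi * I)))
      = -log (1 + exp (-x)) := by
  set f : ℂ → ℂ := fun x =>
    stirlingRemainder (x / (2 * Real.pi * I)) + stirlingRemainder (-(x / (2 * Real.pi * I)))
  have hf : ContinuousOn f {x | 0 < x.re} := by
    intro x hx
    have hx : 0 < x.re := hx
    refine (ContinuousAt.add ?_ ?_).continuousWithinAt
    · exact ContinuousAt.comp (f := fun x : ℂ => x / (2 * Real.pi * I)) (x := x)
        (differentiableAt_stirlingRemainder (div_two_pi_I_mem_slitPlane hx.ne')).continuousAt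
        (by fun_prop)
    · exact ContinuousAt.comp (f := fun x : ℂ => -(x / (2 * Real.pi * I))) (x := x)
        (differentiableAt_stirlingRemainder (neg_div_two_pi_I_mem_slitPlane hx.ne')).continuousAt
        (by fun_prop)
  have hd : ∀ x ∈ {x : ℂ | 0 < x.re}, exp (f x) = exp (-log (1 + exp (-x))) := fun x hx =>
    exp_stirlingRemainder_add_neg hx
  -- the two logarithms differ by a constant, which vanishes in the limit of large `x`
  have hlim : Tendsto (fun n : ℕ => f (n + 1 : ℕ) + log (1 + exp (-((n + 1 : ℕ) : ℂ)))) atTop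
      (𝓝 0) := by
    have hb : Tendsto (fun n : ℕ => 16 * Real.pi / ((n + 1 : ℕ) : ℝ) +
        2 * Real.exp (-((n + 1 : ℕ) : ℝ))) atTop (𝓝 0) := by
      have h1 : Tendsto (fun n : ℕ => ((n + 1 : ℕ) : ℝ)) atTop atTop :=
        tendsto_natCast_atTop_atTop.comp (tendsto_add_atTop_nat 1)
      have := (h1.const_div_atTop (16 * Real.pi)).add
        ((Real.tendsto_exp_neg_atTop_nhds_zero.comp h1).const_mul 2)
      simpa using this
    rw [tendsto_zero_iff_norm_tendsto_zero]
    refine squeeze_zero' (Eventually.of_forall fun _ => norm_nonneg _) ?_ hb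
    -- Then `y ≥ 8 > 2π`, so that `w = y/(2πi)` has modulus at least `1`, as Stirling's formula
    -- requires.
    filter_upwards [eventually_ge_atTop 7] with n hn
    set y : ℝ := ((n + 1 : ℕ) : ℝ) with hy
    have hy8 : 8 ≤ y := by
      rw [hy]
      push_cast
      have : (7 : ℝ) ≤ n := by exact_mod_cast hn
      linarith
    have hyc : (((n + 1 : ℕ) : ℕ) : ℂ) = (y : ℂ) := by simp [hy]
    rw [hyc]
    have hnw : ‖(y : ℂ) / (2 * Real.pi * I)‖ = y / (2 * Real.pi) := by
      simp [abs_of_nonneg (by linarith : 0 ≤ y), Real.pi_pos.le, abs_of_nonneg]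
    have hge : 1 ≤ y / (2 * Real.pi) := by
      rw [le_div_iff₀ (by positivity)]
      linarith [Real.pi_lt_four]
    have hb1 := norm_stirlingRemainder_le (w := (y : ℂ) / (2 * Real.pi * I))
      (by rw [div_two_pi_I_re]; simp) (by rw [hnw]; exact hge)
    have hb2 := norm_stirlingRemainder_le (w := -((y : ℂ) / (2 * Real.pi * I)))
      (by rw [neg_re, div_two_pi_I_re]; simp) (by rw [norm_neg, hnw]; exact hge)
    have hb3 := norm_log_one_add_exp_neg_le (x := (y : ℂ)) (by simp; linarith)
    rw [norm_neg] at hb2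
    rw [hnw] at hb1 hb2
    have e : 4 / (y / (2 * Real.pi)) + 4 / (y / (2 * Real.pi)) = 16 * Real.pi / y := by
      field_simp
      ring
    rw [← e]
    rw [ofReal_re] at hb3
    exact (norm_add_le _ _).trans (add_le_add ((norm_add_le _ _).trans (add_le_add hb1 hb2)) hb3)
  have hpre : IsPreconnected {x : ℂ | 0 < x.re} := (convex_halfSpace_re_gt 0).isPreconnected
  have h1m : (1 : ℂ) ∈ {x : ℂ | 0 < x.re} := by simp
  set g : ℂ → ℂ := fun x => -log (1 + exp (-x))
  have hg : ContinuousOn g {x | 0 < x.re} := continuousOn_log_one_add_exp_neg.neg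
  have hconst := eqOn_of_exp_eqOn hpre (f := f) (g := fun x => g x + (f 1 - g 1)) hf
    (hg.add continuousOn_const) (fun x hx => by
      rw [exp_add (g x), exp_sub, hd x hx, hd 1 h1m, div_self (exp_ne_zero _), mul_one]) h1m
      (by simp)
  have h0 : f 1 - g 1 = 0 := by
    refine tendsto_nhds_unique (tendsto_const_nhds.congr fun n => ?_) hlim
    have := hconst ((n + 1 : ℕ) : ℂ) (by simp; positivity)
    rw [this]
    simp [g]
  have := hconst x h
  simpa [h0] using this

theorem stirlingRemainder_zero : 2 * stirlingRemainder 0 = -Real.log 2 := by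
  have hpath : Tendsto (fun x : ℝ => (x : ℂ)) (𝓝[>] 0) (𝓝 0) := by
    have : ContinuousAt (fun x : ℝ => (x : ℂ)) 0 := by fun_prop
    have := this.tendsto
    simp only [ofReal_zero] at this
    exact this.mono_left nhdsWithin_le_nhds
  have h1 : Tendsto (fun x : ℝ => stirlingRemainder ((x : ℂ) / (2 * Real.pi * I)) +
      stirlingRemainder (-((x : ℂ) / (2 * Real.pi * I)))) (𝓝[>] 0)
      (𝓝 (stirlingRemainder 0 + stirlingRemainder 0)) := by
    have ha : Tendsto (fun x : ℝ => (x : ℂ) / (2 * Real.pi * I)) (𝓝[>] 0) (𝓝 0) := by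
      simpa using hpath.div_const (2 * Real.pi * I)
    have hb : Tendsto (fun x : ℝ => -((x : ℂ) / (2 * Real.pi * I))) (𝓝[>] 0) (𝓝 0) := by
      simpa using ha.neg
    exact (continuousAt_stirlingRemainder_zero.tendsto.comp ha).add
      (continuousAt_stirlingRemainder_zero.tendsto.comp hb)
  have h2 : Tendsto (fun x : ℝ => -log (1 + exp (-(x : ℂ)))) (𝓝[>] 0) (𝓝 (-Real.log 2)) := by
    have hc : ContinuousAt (fun x : ℂ => -log (1 + exp (-x))) 0 := by
      refine (ContinuousAt.clog (by fun_prop) ?_).neg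
      simp [slitPlane]
    have := hc.tendsto.comp hpath
    rw [ofReal_log (by norm_num)]
    have e : -log ((2 : ℝ) : ℂ) = -log (1 + exp (-0)) := by
      rw [neg_zero, exp_zero]
      norm_num
    rw [e]
    exact this
  have := tendsto_nhds_unique h1 (h2.congr' ?_)
  · rw [two_mul, this]
  · filter_upwards [self_mem_nhdsWithin] with x hx
    exact (stirlingRemainder_add_neg_of_re_pos (x := (x : ℂ)) (by simpa using hx)).symm

/-- The additive decomposition of `ln(1 + exp(-|x|))` into two functions holomorphic off half of
the imaginary axis. -/
theorem thermalLog_eq {x : ℂ} (h : x.re ≠ 0 ∨ x = 0) :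
    thermalLog x = -(stirlingRemainder (x / (2 * Real.pi * I)) +
      stirlingRemainder (-(x / (2 * Real.pi * I)))) := by
  rcases h with h | rfl
  · rcases lt_or_gt_of_ne h with h | h
    · have := stirlingRemainder_add_neg_of_re_pos (x := -x) (by simpa using h)
      rw [neg_div, neg_neg, neg_neg] at this
      rw [thermalLog_of_neg h, add_comm (stirlingRemainder _), this, neg_neg]
    · rw [thermalLog_of_nonneg h.le, stirlingRemainder_add_neg_of_re_pos h, neg_neg]
  · rw [thermalLog_zero, zero_div, neg_zero, ← two_mul, stirlingRemainder_zero, neg_neg]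

/-- Continuity at `0` across the two half-planes is not apparent from the case distinction; it is
read off from the splitting into remainders, which are continuous at `0`. -/
theorem continuousOn_thermalLog : ContinuousOn thermalLog {x | x.re ≠ 0 ∨ x = 0} := by
  refine ContinuousOn.congr (f := fun x => -(stirlingRemainder (x / (2 * Real.pi * I)) +
      stirlingRemainder (-(x / (2 * Real.pi * I))))) ?_ fun x hx => thermalLog_eq hx
  have hc : ∀ w : ℂ, w ∈ slitPlane ∨ w = 0 → ContinuousAt stirlingRemainder w := by
    rintro w (hw | rfl)
    · exact (differentiableAt_stirlingRemainder hw).continuousAt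
    · exact continuousAt_stirlingRemainder_zero
  intro x hx
  refine ((ContinuousAt.add ?_ ?_).neg).continuousWithinAt
  · refine ContinuousAt.comp (f := fun x : ℂ => x / (2 * Real.pi * I)) (x := x)
      (hc _ ?_) (by fun_prop)
    rcases hx with hx | rfl
    · exact Or.inl (div_two_pi_I_mem_slitPlane hx)
    · simp
  · refine ContinuousAt.comp (f := fun x : ℂ => -(x / (2 * Real.pi * I))) (x := x)
      (hc _ ?_) (by fun_prop)
    rcases hx with hx | rfl
    · exact Or.inl (neg_div_two_pi_I_mem_slitPlane hx)
    · simp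

/-- Stirling's formula away from the cut. -/
theorem norm_stirlingRemainder_div_le {κ T : ℝ} (hκ : 0 < κ) (hT : 0 < T) (hTκ : 8 * T ≤ κ)
    {x : ℂ} (hx : κ ≤ |x.re| ∨ κ ≤ x.im) :
    ‖stirlingRemainder (x / T / (2 * Real.pi * I))‖ ≤ 40 * T / κ := by
  have hn : κ ≤ ‖x‖ := hx.elim (fun h => h.trans (abs_re_le_norm x))
    fun h => h.trans ((le_abs_self _).trans (abs_im_le_norm x))
  have hnw : ‖x / T / (2 * Real.pi * I)‖ = ‖x‖ / T / (2 * Real.pi) := by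
    simp [abs_of_pos hT, abs_of_pos Real.pi_pos]
  have hpi := Real.pi_pos
  have hge : κ / T / (2 * Real.pi) ≤ ‖x‖ / T / (2 * Real.pi) := by gcongr
  have h1 : 1 ≤ κ / T / (2 * Real.pi) := by
    rw [le_div_iff₀ (by positivity), le_div_iff₀ hT]
    nlinarith [Real.pi_lt_four]
  have hbd : 4 / (‖x‖ / T / (2 * Real.pi)) ≤ 32 * T / κ := by
    refine (div_le_div_of_nonneg_left (by norm_num) (by positivity) hge).trans ?_
    rw [div_le_div_iff₀ (by positivity) hκ]
    have e : 32 * T * (κ / T / (2 * Real.pi)) = 16 * κ / Real.pi := by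
      field_simp
      ring
    rw [e, le_div_iff₀ hpi]
    nlinarith [Real.pi_lt_four]
  -- For `Im x ≥ 0` the argument lies in the closed right half-plane and Stirling's formula applies.
  -- Otherwise `R(w)` is exchanged for `-R(-w)` minus the thermal logarithm, which is exponentially
  -- small because then `|Re x| ≥ κ`. The condition `8T ≤ κ` makes the modulus of the argument at
  -- least `1`.
  rcases le_or_gt 0 x.im with him | him
  · have := norm_stirlingRemainder_le (w := x / T / (2 * Real.pi * I))
      (by rw [div_two_pi_I_re, div_ofReal_im]; positivity) (by rw [hnw]; linarith)
    rw [hnw] at this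
    refine (this.trans hbd).trans ?_
    gcongr
    norm_num
  · have hre : κ ≤ |x.re| := hx.elim id fun h => by linarith
    have hre0 : (x / T).re ≠ 0 := by
      rw [div_ofReal_re]
      refine div_ne_zero (fun h => ?_) hT.ne'
      rw [h, abs_zero] at hre
      linarith
    have hT' := thermalLog_eq (Or.inl hre0)
    have hRe : |(x / T).re| = |x.re| / T := by rw [div_ofReal_re, abs_div, abs_of_pos hT]
    have hκT : κ / T ≤ |x.re| / T := by gcongr
    have h8 : 8 ≤ κ / T := by rwa [le_div_iff₀ hT]
    have hth := norm_thermalLog_le (x := x / T) (by rw [hRe]; linarith)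
    have hexp : Real.exp (-|(x / T).re|) ≤ T / κ := by
      rw [hRe, Real.exp_neg, ← inv_div κ T]
      refine inv_anti₀ (by positivity) ?_
      linarith [Real.add_one_le_exp (|x.re| / T)]
    have := norm_stirlingRemainder_le (w := -(x / T / (2 * Real.pi * I)))
      (by
        rw [neg_re, div_two_pi_I_re, div_ofReal_im]
        have : x.im / T / (2 * Real.pi) ≤ 0 :=
          div_nonpos_of_nonpos_of_nonneg (div_nonpos_of_nonpos_of_nonneg him.le hT.le)
            (by positivity)
        linarith) (by rw [norm_neg, hnw]; linarith)
    rw [norm_neg, hnw] at this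
    have heq : stirlingRemainder (x / T / (2 * Real.pi * I)) =
        -(stirlingRemainder (-(x / T / (2 * Real.pi * I))) + thermalLog (x / T)) := by
      rw [hT']
      ring
    rw [heq, norm_neg]
    refine (norm_add_le _ _).trans ?_
    have e : 40 * T / κ = 32 * T / κ + 8 * (T / κ) := by ring
    rw [e]
    have : 0 < T / κ := by positivity
    linarith

/-! ### Deformation of a path crossing the imaginary axis -/

/-- The fundamental theorem of calculus along a path. -/
theorem integral_comp_mul_deriv_of_primitive {S : Set ℂ} {F P : ℂ → ℂ} {c : ℝ → ℂ} {a b : ℝ}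
    (hab : a ≤ b) (hF : ContinuousOn F S) (hP : ContinuousOn P S) (hc : ContinuousOn c (Icc a b))
    (hmaps : MapsTo c (Icc a b) S) {s : Set ℝ} (hs : s.Countable)
    (hd : ∀ t ∈ Ioo a b \ s, DifferentiableAt ℝ c t ∧ HasDerivAt P (F (c t)) (c t))
    (hi : IntervalIntegrable (deriv c) MeasureTheory.volume a b) :
    ∫ t in a..b, F (c t) * deriv c t = P (c b) - P (c a) := by
  have hFc : ContinuousOn (fun t => F (c t)) (Icc a b) := hF.comp hc hmaps
  exact MeasureTheory.integral_eq_of_hasDerivAt_off_countable_of_le (fun t => P (c t))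
    (fun t => F (c t) * deriv c t) hab hs (hP.comp hc hmaps)
    (fun t ht => (hd t ht).2.comp_of_eq t (hd t ht).1.hasDerivAt rfl)
    (hi.continuousOn_mul (by rwa [uIcc_of_le hab]))

/-- The integral along the segment from `a` to `b`. -/
noncomputable def segmentIntegral (a b : ℂ) (F : ℂ → ℂ) : ℂ :=
  ∫ s in (0 : ℝ)..1, F (a + s * (b - a)) * (b - a)

theorem segmentIntegral_eq_sub {S : Set ℂ} {F P : ℂ → ℂ} {a b : ℂ}
    (hF : ContinuousOn F S) (hP : ContinuousOn P S)
    (hmem : ∀ s ∈ Icc (0 : ℝ) 1, a + s * (b - a) ∈ S)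
    (hd : ∀ s ∈ Ioo (0 : ℝ) 1, HasDerivAt P (F (a + s * (b - a))) (a + s * (b - a))) :
    segmentIntegral a b F = P b - P a := by
  have hder : ∀ s : ℝ, HasDerivAt (fun s : ℝ => a + (s : ℂ) * (b - a)) (b - a) s := fun s => by
    simpa using ((hasDerivAt_id s).ofReal_comp.mul_const (b - a)).const_add a
  have hde : deriv (fun s : ℝ => a + (s : ℂ) * (b - a)) = fun _ => b - a :=
    funext fun s => (hder s).deriv
  have := integral_comp_mul_deriv_of_primitive (c := fun s : ℝ => a + (s : ℂ) * (b - a))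
    zero_le_one hF hP (by fun_prop) hmem countable_empty
    (fun t ht => ⟨(hder t).differentiableAt, hd t ht.1⟩) (by rw [hde]; exact intervalIntegrable_const)
  simp only [hde] at this
  simpa [segmentIntegral] using this

theorem norm_segmentIntegral_le {a b : ℂ} {F : ℂ → ℂ} {M : ℝ}
    (h : ∀ s ∈ Icc (0 : ℝ) 1, ‖F (a + s * (b - a))‖ ≤ M) :
    ‖segmentIntegral a b F‖ ≤ M * ‖b - a‖ := by
  have := intervalIntegral.norm_integral_le_of_norm_le_const (a := (0 : ℝ)) (b := 1)
    (f := fun s : ℝ => F (a + s * (b - a)) * (b - a)) (C := M * ‖b - a‖) ?_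
  · simpa [segmentIntegral] using this
  · intro s hs
    rw [uIoc_of_le zero_le_one] at hs
    rw [norm_mul]
    exact mul_le_mul_of_nonneg_right (h s (Ioc_subset_Icc_self hs)) (norm_nonneg _)

/-- A function holomorphic on a convex open set and continuous at the boundary point `0` has a
primitive that is continuous at `0`. -/
theorem exists_primitive_insert_zero {Ω : Set ℂ} (hΩ : Convex ℝ Ω) (ho : IsOpen Ω)
    (h0 : (0 : ℂ) ∉ Ω) {F : ℂ → ℂ} (hF : DifferentiableOn ℂ F Ω)
    (hF0 : ContinuousOn F (insert 0 Ω)) :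
    ∃ P : ℂ → ℂ, ContinuousOn P (insert 0 Ω) ∧ ∀ x ∈ Ω, HasDerivAt P (F x) x := by
  obtain ⟨P, hP⟩ := hΩ.exists_forall_hasDerivWithinAt hF
  have hbd : ∃ ε > 0, ∀ x ∈ Ω ∩ Metric.ball 0 ε, ‖F x‖₊ ≤ ‖F 0‖₊ + 1 := by
    have hc := (hF0 0 (mem_insert _ _)).nnnorm
    have := hc.eventually (gt_mem_nhds (lt_add_one ‖F 0‖₊))
    obtain ⟨ε, hε, h⟩ := Metric.mem_nhdsWithin_iff.1 this
    exact ⟨ε, hε, fun x hx => (h ⟨hx.2, mem_insert_of_mem _ hx.1⟩ : ‖F x‖₊ < _).le⟩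
  obtain ⟨ε, hε, hb⟩ := hbd
  -- Near `0` the integrand is bounded, so the primitive is Lipschitz there, and a Lipschitz
  -- extension supplies its value at the boundary point `0`.
  have hlip : LipschitzOnWith (‖F 0‖₊ + 1) P (Ω ∩ Metric.ball 0 ε) :=
    (hΩ.inter (convex_ball 0 ε)).lipschitzOnWith_of_nnnorm_hasDerivWithin_le
      (fun x hx => (hP x hx.1).mono inter_subset_left) hb
  obtain ⟨g, hg, hPg⟩ := hlip.extend_finite_dimension
  refine ⟨fun x => if x = 0 then g 0 else P x, ?_, ?_⟩
  · rintro x (rfl | hx)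
    · have hgc : ContinuousWithinAt g (insert 0 Ω) 0 := hg.continuous.continuousWithinAt
      refine hgc.congr_of_eventuallyEq ?_ (by simp)
      filter_upwards [self_mem_nhdsWithin,
        mem_nhdsWithin_of_mem_nhds (Metric.ball_mem_nhds (0 : ℂ) hε)] with y hy hyε
      by_cases h : y = 0
      · simp [h]
      · simp only [h, if_false]
        exact hPg ⟨hy.resolve_left h, hyε⟩
    · have hx0 : x ≠ 0 := fun h => h0 (h ▸ hx)
      have hc : ContinuousAt P x := ((hP x hx).hasDerivAt (ho.mem_nhds hx)).continuousAt
      refine (hc.congr ?_).continuousWithinAt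
      filter_upwards [isOpen_ne.mem_nhds hx0] with y hy
      simp [show y ≠ 0 from hy]
  · intro x hx
    have hx0 : x ≠ 0 := fun h => h0 (h ▸ hx)
    refine ((hP x hx).hasDerivAt (ho.mem_nhds hx)).congr_of_eventuallyEq ?_
    filter_upwards [isOpen_ne.mem_nhds hx0] with y hy
    simp [show y ≠ 0 from hy]

/-- The disc without the half `{-σ i y : y ≥ 0}` of the imaginary axis. -/
def slitDisc (ρ σ : ℝ) : Set ℂ := {x | ‖x‖ < ρ ∧ (x.re ≠ 0 ∨ 0 < σ * x.im)}

/-- A path that passes, at the parameter `t₀`, through the origin from the left half-plane to the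
right half-plane. -/
structure IsCrossing (c : ℝ → ℂ) (t₁ t₀ t₂ ρ κ : ℝ) : Prop where
  lt_left : t₁ < t₀
  lt_right : t₀ < t₂
  continuousOn : ContinuousOn c (Icc t₁ t₂)
  differentiableAt : ∀ t ∈ Ioo t₁ t₂, t ≠ t₀ → DifferentiableAt ℝ c t
  integrable : IntervalIntegrable (deriv c) MeasureTheory.volume t₁ t₂
  norm_lt : ∀ t ∈ Icc t₁ t₂, ‖c t‖ < ρ
  zero : c t₀ = 0
  re_neg : ∀ t ∈ Ico t₁ t₀, (c t).re < 0
  re_pos : ∀ t ∈ Ioc t₀ t₂, 0 < (c t).re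
  re_left : (c t₁).re ≤ -κ
  re_right : κ ≤ (c t₂).re
  kappa_pos : 0 < κ
  kappa_lt : 2 * κ < ρ

/-- The integral from the first to the last point of the crossing along a polygon that stays at
distance `κ` from the cut of the slit disc. -/
noncomputable def outerIntegral (c : ℝ → ℂ) (t₁ t₂ κ σ : ℝ) (F : ℂ → ℂ) : ℂ :=
  segmentIntegral (c t₁) (-κ + σ * κ * I) F + segmentIntegral (-κ + σ * κ * I) (κ + σ * κ * I) F +
    segmentIntegral (κ + σ * κ * I) (c t₂) F

section slit

variable {ρ σ : ℝ}

theorem isOpen_norm_lt_re_neg : IsOpen {x : ℂ | ‖x‖ < ρ ∧ x.re < 0} :=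
  (isOpen_lt continuous_norm continuous_const).inter (isOpen_lt continuous_re continuous_const)

theorem isOpen_norm_lt_re_pos : IsOpen {x : ℂ | ‖x‖ < ρ ∧ 0 < x.re} :=
  (isOpen_lt continuous_norm continuous_const).inter (isOpen_lt continuous_const continuous_re)

theorem isOpen_norm_lt_im_pos : IsOpen {x : ℂ | ‖x‖ < ρ ∧ 0 < σ * x.im} :=
  (isOpen_lt continuous_norm continuous_const).inter
    (isOpen_lt continuous_const (continuous_const.mul continuous_im))

theorem isOpen_slitDisc : IsOpen (slitDisc ρ σ) :=
  (isOpen_lt continuous_norm continuous_const).inter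
    ((isOpen_ne.preimage continuous_re).union
      (isOpen_lt continuous_const (continuous_const.mul continuous_im)))

theorem convex_norm_lt : Convex ℝ {x : ℂ | ‖x‖ < ρ} := by
  have : {x : ℂ | ‖x‖ < ρ} = Metric.ball 0 ρ := by ext; simp
  rw [this]
  exact convex_ball 0 ρ

theorem convex_norm_lt_re_neg : Convex ℝ {x : ℂ | ‖x‖ < ρ ∧ x.re < 0} :=
  convex_norm_lt.inter (convex_halfSpace_re_lt 0)

theorem convex_norm_lt_re_pos : Convex ℝ {x : ℂ | ‖x‖ < ρ ∧ 0 < x.re} :=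
  convex_norm_lt.inter (convex_halfSpace_re_gt 0)

theorem convex_norm_lt_im_pos : Convex ℝ {x : ℂ | ‖x‖ < ρ ∧ 0 < σ * x.im} := by
  refine convex_norm_lt.inter ?_
  intro x hx y hy a b ha hb hab
  have hx : 0 < σ * x.im := hx
  have hy : 0 < σ * y.im := hy
  have : σ * (a • x + b • y).im = a * (σ * x.im) + b * (σ * y.im) := by
    simp
    ring
  show 0 < σ * (a • x + b • y).im
  rw [this]
  rcases ha.eq_or_lt with rfl | ha
  · have : b = 1 := by linarith
    subst this
    linarith
  · have := mul_pos ha hx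
    have := mul_nonneg hb hy.le
    linarith

end slit

/-- Every complex number of a convex set that is a combination `a + s (b - a)`. -/
theorem _root_.Convex.add_ofReal_mul_sub_mem {Ω : Set ℂ} (hΩ : Convex ℝ Ω) {a b : ℂ} (ha : a ∈ Ω)
    (hb : b ∈ Ω) {s : ℝ} (hs : s ∈ Icc (0 : ℝ) 1) : a + s * (b - a) ∈ Ω := by
  have := hΩ.add_smul_sub_mem ha hb hs
  simpa [real_smul] using this

namespace IsCrossing

variable {c : ℝ → ℂ} {t₁ t₀ t₂ ρ κ σ : ℝ}

theorem norm_corner_lt (h : IsCrossing c t₁ t₀ t₂ ρ κ) (hσ : σ = 1 ∨ σ = -1) {ε : ℝ}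
    (hε : ε = 1 ∨ ε = -1) : ‖(ε * κ + σ * κ * I : ℂ)‖ < ρ := by
  refine lt_of_le_of_lt (norm_add_le _ _) ?_
  have hκ := h.kappa_pos
  have h1 : ‖(ε * κ : ℂ)‖ = κ := by rcases hε with rfl | rfl <;> simp [abs_of_pos hκ]
  have h2 : ‖(σ * κ * I : ℂ)‖ = κ := by rcases hσ with rfl | rfl <;> simp [abs_of_pos hκ]
  rw [h1, h2]
  linarith [h.kappa_lt]

theorem left_mem (h : IsCrossing c t₁ t₀ t₂ ρ κ) : c t₁ ∈ {x : ℂ | ‖x‖ < ρ ∧ x.re < 0} :=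
  ⟨h.norm_lt _ ⟨le_rfl, (h.lt_left.trans h.lt_right).le⟩, h.re_neg _ ⟨le_rfl, h.lt_left⟩⟩

theorem right_mem (h : IsCrossing c t₁ t₀ t₂ ρ κ) : c t₂ ∈ {x : ℂ | ‖x‖ < ρ ∧ 0 < x.re} :=
  ⟨h.norm_lt _ ⟨(h.lt_left.trans h.lt_right).le, le_rfl⟩, h.re_pos _ ⟨h.lt_right, le_rfl⟩⟩

theorem integrable_left (h : IsCrossing c t₁ t₀ t₂ ρ κ) :
    IntervalIntegrable (deriv c) MeasureTheory.volume t₁ t₀ :=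
  h.integrable.mono_set (by
    rw [uIcc_of_le h.lt_left.le, uIcc_of_le (h.lt_left.trans h.lt_right).le]
    exact Icc_subset_Icc_right h.lt_right.le)

theorem integrable_right (h : IsCrossing c t₁ t₀ t₂ ρ κ) :
    IntervalIntegrable (deriv c) MeasureTheory.volume t₀ t₂ :=
  h.integrable.mono_set (by
    rw [uIcc_of_le h.lt_right.le, uIcc_of_le (h.lt_left.trans h.lt_right).le]
    exact Icc_subset_Icc_left h.lt_left.le)

theorem mapsTo_left (h : IsCrossing c t₁ t₀ t₂ ρ κ) :
    MapsTo c (Icc t₁ t₀) (insert 0 {x : ℂ | ‖x‖ < ρ ∧ x.re < 0}) := by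
  intro t ht
  rcases ht.2.eq_or_lt with rfl | hlt
  · exact Or.inl h.zero
  · exact Or.inr ⟨h.norm_lt t ⟨ht.1, ht.2.trans h.lt_right.le⟩, h.re_neg t ⟨ht.1, hlt⟩⟩

theorem mapsTo_right (h : IsCrossing c t₁ t₀ t₂ ρ κ) :
    MapsTo c (Icc t₀ t₂) (insert 0 {x : ℂ | ‖x‖ < ρ ∧ 0 < x.re}) := by
  intro t ht
  rcases ht.1.eq_or_lt with rfl | hlt
  · exact Or.inl h.zero
  · exact Or.inr ⟨h.norm_lt t ⟨h.lt_left.le.trans ht.1, ht.2⟩, h.re_pos t ⟨hlt, ht.2⟩⟩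

theorem mapsTo (h : IsCrossing c t₁ t₀ t₂ ρ κ) :
    MapsTo c (Icc t₁ t₂) (insert 0 (slitDisc ρ σ)) := by
  intro t ht
  rcases le_total t t₀ with hl | hl
  · rcases h.mapsTo_left ⟨ht.1, hl⟩ with h0 | ⟨h1, h2⟩
    · exact Or.inl h0
    · exact Or.inr ⟨h1, Or.inl h2.ne⟩
  · rcases h.mapsTo_right ⟨hl, ht.2⟩ with h0 | ⟨h1, h2⟩
    · exact Or.inl h0
    · exact Or.inr ⟨h1, Or.inl h2.ne'⟩

theorem integral_left (h : IsCrossing c t₁ t₀ t₂ ρ κ) {F P : ℂ → ℂ} {S : Set ℂ}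
    (hS : insert 0 {x : ℂ | ‖x‖ < ρ ∧ x.re < 0} ⊆ S)
    (hF : ContinuousOn F S) (hP : ContinuousOn P S)
    (hd : ∀ x ∈ {x : ℂ | ‖x‖ < ρ ∧ x.re < 0}, HasDerivAt P (F x) x) :
    ∫ t in t₁..t₀, F (c t) * deriv c t = P 0 - P (c t₁) := by
  rw [← h.zero]
  refine integral_comp_mul_deriv_of_primitive h.lt_left.le hF hP
    (h.continuousOn.mono (Icc_subset_Icc_right h.lt_right.le)) (fun t ht => hS (h.mapsTo_left ht))
    countable_empty (fun t ht => ⟨h.differentiableAt t ⟨ht.1.1, ht.1.2.trans h.lt_right⟩ ht.1.2.ne,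
      hd _ ⟨h.norm_lt t ⟨ht.1.1.le, (ht.1.2.trans h.lt_right).le⟩, h.re_neg t ⟨ht.1.1.le, ht.1.2⟩⟩⟩)
    h.integrable_left

theorem integral_right (h : IsCrossing c t₁ t₀ t₂ ρ κ) {F P : ℂ → ℂ} {S : Set ℂ}
    (hS : insert 0 {x : ℂ | ‖x‖ < ρ ∧ 0 < x.re} ⊆ S)
    (hF : ContinuousOn F S) (hP : ContinuousOn P S)
    (hd : ∀ x ∈ {x : ℂ | ‖x‖ < ρ ∧ 0 < x.re}, HasDerivAt P (F x) x) :
    ∫ t in t₀..t₂, F (c t) * deriv c t = P (c t₂) - P 0 := by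
  rw [← h.zero]
  refine integral_comp_mul_deriv_of_primitive h.lt_right.le hF hP
    (h.continuousOn.mono (Icc_subset_Icc_left h.lt_left.le)) (fun t ht => hS (h.mapsTo_right ht))
    countable_empty (fun t ht => ⟨h.differentiableAt t ⟨h.lt_left.trans ht.1.1, ht.1.2⟩ ht.1.1.ne',
      hd _ ⟨h.norm_lt t ⟨(h.lt_left.trans ht.1.1).le, ht.1.2.le⟩, h.re_pos t ⟨ht.1.1, ht.1.2.le⟩⟩⟩)
    h.integrable_right

theorem intervalIntegrable_mul (h : IsCrossing c t₁ t₀ t₂ ρ κ) {f : ℝ → ℂ}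
    (hf : ContinuousOn f (Icc t₁ t₂)) :
    IntervalIntegrable (fun t => f t * deriv c t) MeasureTheory.volume t₁ t₂ :=
  h.integrable.continuousOn_mul (by rwa [uIcc_of_le (h.lt_left.trans h.lt_right).le])

theorem integral_add (h : IsCrossing c t₁ t₀ t₂ ρ κ) {f : ℝ → ℂ}
    (hf : ContinuousOn f (Icc t₁ t₂)) :
    ∫ t in t₁..t₂, f t * deriv c t =
      (∫ t in t₁..t₀, f t * deriv c t) + ∫ t in t₀..t₂, f t * deriv c t := by
  rw [intervalIntegral.integral_add_adjacent_intervals]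
  · refine h.integrable_left.continuousOn_mul ?_
    rw [uIcc_of_le h.lt_left.le]
    exact hf.mono (Icc_subset_Icc_right h.lt_right.le)
  · refine h.integrable_right.continuousOn_mul ?_
    rw [uIcc_of_le h.lt_right.le]
    exact hf.mono (Icc_subset_Icc_left h.lt_left.le)

/-- Deformation of the path away from the cut. -/
theorem integral_eq_outerIntegral (h : IsCrossing c t₁ t₀ t₂ ρ κ) (hσ : σ = 1 ∨ σ = -1) {F : ℂ → ℂ}
    (hF : DifferentiableOn ℂ F (slitDisc ρ σ)) (hF0 : ContinuousOn F (insert 0 (slitDisc ρ σ))) :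
    ∫ t in t₁..t₂, F (c t) * deriv c t = outerIntegral c t₁ t₂ κ σ F := by
  have hκ := h.kappa_pos
  have hσσ : σ * σ = 1 := by rcases hσ with rfl | rfl <;> norm_num
  set p : ℂ := -κ + σ * κ * I with hp
  set q : ℂ := κ + σ * κ * I with hq
  have hpn : ‖p‖ < ρ := by simpa using h.norm_corner_lt hσ (ε := -1) (Or.inr rfl)
  have hqn : ‖q‖ < ρ := by simpa using h.norm_corner_lt hσ (ε := 1) (Or.inl rfl)
  have hsL : {x : ℂ | ‖x‖ < ρ ∧ x.re < 0} ⊆ slitDisc ρ σ := fun x hx => ⟨hx.1, Or.inl hx.2.ne⟩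
  have hsR : {x : ℂ | ‖x‖ < ρ ∧ 0 < x.re} ⊆ slitDisc ρ σ := fun x hx => ⟨hx.1, Or.inl hx.2.ne'⟩
  have hsU : {x : ℂ | ‖x‖ < ρ ∧ 0 < σ * x.im} ⊆ slitDisc ρ σ := fun x hx => ⟨hx.1, Or.inr hx.2⟩
  -- The slit disc is not convex, but it is covered by the left, the right and the `σ`-sided
  -- half-disc. Each is convex with `0` on its boundary and has its own primitive.
  obtain ⟨PL, hPLc, hPL⟩ := exists_primitive_insert_zero (convex_norm_lt_re_neg (ρ := ρ))
    isOpen_norm_lt_re_neg (by simp) (hF.mono hsL) (hF0.mono (insert_subset_insert hsL))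
  obtain ⟨PR, hPRc, hPR⟩ := exists_primitive_insert_zero (convex_norm_lt_re_pos (ρ := ρ))
    isOpen_norm_lt_re_pos (by simp) (hF.mono hsR) (hF0.mono (insert_subset_insert hsR))
  obtain ⟨PU, hPUc, hPU⟩ := exists_primitive_insert_zero (convex_norm_lt_im_pos (ρ := ρ) (σ := σ))
    isOpen_norm_lt_im_pos (by simp) (hF.mono hsU) (hF0.mono (insert_subset_insert hsU))
  have hFL := hF0.mono (insert_subset_insert hsL)
  have hFR := hF0.mono (insert_subset_insert hsR)
  have hFU := hF0.mono (insert_subset_insert hsU)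
  have hpL : p ∈ {x : ℂ | ‖x‖ < ρ ∧ x.re < 0} := ⟨hpn, by simp [hp, hκ]⟩
  have hqR : q ∈ {x : ℂ | ‖x‖ < ρ ∧ 0 < x.re} := ⟨hqn, by simp [hq, hκ]⟩
  have hpU : p ∈ {x : ℂ | ‖x‖ < ρ ∧ 0 < σ * x.im} := ⟨hpn, by
    have : σ * p.im = κ := by simp [hp, ← mul_assoc, hσσ]
    rw [this]; exact hκ⟩
  have hqU : q ∈ {x : ℂ | ‖x‖ < ρ ∧ 0 < σ * x.im} := ⟨hqn, by
    have : σ * q.im = κ := by simp [hq, ← mul_assoc, hσσ]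
    rw [this]; exact hκ⟩
  -- segments ending or starting at the origin
  have hsegp : ∀ {Ω : Set ℂ} {P : ℂ → ℂ}, (∀ s ∈ Ioc (0 : ℝ) 1, ∀ x ∈ Ω, (s : ℂ) * x ∈ Ω) →
      ContinuousOn F (insert 0 Ω) → ContinuousOn P (insert 0 Ω) →
      (∀ x ∈ Ω, HasDerivAt P (F x) x) → ∀ x ∈ Ω, segmentIntegral 0 x F = P x - P 0 := by
    intro Ω P hs hF hP hd x hx
    refine segmentIntegral_eq_sub hF hP ?_ ?_
    · intro s hs'
      rcases hs'.1.eq_or_lt with rfl | h0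
      · left; simp
      · right; simpa using hs s ⟨h0, hs'.2⟩ x hx
    · intro s hs'
      simpa using hd _ (hs s ⟨hs'.1, hs'.2.le⟩ x hx)
  have hnorm : ∀ s ∈ Ioc (0 : ℝ) 1, ∀ x : ℂ, ‖x‖ < ρ → ‖(s : ℂ) * x‖ < ρ := by
    intro s hs x hx
    rw [norm_mul, norm_real, Real.norm_of_nonneg hs.1.le]
    exact (mul_le_of_le_one_left (norm_nonneg _) hs.2).trans_lt hx
  have hcL : ∀ s ∈ Ioc (0 : ℝ) 1, ∀ x ∈ {x : ℂ | ‖x‖ < ρ ∧ x.re < 0},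
      (s : ℂ) * x ∈ {x : ℂ | ‖x‖ < ρ ∧ x.re < 0} := fun s hs x hx =>
    ⟨hnorm s hs x hx.1, by rw [re_ofReal_mul]; exact mul_neg_of_pos_of_neg hs.1 hx.2⟩
  have hcR : ∀ s ∈ Ioc (0 : ℝ) 1, ∀ x ∈ {x : ℂ | ‖x‖ < ρ ∧ 0 < x.re},
      (s : ℂ) * x ∈ {x : ℂ | ‖x‖ < ρ ∧ 0 < x.re} := fun s hs x hx =>
    ⟨hnorm s hs x hx.1, by rw [re_ofReal_mul]; exact mul_pos hs.1 hx.2⟩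
  have hcU : ∀ s ∈ Ioc (0 : ℝ) 1, ∀ x ∈ {x : ℂ | ‖x‖ < ρ ∧ 0 < σ * x.im},
      (s : ℂ) * x ∈ {x : ℂ | ‖x‖ < ρ ∧ 0 < σ * x.im} := fun s hs x hx =>
    ⟨hnorm s hs x hx.1, by
      rw [im_ofReal_mul, mul_left_comm]; exact mul_pos hs.1 hx.2⟩
  -- The segments from `0` to the two upper corners lie in two half-discs each. Integrating along
  -- them with both primitives compares the primitives without gluing them; the segments cancel in
  -- the final sum.
  have e1 := hsegp hcL hFL hPLc hPL p hpL
  have e2 := hsegp hcU hFU hPUc hPU p hpU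
  have e3 := hsegp hcU hFU hPUc hPU q hqU
  have e4 := hsegp hcR hFR hPRc hPR q hqR
  have hseg : ∀ {Ω : Set ℂ} {P : ℂ → ℂ}, Convex ℝ Ω →
      ContinuousOn F (insert 0 Ω) → ContinuousOn P (insert 0 Ω) →
      (∀ x ∈ Ω, HasDerivAt P (F x) x) → ∀ x ∈ Ω, ∀ y ∈ Ω, segmentIntegral x y F = P y - P x := by
    intro Ω P hΩ hF hP hd x hx y hy
    exact segmentIntegral_eq_sub hF hP
      (fun s hs => Or.inr (hΩ.add_ofReal_mul_sub_mem hx hy hs))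
      fun s hs => hd _ (hΩ.add_ofReal_mul_sub_mem hx hy (Ioo_subset_Icc_self hs))
  have s1 := hseg convex_norm_lt_re_neg hFL hPLc hPL _ h.left_mem p hpL
  have s2 := hseg convex_norm_lt_im_pos hFU hPUc hPU p hpU q hqU
  have s3 := hseg convex_norm_lt_re_pos hFR hPRc hPR q hqR _ h.right_mem
  rw [h.integral_add (f := fun t => F (c t)) (hF0.comp h.continuousOn h.mapsTo),
    h.integral_left subset_rfl hFL hPLc hPL, h.integral_right subset_rfl hFR hPRc hPR,
    outerIntegral, ← hp, ← hq, s1, s2, s3]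
  linear_combination e1 - e2 + e3 - e4

end IsCrossing

/-- The points of the disc at distance at least `κ` from the cut, in the sense of coordinates. -/
def outerRegion (ρ κ σ : ℝ) : Set ℂ := {x | ‖x‖ < ρ ∧ (κ ≤ |x.re| ∨ κ ≤ σ * x.im)}

theorem segmentIntegral_sub_const_mul {a b g : ℂ} {F H : ℂ → ℂ}
    (hF : ContinuousOn (fun s : ℝ => F (a + s * (b - a))) (Icc 0 1))
    (hH : ContinuousOn (fun s : ℝ => H (a + s * (b - a))) (Icc 0 1)) :
    segmentIntegral a b (fun x => F x - g * H x) =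
      segmentIntegral a b F - g * segmentIntegral a b H := by
  simp only [segmentIntegral]
  rw [← intervalIntegral.integral_const_mul, ← intervalIntegral.integral_sub]
  · congr 1
    ext s
    ring
  · refine ContinuousOn.intervalIntegrable ?_
    rw [uIcc_of_le zero_le_one]
    exact hF.mul continuousOn_const
  · refine ContinuousOn.intervalIntegrable ?_
    rw [uIcc_of_le zero_le_one]
    exact continuousOn_const.mul (hH.mul continuousOn_const)

theorem segmentIntegral_congr {a b : ℂ} {F H : ℂ → ℂ}
    (h : ∀ s ∈ Icc (0 : ℝ) 1, F (a + s * (b - a)) = H (a + s * (b - a))) :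
    segmentIntegral a b F = segmentIntegral a b H := by
  refine intervalIntegral.integral_congr fun s hs => ?_
  rw [uIcc_of_le zero_le_one] at hs
  simp only [h s hs]

theorem log_I_mul {x : ℂ} (hx : 0 < x.re) : log (I * x) = log x + Real.pi / 2 * I := by
  have h0 : x ≠ 0 := by rintro rfl; simp at hx
  have ha := abs_lt.1 (abs_arg_lt_pi_div_two_iff.2 (Or.inl hx))
  rw [mul_comm, log_mul h0 I_ne_zero, log_I]
  rw [arg_I]
  constructor <;> linarith [ha.1, ha.2, Real.pi_pos]

theorem log_neg_I_mul {x : ℂ} (hx : 0 < x.re) : log (-I * x) = log x - Real.pi / 2 * I := by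
  have h0 : x ≠ 0 := by rintro rfl; simp at hx
  have ha := abs_lt.1 (abs_arg_lt_pi_div_two_iff.2 (Or.inl hx))
  rw [mul_comm, log_mul h0 (neg_ne_zero.2 I_ne_zero), log_neg_I]
  · ring
  rw [arg_neg_I]
  constructor <;> linarith [ha.1, ha.2, Real.pi_pos]

theorem log_sign_mul_I_mul {σ : ℝ} (hσ : σ = 1 ∨ σ = -1) {x : ℂ} (hx : 0 < x.re) :
    log (σ * I * x) = log x + σ * (Real.pi / 2 * I) := by
  rcases hσ with rfl | rfl
  · simpa using log_I_mul hx
  · have := log_neg_I_mul hx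
    simpa [sub_eq_add_neg] using this

namespace IsCrossing

variable {c : ℝ → ℂ} {t₁ t₀ t₂ ρ κ σ : ℝ}

theorem outerRegion_subset (h : IsCrossing c t₁ t₀ t₂ ρ κ) : outerRegion ρ κ σ ⊆ slitDisc ρ σ := by
  rintro x ⟨hx, hx' | hx'⟩
  · refine ⟨hx, Or.inl fun h0 => ?_⟩
    rw [h0, abs_zero] at hx'
    linarith [h.kappa_pos]
  · exact ⟨hx, Or.inr (h.kappa_pos.trans_le hx')⟩

/-- The three sides of the polygon lie in the outer region. -/
theorem sides_mem (h : IsCrossing c t₁ t₀ t₂ ρ κ) (hσ : σ = 1 ∨ σ = -1) {s : ℝ}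
    (hs : s ∈ Icc (0 : ℝ) 1) :
    (c t₁ + s * ((-κ + σ * κ * I) - c t₁) ∈ {x : ℂ | ‖x‖ < ρ ∧ x.re ≤ -κ}) ∧
    ((-κ + σ * κ * I) + s * ((κ + σ * κ * I) - (-κ + σ * κ * I)) ∈
      {x : ℂ | ‖x‖ < ρ ∧ σ * x.im = κ}) ∧
    ((κ + σ * κ * I) + s * (c t₂ - (κ + σ * κ * I)) ∈ {x : ℂ | ‖x‖ < ρ ∧ κ ≤ x.re}) := by
  have hσσ : σ * σ = 1 := by rcases hσ with rfl | rfl <;> norm_num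
  have hpn : ‖(-κ + σ * κ * I : ℂ)‖ < ρ := by simpa using h.norm_corner_lt hσ (ε := -1) (Or.inr rfl)
  have hqn : ‖(κ + σ * κ * I : ℂ)‖ < ρ := by simpa using h.norm_corner_lt hσ (ε := 1) (Or.inl rfl)
  refine ⟨⟨convex_norm_lt.add_ofReal_mul_sub_mem h.left_mem.1 hpn hs, ?_⟩,
    ⟨convex_norm_lt.add_ofReal_mul_sub_mem hpn hqn hs, ?_⟩,
    ⟨convex_norm_lt.add_ofReal_mul_sub_mem hqn h.right_mem.1 hs, ?_⟩⟩
  · refine (convex_halfSpace_re_le (-κ)).add_ofReal_mul_sub_mem h.re_left ?_ hs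
    simp
  · simp [← mul_assoc, hσσ]
  · refine (convex_halfSpace_re_ge κ).add_ofReal_mul_sub_mem ?_ h.re_right hs
    simp

theorem sides_mem_outerRegion (h : IsCrossing c t₁ t₀ t₂ ρ κ) (hσ : σ = 1 ∨ σ = -1) {s : ℝ}
    (hs : s ∈ Icc (0 : ℝ) 1) :
    (c t₁ + s * ((-κ + σ * κ * I) - c t₁) ∈ outerRegion ρ κ σ) ∧
    ((-κ + σ * κ * I) + s * ((κ + σ * κ * I) - (-κ + σ * κ * I)) ∈ outerRegion ρ κ σ) ∧
    ((κ + σ * κ * I) + s * (c t₂ - (κ + σ * κ * I)) ∈ outerRegion ρ κ σ) := by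
  obtain ⟨h1, h2, h3⟩ := h.sides_mem hσ hs
  exact ⟨⟨h1.1, Or.inl (le_abs.2 (Or.inr (by linarith [h1.2])))⟩, ⟨h2.1, Or.inr h2.2.ge⟩,
    ⟨h3.1, Or.inl (h3.2.trans (le_abs_self _))⟩⟩

theorem outerIntegral_sub_const_mul (h : IsCrossing c t₁ t₀ t₂ ρ κ) (hσ : σ = 1 ∨ σ = -1)
    {F H : ℂ → ℂ} {g : ℂ} (hF : ContinuousOn F (outerRegion ρ κ σ))
    (hH : ContinuousOn H (outerRegion ρ κ σ)) :
    outerIntegral c t₁ t₂ κ σ (fun x => F x - g * H x) =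
      outerIntegral c t₁ t₂ κ σ F - g * outerIntegral c t₁ t₂ κ σ H := by
  have hs := fun s (hs : s ∈ Icc (0 : ℝ) 1) => h.sides_mem_outerRegion hσ hs
  simp only [outerIntegral]
  rw [segmentIntegral_sub_const_mul (hF.comp (by fun_prop) fun s hs' => (hs s hs').1)
    (hH.comp (by fun_prop) fun s hs' => (hs s hs').1),
    segmentIntegral_sub_const_mul (hF.comp (by fun_prop) fun s hs' => (hs s hs').2.1)
    (hH.comp (by fun_prop) fun s hs' => (hs s hs').2.1),
    segmentIntegral_sub_const_mul (hF.comp (by fun_prop) fun s hs' => (hs s hs').2.2)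
    (hH.comp (by fun_prop) fun s hs' => (hs s hs').2.2)]
  ring

theorem outerIntegral_congr (h : IsCrossing c t₁ t₀ t₂ ρ κ) (hσ : σ = 1 ∨ σ = -1)
    {F H : ℂ → ℂ} (hFH : EqOn F H (outerRegion ρ κ σ)) :
    outerIntegral c t₁ t₂ κ σ F = outerIntegral c t₁ t₂ κ σ H := by
  have hs := fun s (hs : s ∈ Icc (0 : ℝ) 1) => h.sides_mem_outerRegion hσ hs
  simp only [outerIntegral]
  rw [segmentIntegral_congr fun s hs' => hFH (hs s hs').1,
    segmentIntegral_congr fun s hs' => hFH (hs s hs').2.1,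
    segmentIntegral_congr fun s hs' => hFH (hs s hs').2.2]

theorem norm_outerIntegral_le (h : IsCrossing c t₁ t₀ t₂ ρ κ) (hσ : σ = 1 ∨ σ = -1)
    {F : ℂ → ℂ} {M : ℝ} (hM : 0 ≤ M) (hF : ∀ x ∈ outerRegion ρ κ σ, ‖F x‖ ≤ M) :
    ‖outerIntegral c t₁ t₂ κ σ F‖ ≤ 6 * ρ * M := by
  have hs := fun s (hs : s ∈ Icc (0 : ℝ) 1) => h.sides_mem_outerRegion hσ hs
  have hpn : ‖(-κ + σ * κ * I : ℂ)‖ < ρ := by simpa using h.norm_corner_lt hσ (ε := -1) (Or.inr rfl)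
  have hqn : ‖(κ + σ * κ * I : ℂ)‖ < ρ := by simpa using h.norm_corner_lt hσ (ε := 1) (Or.inl rfl)
  have hlen : ∀ x y : ℂ, ‖x‖ < ρ → ‖y‖ < ρ → M * ‖y - x‖ ≤ 2 * ρ * M := fun x y hx hy => by
    have := norm_sub_le y x
    nlinarith
  have b1 := (norm_segmentIntegral_le fun s hs' => hF _ (hs s hs').1).trans
    (hlen _ _ h.left_mem.1 hpn)
  have b2 := (norm_segmentIntegral_le fun s hs' => hF _ (hs s hs').2.1).trans
    (hlen _ _ hpn hqn)
  have b3 := (norm_segmentIntegral_le fun s hs' => hF _ (hs s hs').2.2).trans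
    (hlen _ _ hqn h.right_mem.1)
  refine (norm_add₃_le).trans ?_
  linarith

theorem ne_of_mem_outerRegion {ζ x : ℂ} (hζ : ‖ζ‖ < κ) (hσ : σ = 1 ∨ σ = -1)
    (hx : x ∈ outerRegion ρ κ σ) : x ≠ ζ := by
  rintro rfl
  rcases hx.2 with h | h
  · linarith [abs_re_le_norm x]
  · have h2 : σ * x.im ≤ |x.im| := by
      rcases hσ with rfl | rfl
      · simpa using le_abs_self x.im
      · simpa using neg_le_abs x.im
    linarith [abs_im_le_norm x]

theorem norm_inv_sub_le {ζ x : ℂ} (hκ : 0 < κ) (hζ : ‖ζ‖ < κ / 2) (hσ : σ = 1 ∨ σ = -1)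
    (hx : x ∈ outerRegion ρ κ σ) : ‖1 / (x - ζ)‖ ≤ 2 / κ := by
  have h1 : κ ≤ ‖x‖ := by
    rcases hx.2 with h | h
    · linarith [abs_re_le_norm x]
    · have h2 : σ * x.im ≤ |x.im| := by
        rcases hσ with rfl | rfl
        · simpa using le_abs_self x.im
        · simpa using neg_le_abs x.im
      linarith [abs_im_le_norm x]
  have h2 : κ / 2 ≤ ‖x - ζ‖ := by
    have := norm_sub_norm_le x ζ
    linarith
  rw [norm_div, norm_one, div_le_div_iff₀ (by linarith) hκ]
  linarith

/-- The integral of the Cauchy kernel along the polygon. -/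
theorem outerIntegral_inv_sub (h : IsCrossing c t₁ t₀ t₂ ρ κ) (hσ : σ = 1 ∨ σ = -1) {ζ : ℂ}
    (hζ : ‖ζ‖ < κ) :
    outerIntegral c t₁ t₂ κ σ (fun x => 1 / (x - ζ)) =
      log (c t₂ - ζ) - log (ζ - c t₁) - σ * (Real.pi * I) := by
  have hκ := h.kappa_pos
  have hσσ : σ * σ = 1 := by rcases hσ with rfl | rfl <;> norm_num
  have hre := abs_lt.1 ((abs_re_le_norm ζ).trans_lt hζ)
  have him : |σ * ζ.im| < κ := by
    rcases hσ with rfl | rfl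
    · simpa using (abs_im_le_norm ζ).trans_lt hζ
    · simpa using (abs_im_le_norm ζ).trans_lt hζ
  have him := abs_lt.1 him
  set p : ℂ := -κ + σ * κ * I with hp
  set q : ℂ := κ + σ * κ * I with hq
  -- Multiplication by `e` turns a side of the polygon, seen from `ζ`, into the right half-plane,
  -- where `log (e (x - ζ))` is a primitive of the Cauchy kernel. The factors are `-1`, `-σi` and
  -- `1` for the three sides.
  have key : ∀ (S : Set ℂ) (e : ℂ) (a b : ℂ),
      (∀ x ∈ S, e * (x - ζ) ∈ slitPlane) →
      (∀ s ∈ Icc (0 : ℝ) 1, a + s * (b - a) ∈ S) →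
      segmentIntegral a b (fun x => 1 / (x - ζ)) = log (e * (b - ζ)) - log (e * (a - ζ)) := by
    intro S e a b hS hseg
    have hd : ∀ x ∈ S, HasDerivAt (fun x => log (e * (x - ζ))) (1 / (x - ζ)) x := by
      intro x hx
      have := (((hasDerivAt_id x).sub_const ζ).const_mul e).clog (hS x hx)
      refine this.congr_deriv ?_
      have h1 := slitPlane_ne_zero (hS x hx)
      have h2 := left_ne_zero_of_mul h1
      have h3 := right_ne_zero_of_mul h1
      simp only [id]
      field_simp
    refine segmentIntegral_eq_sub (S := S) (F := fun x => 1 / (x - ζ))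
      (P := fun x => log (e * (x - ζ))) ?_ ?_ hseg
      fun s hs => hd _ (hseg s (Ioo_subset_Icc_self hs))
    · intro x hx
      have h3 := right_ne_zero_of_mul (slitPlane_ne_zero (hS x hx))
      have hc : ContinuousAt (fun x => x - ζ) x := by fun_prop
      exact (continuousAt_const.div hc h3).continuousWithinAt
    · exact fun x hx => (hd x hx).continuousAt.continuousWithinAt
  have s1 := key {x | x.re ≤ -κ} (-1) (c t₁) p
    (fun x hx => by
      have hx : x.re ≤ -κ := hx
      left; simp; linarith) (fun s hs => (h.sides_mem hσ hs).1.2)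
  have s2 := key {x | σ * x.im = κ} (-σ * I) p q
    (fun x hx => by
      have hx : σ * x.im = κ := hx
      left
      have : ((-σ : ℂ) * I * (x - ζ)).re = σ * x.im - σ * ζ.im := by
        simp
        ring
      rw [this]
      linarith) (fun s hs => (h.sides_mem hσ hs).2.1.2)
  have s3 := key {x | κ ≤ x.re} 1 q (c t₂)
    (fun x hx => by
      have hx : κ ≤ x.re := hx
      left; simp; linarith) (fun s hs => (h.sides_mem hσ hs).2.2.2)
  have hp1 : 0 < (ζ - p).re := by simp [hp]; linarith
  have hq1 : 0 < (q - ζ).re := by simp [hq]; linarith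
  have hσ' : -σ = 1 ∨ -σ = -1 := by rcases hσ with rfl | rfl <;> simp
  have l1 : log (-σ * I * (q - ζ)) = log (q - ζ) - σ * (Real.pi / 2 * I) := by
    have := log_sign_mul_I_mul hσ' hq1
    push_cast at this
    rw [this]
    ring
  have l2 : log (-σ * I * (p - ζ)) = log (ζ - p) + σ * (Real.pi / 2 * I) := by
    rw [show (-σ * I * (p - ζ) : ℂ) = σ * I * (ζ - p) by ring]
    exact log_sign_mul_I_mul hσ hp1
  rw [outerIntegral, ← hp, ← hq, s1, s2, s3, l1, l2]
  simp only [neg_mul, one_mul, neg_sub]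
  ring

/-- Cauchy's formula: the pole `ζ` contributes through the index of the path. -/
theorem integral_div_sub_of_mem (h : IsCrossing c t₁ t₀ t₂ ρ κ) (hσ : σ = 1 ∨ σ = -1) {G : ℂ → ℂ}
    (hG : DifferentiableOn ℂ G (slitDisc ρ σ)) (hG0 : ContinuousOn G (insert 0 (slitDisc ρ σ)))
    {ζ : ℂ} (hζ : ‖ζ‖ < κ) (hc : ∀ t ∈ Icc t₁ t₂, c t ≠ ζ) (hmem : ζ ∈ slitDisc ρ σ) :
    ∫ t in t₁..t₂, G (c t) * (1 / (c t - ζ)) * deriv c t =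
      outerIntegral c t₁ t₂ κ σ (fun x => G x * (1 / (x - ζ))) +
        G ζ * ((∫ t in t₁..t₂, 1 / (c t - ζ) * deriv c t) -
          outerIntegral c t₁ t₂ κ σ (fun x => 1 / (x - ζ))) := by
  have hle := (h.lt_left.trans h.lt_right).le
  have hnhds := isOpen_slitDisc.mem_nhds hmem
  -- The slope function removes the pole and can be deformed freely. What is left is `G ζ` times the
  -- difference of the kernel integrals along the path and along the polygon.
  have hD : DifferentiableOn ℂ (dslope G ζ) (slitDisc ρ σ) :=
    (Complex.differentiableOn_dslope hnhds).2 hG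
  have hD0 : ContinuousOn (dslope G ζ) (insert 0 (slitDisc ρ σ)) :=
    (continuousOn_dslope (mem_of_superset hnhds (subset_insert _ _))).2
      ⟨hG0, hG.differentiableAt hnhds⟩
  have heq : ∀ x, x ≠ ζ → dslope G ζ x = G x * (1 / (x - ζ)) - G ζ * (1 / (x - ζ)) := by
    intro x hx
    rw [dslope_of_ne G hx, slope_def_field]
    ring
  have key := h.integral_eq_outerIntegral hσ hD hD0
  have hinv : ContinuousOn (fun t => 1 / (c t - ζ)) (Icc t₁ t₂) :=
    continuousOn_const.div (h.continuousOn.sub continuousOn_const)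
      fun t ht => sub_ne_zero.2 (hc t ht)
  have hGc : ContinuousOn (fun t => G (c t)) (Icc t₁ t₂) := hG0.comp h.continuousOn h.mapsTo
  have e1 : ∫ t in t₁..t₂, dslope G ζ (c t) * deriv c t =
      (∫ t in t₁..t₂, G (c t) * (1 / (c t - ζ)) * deriv c t) -
        G ζ * ∫ t in t₁..t₂, 1 / (c t - ζ) * deriv c t := by
    rw [← intervalIntegral.integral_const_mul, ← intervalIntegral.integral_sub]
    · refine intervalIntegral.integral_congr fun t ht => ?_
      rw [uIcc_of_le hle] at ht
      simp only [heq _ (hc t ht)]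
      ring
    · exact h.intervalIntegrable_mul (hGc.mul hinv)
    · exact (h.intervalIntegrable_mul hinv).const_mul _
  have hsub := h.outerRegion_subset (σ := σ)
  have hinv' : ContinuousOn (fun x => 1 / (x - ζ)) (outerRegion ρ κ σ) :=
    continuousOn_const.div (by fun_prop)
      fun x hx => sub_ne_zero.2 (ne_of_mem_outerRegion hζ hσ hx)
  have e2 : outerIntegral c t₁ t₂ κ σ (dslope G ζ) =
      outerIntegral c t₁ t₂ κ σ (fun x => G x * (1 / (x - ζ))) -
        G ζ * outerIntegral c t₁ t₂ κ σ (fun x => 1 / (x - ζ)) := by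
    rw [← h.outerIntegral_sub_const_mul hσ (F := fun x => G x * (1 / (x - ζ)))
      ((hG.continuousOn.mono hsub).mul hinv') hinv']
    exact h.outerIntegral_congr hσ fun x hx => heq x (ne_of_mem_outerRegion hζ hσ hx)
  rw [e1, e2] at key
  linear_combination key

/-- A pole outside the slit disc, in particular on the cut, is no obstacle to the deformation. The
origin is excluded because the path passes through it. -/
theorem integral_div_sub_of_notMem (h : IsCrossing c t₁ t₀ t₂ ρ κ) (hσ : σ = 1 ∨ σ = -1) {G : ℂ → ℂ}
    (hG : DifferentiableOn ℂ G (slitDisc ρ σ)) (hG0 : ContinuousOn G (insert 0 (slitDisc ρ σ)))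
    {ζ : ℂ} (h0 : ζ ≠ 0) (hmem : ζ ∉ slitDisc ρ σ) :
    ∫ t in t₁..t₂, G (c t) * (1 / (c t - ζ)) * deriv c t =
      outerIntegral c t₁ t₂ κ σ (fun x => G x * (1 / (x - ζ))) := by
  have hne : ∀ x ∈ slitDisc ρ σ, x - ζ ≠ 0 := by
    intro x hx h
    rw [sub_eq_zero.1 h] at hx
    exact hmem hx
  refine h.integral_eq_outerIntegral hσ (F := fun x => G x * (1 / (x - ζ))) ?_ ?_
  · exact hG.mul ((differentiableOn_const _).div (by fun_prop) hne)
  · refine hG0.mul (continuousOn_const.div (by fun_prop) ?_)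
    rintro x (rfl | hx)
    · simpa using h0
    · exact hne x hx

end IsCrossing

/-! ### Contribution of a crossing at low temperature -/

/-- Stirling's remainder at low temperature, holomorphic off the cut of the slit disc. -/
noncomputable def scaledRemainder (T σ : ℝ) (x : ℂ) : ℂ :=
  stirlingRemainder (σ * x / T / (2 * Real.pi * I))

section scaledRemainder

variable {ρ κ σ T : ℝ}

theorem scaledRemainder_arg_mem (hT : 0 < T) (hσ : σ = 1 ∨ σ = -1) {x : ℂ}
    (hx : x ∈ slitDisc ρ σ) : σ * x / T / (2 * Real.pi * I) ∈ slitPlane := by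
  have hσ0 : σ ≠ 0 := by rcases hσ with rfl | rfl <;> norm_num
  rcases hx.2 with h | h
  · refine div_two_pi_I_mem_slitPlane ?_
    rw [div_ofReal_re, re_ofReal_mul]
    exact div_ne_zero (mul_ne_zero hσ0 h) hT.ne'
  · left
    rw [div_two_pi_I_re, div_ofReal_im, im_ofReal_mul]
    have := Real.pi_pos
    positivity

theorem differentiableOn_scaledRemainder (hT : 0 < T) (hσ : σ = 1 ∨ σ = -1) :
    DifferentiableOn ℂ (scaledRemainder T σ) (slitDisc ρ σ) := fun x hx =>
  (DifferentiableAt.comp (f := fun x : ℂ => σ * x / T / (2 * Real.pi * I)) x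
    (differentiableAt_stirlingRemainder (scaledRemainder_arg_mem hT hσ hx))
    (by fun_prop)).differentiableWithinAt

theorem continuousOn_scaledRemainder (hT : 0 < T) (hσ : σ = 1 ∨ σ = -1) :
    ContinuousOn (scaledRemainder T σ) (insert 0 (slitDisc ρ σ)) := by
  rintro x (rfl | hx)
  · refine (ContinuousAt.comp (f := fun x : ℂ => σ * x / T / (2 * Real.pi * I)) (x := (0 : ℂ))
      ?_ (by fun_prop)).continuousWithinAt
    simpa using continuousAt_stirlingRemainder_zero
  · exact ((differentiableOn_scaledRemainder hT hσ).differentiableAt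
      (isOpen_slitDisc.mem_nhds hx)).continuousAt.continuousWithinAt

theorem norm_scaledRemainder_le (hκ : 0 < κ) (hT : 0 < T) (hTκ : 8 * T ≤ κ) (hσ : σ = 1 ∨ σ = -1)
    {x : ℂ} (hx : x ∈ outerRegion ρ κ σ) : ‖scaledRemainder T σ x‖ ≤ 40 * T / κ := by
  refine norm_stirlingRemainder_div_le hκ hT hTκ ?_
  rcases hx.2 with h | h
  · left
    rw [re_ofReal_mul, abs_mul]
    rcases hσ with rfl | rfl <;> simpa using h
  · right
    rwa [im_ofReal_mul]

theorem thermalLog_div_eq (hT : 0 < T) (hσ : σ = 1 ∨ σ = -1) {x : ℂ} (hx : x.re ≠ 0 ∨ x = 0) :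
    thermalLog (x / T) = -(scaledRemainder T σ x + scaledRemainder T (-σ) x) := by
  have h1 : (x / T).re ≠ 0 ∨ x / T = 0 := by
    rcases hx with hx | rfl
    · left
      rw [div_ofReal_re]
      exact div_ne_zero hx hT.ne'
    · right; simp
  rw [thermalLog_eq h1, scaledRemainder, scaledRemainder]
  rcases hσ with rfl | rfl
  · simp [neg_div]
  · simp [neg_div, add_comm]

end scaledRemainder

namespace IsCrossing

variable {c : ℝ → ℂ} {t₁ t₀ t₂ ρ κ σ T : ℝ}

theorem re_ne_zero_or (h : IsCrossing c t₁ t₀ t₂ ρ κ) {t : ℝ} (ht : t ∈ Icc t₁ t₂) :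
    (c t).re ≠ 0 ∨ c t = 0 := by
  rcases le_total t t₀ with hl | hl
  · rcases h.mapsTo_left ⟨ht.1, hl⟩ with h0 | ⟨h1, h2⟩
    · exact Or.inr h0
    · exact Or.inl h2.ne
  · rcases h.mapsTo_right ⟨hl, ht.2⟩ with h0 | ⟨h1, h2⟩
    · exact Or.inr h0
    · exact Or.inl h2.ne'

theorem continuousOn_scaledRemainder (h : IsCrossing c t₁ t₀ t₂ ρ κ) (hT : 0 < T)
    (hσ : σ = 1 ∨ σ = -1) : ContinuousOn (fun t => scaledRemainder T σ (c t)) (Icc t₁ t₂) :=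
  (Sommerfeld.continuousOn_scaledRemainder (ρ := ρ) hT hσ).comp h.continuousOn h.mapsTo

/-- The part of the path close to the zero contributes little to integrals of holomorphic
functions. -/
theorem norm_integral_mul_thermalLog_le (h : IsCrossing c t₁ t₀ t₂ ρ κ) (hT : 0 < T)
    (hTκ : 8 * T ≤ κ) {k : ℂ → ℂ} {M : ℝ} (hk : DifferentiableOn ℂ k {x | ‖x‖ < ρ})
    (hkM : ∀ x, ‖x‖ < ρ → ‖k x‖ ≤ M) :
    ‖∫ t in t₁..t₂, k (c t) * thermalLog (c t / T) * deriv c t‖ ≤ 480 * ρ * M / κ * T := by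
  have hle := (h.lt_left.trans h.lt_right).le
  have hκ := h.kappa_pos
  have hM : 0 ≤ M := (norm_nonneg _).trans (hkM (c t₁) h.left_mem.1)
  have hkc : ContinuousOn (fun t => k (c t)) (Icc t₁ t₂) :=
    hk.continuousOn.comp h.continuousOn h.norm_lt
  have hsub : ∀ σ : ℝ, insert 0 (slitDisc ρ σ) ⊆ {x | ‖x‖ < ρ} := by
    rintro σ x (rfl | hx)
    · simpa using (by linarith [h.kappa_lt] : 0 < ρ)
    · exact hx.1
  -- The two halves of the thermal logarithm have opposite cuts and are pushed to opposite sides,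
  -- where both are `O(T)`.
  have key : ∀ σ : ℝ, σ = 1 ∨ σ = -1 →
      ‖∫ t in t₁..t₂, k (c t) * scaledRemainder T σ (c t) * deriv c t‖ ≤ 240 * ρ * M / κ * T := by
    intro σ hσ
    have := h.integral_eq_outerIntegral hσ (F := fun x => k x * scaledRemainder T σ x)
      ((hk.mono ((subset_insert _ _).trans (hsub σ))).mul (differentiableOn_scaledRemainder hT hσ))
      ((hk.continuousOn.mono (hsub σ)).mul (Sommerfeld.continuousOn_scaledRemainder hT hσ))
    rw [this]
    refine (h.norm_outerIntegral_le hσ (M := M * (40 * T / κ)) (by positivity) ?_).trans_eq ?_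
    · intro x hx
      rw [norm_mul]
      exact mul_le_mul (hkM x hx.1) (norm_scaledRemainder_le hκ hT hTκ hσ hx) (norm_nonneg _) hM
    · ring
  have h1 := key 1 (Or.inl rfl)
  have h2 := key (-1) (Or.inr rfl)
  have e : ∫ t in t₁..t₂, k (c t) * thermalLog (c t / T) * deriv c t =
      -((∫ t in t₁..t₂, k (c t) * scaledRemainder T 1 (c t) * deriv c t) +
        ∫ t in t₁..t₂, k (c t) * scaledRemainder T (-1) (c t) * deriv c t) := by
    rw [← intervalIntegral.integral_add, ← intervalIntegral.integral_neg]
    · refine intervalIntegral.integral_congr fun t ht => ?_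
      rw [uIcc_of_le hle] at ht
      simp only [thermalLog_div_eq hT (Or.inl rfl) (h.re_ne_zero_or ht)]
      ring
    · exact h.intervalIntegrable_mul (hkc.mul (h.continuousOn_scaledRemainder hT (Or.inl rfl)))
    · exact h.intervalIntegrable_mul (hkc.mul (h.continuousOn_scaledRemainder hT (Or.inr rfl)))
  rw [e, norm_neg]
  refine (norm_add_le _ _).trans ((add_le_add h1 h2).trans_eq ?_)
  ring

/-- The contribution of a pole on the side `σ` of the path; the side is encoded in the value of the
integral of the Cauchy kernel. -/
theorem norm_integral_inv_sub_mul_thermalLog_le (h : IsCrossing c t₁ t₀ t₂ ρ κ) (hT : 0 < T)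
    (hTκ : 8 * T ≤ κ) (hσ : σ = 1 ∨ σ = -1) {ζ : ℂ} (hζ : ‖ζ‖ < κ / 2)
    (hc : ∀ t ∈ Icc t₁ t₂, c t ≠ ζ)
    (hW : ∫ t in t₁..t₂, 1 / (c t - ζ) * deriv c t =
      log (c t₂ - ζ) - log (ζ - c t₁) + σ * (Real.pi * I)) :
    ‖(∫ t in t₁..t₂, 1 / (c t - ζ) * thermalLog (c t / T) * deriv c t) +
      σ * (2 * Real.pi * I) * scaledRemainder T σ ζ‖ ≤ 960 * ρ / κ ^ 2 * T := by
  have hle := (h.lt_left.trans h.lt_right).le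
  have hκ := h.kappa_pos
  have hζ' : ‖ζ‖ < κ := by linarith
  have h0 : ζ ≠ 0 := by
    rintro rfl
    exact hc t₀ ⟨h.lt_left.le, h.lt_right.le⟩ h.zero
  have hσ' : -σ = 1 ∨ -σ = -1 := by rcases hσ with rfl | rfl <;> simp
  have hσ0 : (σ : ℂ) ≠ 0 := by rcases hσ with rfl | rfl <;> simp
  have hinv : ContinuousOn (fun t => 1 / (c t - ζ)) (Icc t₁ t₂) :=
    continuousOn_const.div (h.continuousOn.sub continuousOn_const)
      fun t ht => sub_ne_zero.2 (hc t ht)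
  -- the side of the pole keeps it away from the cut
  have hmem : ζ ∈ slitDisc ρ σ := by
    by_contra hmem
    have h1 := h.integral_div_sub_of_notMem hσ (G := fun _ => 1) (differentiableOn_const _)
      continuousOn_const h0 hmem
    simp only [one_mul] at h1
    rw [h.outerIntegral_inv_sub hσ hζ', hW] at h1
    have h2 : (σ : ℂ) * (Real.pi * I) = 0 := by linear_combination h1 / 2
    have h3 : (Real.pi : ℂ) * I ≠ 0 :=
      mul_ne_zero (by exact_mod_cast Real.pi_ne_zero) I_ne_zero
    exact mul_ne_zero hσ0 h3 h2
  have bd : ∀ σ : ℝ, σ = 1 ∨ σ = -1 →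
      ‖outerIntegral c t₁ t₂ κ σ (fun x => scaledRemainder T σ x * (1 / (x - ζ)))‖ ≤
        480 * ρ / κ ^ 2 * T := by
    intro σ hσ
    refine (h.norm_outerIntegral_le hσ (M := 40 * T / κ * (2 / κ)) (by positivity) ?_).trans_eq ?_
    · intro x hx
      rw [norm_mul]
      exact mul_le_mul (norm_scaledRemainder_le hκ hT hTκ hσ hx) (norm_inv_sub_le hκ hζ hσ hx)
        (norm_nonneg _) (by positivity)
    · field_simp
      ring
  -- For the half pushed towards the pole, the kernel integrals along path and polygon differ by
  -- `2πiσ`: this is the residue.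
  have e1 := h.integral_div_sub_of_mem hσ (differentiableOn_scaledRemainder hT hσ)
    (Sommerfeld.continuousOn_scaledRemainder hT hσ) hζ' hc hmem
  rw [hW, h.outerIntegral_inv_sub hσ hζ'] at e1
  -- For the other half the two kernel integrals coincide, so no residue appears, whether or not `ζ`
  -- lies on the opposite cut.
  have e2 : ∫ t in t₁..t₂, scaledRemainder T (-σ) (c t) * (1 / (c t - ζ)) * deriv c t =
      outerIntegral c t₁ t₂ κ (-σ) (fun x => scaledRemainder T (-σ) x * (1 / (x - ζ))) := by
    by_cases hm : ζ ∈ slitDisc ρ (-σ)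
    · rw [h.integral_div_sub_of_mem hσ' (differentiableOn_scaledRemainder hT hσ')
        (Sommerfeld.continuousOn_scaledRemainder hT hσ') hζ' hc hm, hW,
        h.outerIntegral_inv_sub hσ' hζ']
      push_cast
      ring
    · exact h.integral_div_sub_of_notMem hσ' (differentiableOn_scaledRemainder hT hσ')
        (Sommerfeld.continuousOn_scaledRemainder hT hσ') h0 hm
  have e : ∫ t in t₁..t₂, 1 / (c t - ζ) * thermalLog (c t / T) * deriv c t =
      -((∫ t in t₁..t₂, scaledRemainder T σ (c t) * (1 / (c t - ζ)) * deriv c t) +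
        ∫ t in t₁..t₂, scaledRemainder T (-σ) (c t) * (1 / (c t - ζ)) * deriv c t) := by
    rw [← intervalIntegral.integral_add, ← intervalIntegral.integral_neg]
    · refine intervalIntegral.integral_congr fun t ht => ?_
      rw [uIcc_of_le hle] at ht
      simp only [thermalLog_div_eq hT hσ (h.re_ne_zero_or ht)]
      ring
    · exact h.intervalIntegrable_mul ((h.continuousOn_scaledRemainder hT hσ).mul hinv)
    · exact h.intervalIntegrable_mul ((h.continuousOn_scaledRemainder hT hσ').mul hinv)
  rw [e, e1, e2]
  have e3 : ∀ A B : ℂ, -(A + scaledRemainder T σ ζ * (log (c t₂ - ζ) - log (ζ - c t₁) +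
      σ * (Real.pi * I) - (log (c t₂ - ζ) - log (ζ - c t₁) - σ * (Real.pi * I))) + B) +
      σ * (2 * Real.pi * I) * scaledRemainder T σ ζ = -(A + B) := fun A B => by ring
  rw [e3, norm_neg]
  refine (norm_add_le _ _).trans ((add_le_add (bd σ hσ) (bd (-σ) hσ')).trans_eq ?_)
  ring

end IsCrossing

/-! ### Winding: the side of the path on which a point lies -/

/-- A property of intervals that is stable under concatenation and holds for all short one-sided
intervals at each point holds for the whole interval. -/
theorem interval_additive_induction {P : ℝ → ℝ → Prop} {A B : ℝ} (hAB : A ≤ B)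
    (hadd : ∀ α β γ, A ≤ α → α ≤ β → β ≤ γ → γ ≤ B → P α β → P β γ → P α γ)
    (hloc : ∀ x ∈ Icc A B, ∃ ε > 0, (∀ α β, A ≤ α → x - ε < α → α ≤ β → β ≤ x → P α β) ∧
      ∀ α β, x ≤ α → α ≤ β → β < x + ε → β ≤ B → P α β) : P A B := by
  choose! ε hε hl hr using hloc
  have hcover : Icc A B ⊆ ⋃ x : Icc A B, Metric.ball (x : ℝ) (ε x) := fun x hx =>
    mem_iUnion.2 ⟨⟨x, hx⟩, Metric.mem_ball_self (hε x hx)⟩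
  obtain ⟨δ, hδ, hleb⟩ := lebesgue_number_lemma_of_metric isCompact_Icc
    (fun x : Icc A B => Metric.isOpen_ball) hcover
  have hshort : ∀ α β, A ≤ α → α ≤ β → β ≤ B → β < α + δ → P α β := by
    intro α β hα hαβ hβ hlt
    obtain ⟨⟨x, hx⟩, hball⟩ := hleb α ⟨hα, hαβ.trans hβ⟩
    have h1 : |α - x| < ε x := by
      simpa [Real.dist_eq] using hball (Metric.mem_ball_self hδ)
    have h2 : |β - x| < ε x := by
      have : β ∈ Metric.ball α δ := by
        rw [Metric.mem_ball, Real.dist_eq, abs_of_nonneg (by linarith)]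
        linarith
      simpa [Real.dist_eq] using hball this
    rw [abs_lt] at h1 h2
    -- A short interval around `x` is split at `x`. One-sided information suffices, as is needed at
    -- the corners of a piecewise smooth path.
    rcases le_total β x with hβx | hβx
    · exact hl x hx α β hα (by linarith) hαβ hβx
    rcases le_total x α with hαx | hαx
    · exact hr x hx α β hαx hαβ (by linarith) hβ
    · exact hadd α x β hα hαx hβx hβ (hl x hx α x hα (by linarith) hαx le_rfl)
        (hr x hx x β le_rfl hβx (by linarith) hβ)
  have hn : ∀ n : ℕ, ∀ β, A ≤ β → β ≤ B → β ≤ A + n * (δ / 2) → P A β := by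
    intro n
    induction n with
    | zero =>
      intro β h1 h2 h3
      exact hshort A β le_rfl h1 h2 (by simp at h3; linarith)
    | succ n ih =>
      intro β h1 h2 h3
      rcases le_total β (A + δ / 2) with h | h
      · exact hshort A β le_rfl h1 h2 (by linarith)
      · push_cast at h3
        exact hadd A (β - δ / 2) β le_rfl (by linarith) (by linarith) h2
          (ih _ (by linarith) (by linarith) (by linarith))
          (hshort _ _ (by linarith) (by linarith) h2 (by linarith))
  obtain ⟨n, hn'⟩ := exists_nat_ge ((B - A) / (δ / 2))
  refine hn n B hAB le_rfl ?_
  rw [div_le_iff₀ (by linarith)] at hn'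
  linarith

/-- The integral of the Cauchy kernel along a path that avoids a ray emanating from the pole. -/
theorem integral_inv_sub_eq_log {c : ℝ → ℂ} {α β : ℝ} (hαβ : α ≤ β) {ζ e : ℂ}
    (hc : ContinuousOn c (Icc α β)) {s : Set ℝ} (hs : s.Countable)
    (hd : ∀ t ∈ Ioo α β \ s, DifferentiableAt ℝ c t)
    (hi : IntervalIntegrable (deriv c) MeasureTheory.volume α β)
    (hray : ∀ t ∈ Icc α β, e * (c t - ζ) ∈ slitPlane) :
    ∫ t in α..β, 1 / (c t - ζ) * deriv c t = log (e * (c β - ζ)) - log (e * (c α - ζ)) := by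
  have hder : ∀ x, e * (x - ζ) ∈ slitPlane →
      HasDerivAt (fun x => log (e * (x - ζ))) (1 / (x - ζ)) x := by
    intro x hx
    have := (((hasDerivAt_id x).sub_const ζ).const_mul e).clog hx
    refine this.congr_deriv ?_
    have h1 := slitPlane_ne_zero hx
    have h2 := left_ne_zero_of_mul h1
    have h3 := right_ne_zero_of_mul h1
    simp only [id]
    field_simp
  refine integral_comp_mul_deriv_of_primitive (S := {x | e * (x - ζ) ∈ slitPlane})
    (F := fun x => 1 / (x - ζ)) (P := fun x => log (e * (x - ζ))) hαβ ?_ ?_ hc hray hs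
    (fun t ht => ⟨hd t ht, hder _ (hray t (Ioo_subset_Icc_self ht.1))⟩) hi
  · intro x hx
    have h3 := right_ne_zero_of_mul (slitPlane_ne_zero hx)
    have hc : ContinuousAt (fun x => x - ζ) x := by fun_prop
    exact (continuousAt_const.div hc h3).continuousWithinAt
  · exact fun x hx => (hder x hx).continuousAt.continuousWithinAt

/-- Locally `y` stays in a rotated slit plane and the integral is a difference of logarithms.
Globally no branch need exist, but the exponentiated identity is multiplicative under concatenation.
-/
theorem exp_integral_inv_mul_deriv {y : ℝ → ℂ} {a b : ℝ} (hab : a ≤ b)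
    (hy : ContinuousOn y (Icc a b)) (hne : ∀ t ∈ Icc a b, y t ≠ 0) {s : Set ℝ} (hs : s.Countable)
    (hd : ∀ t ∈ Ioo a b \ s, DifferentiableAt ℝ y t)
    (hi : IntervalIntegrable (deriv y) MeasureTheory.volume a b) :
    exp (∫ t in a..b, 1 / y t * deriv y t) = y b / y a := by
  have hsub : ∀ α β, a ≤ α → α ≤ β → β ≤ b →
      IntervalIntegrable (deriv y) MeasureTheory.volume α β := fun α β h1 h2 h3 =>
    hi.mono_set (by
      rw [uIcc_of_le h2, uIcc_of_le hab]
      exact Icc_subset_Icc h1 h3)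
  have hint : ∀ α β, a ≤ α → α ≤ β → β ≤ b →
      IntervalIntegrable (fun t => 1 / y t * deriv y t) MeasureTheory.volume α β :=
    fun α β h1 h2 h3 => (hsub α β h1 h2 h3).continuousOn_mul (by
      rw [uIcc_of_le h2]
      exact (continuousOn_const.div hy hne).mono (Icc_subset_Icc h1 h3))
  refine interval_additive_induction
    (P := fun α β => exp (∫ t in α..β, 1 / y t * deriv y t) = y β / y α) hab ?_ ?_
  · intro α β γ h1 h2 h3 h4 hP hQ
    rw [← intervalIntegral.integral_add_adjacent_intervals (hint α β h1 h2 (h3.trans h4))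
      (hint β γ (h1.trans h2) h3 h4), exp_add, hP, hQ]
    have := hne α ⟨h1, h2.trans (h3.trans h4)⟩
    have := hne β ⟨h1.trans h2, h3.trans h4⟩
    field_simp
  · intro x hx
    have hyx := hne x hx
    have hcw : ContinuousWithinAt (fun t => (y x)⁻¹ * (y t - 0)) (Icc a b) x :=
      continuousWithinAt_const.mul ((hy x hx).sub continuousWithinAt_const)
    have hmem : (y x)⁻¹ * (y x - 0) ∈ slitPlane := by
      rw [sub_zero, inv_mul_cancel₀ hyx]
      exact one_mem_slitPlane
    obtain ⟨ε, hε, h⟩ := Metric.mem_nhdsWithin_iff.1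
      (hcw.eventually (isOpen_slitPlane.mem_nhds hmem))
    have key : ∀ α β, a ≤ α → x - ε < α → α ≤ β → β < x + ε → β ≤ b →
        exp (∫ t in α..β, 1 / y t * deriv y t) = y β / y α := by
      intro α β h1 h2 h3 h4 h5
      have hray : ∀ t ∈ Icc α β, (y x)⁻¹ * (y t - 0) ∈ slitPlane := fun t ht =>
        h ⟨by
          rw [Metric.mem_ball, Real.dist_eq, abs_lt]
          constructor <;> linarith [ht.1, ht.2], h1.trans ht.1, ht.2.trans h5⟩
      have := integral_inv_sub_eq_log h3 (hy.mono (Icc_subset_Icc h1 h5)) hs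
        (fun t ht => hd t ⟨⟨h1.trans_lt ht.1.1, ht.1.2.trans_le h5⟩, ht.2⟩)
        (hsub α β h1 h3 h5) hray
      simp only [sub_zero] at this hray
      rw [this, exp_sub, exp_log (slitPlane_ne_zero (hray β ⟨h3, le_rfl⟩)),
        exp_log (slitPlane_ne_zero (hray α ⟨le_rfl, h3⟩))]
      field_simp
    refine ⟨ε, hε, fun α β h1 h2 h3 h4 => ?_, fun α β h1 h2 h3 h4 => ?_⟩
    · exact key α β h1 h2 h3 (by linarith) (h4.trans hx.2)
    · exact key α β (hx.1.trans h1) (by linarith) h2 h3 h4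

theorem log_div_eq_log_sub_log {a b : ℂ} (ha : 0 < a.re) (hb : 0 < b.re) :
    log (a / b) = log a - log b := by
  have ha0 : a ≠ 0 := by rintro rfl; simp at ha
  have hb0 : b ≠ 0 := by rintro rfl; simp at hb
  have h1 := abs_lt.1 (abs_arg_lt_pi_div_two_iff.2 (Or.inl ha))
  have h2 := abs_lt.1 (abs_arg_lt_pi_div_two_iff.2 (Or.inl hb))
  have hb' : b.arg ≠ Real.pi := by linarith [Real.pi_pos]
  rw [div_eq_mul_inv, log_mul ha0 (inv_ne_zero hb0), log_inv b hb', sub_eq_add_neg]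
  rw [arg_inv, if_neg hb']
  constructor <;> linarith [h1.1, h1.2, h2.1, h2.2]

/-- Used to pass from coordinates adapted to a tangent direction `d` back to fixed coordinates: when
all four points lie in the right half-plane, division by `d` shifts both logarithms equally. -/
theorem log_div_sub_log_div {a b d : ℂ} (ha : 0 < a.re) (hb : 0 < b.re) (had : 0 < (a / d).re)
    (hbd : 0 < (b / d).re) : log (a / d) - log (b / d) = log a - log b := by
  have hd : d ≠ 0 := by rintro rfl; simp at had
  rw [← log_div_eq_log_sub_log ha hb, ← log_div_eq_log_sub_log had hbd, div_div_div_cancel_right₀ hd]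

/-- The path stays close to its tangent at `s`. -/
def NearTangent (c : ℝ → ℂ) (d : ℂ) (s : ℝ) (J : Set ℝ) : Prop :=
  ∀ t ∈ J, ‖c t - c s - (t - s) * d‖ ≤ ‖d‖ / 3 * |t - s|

/-- The integral of the Cauchy kernel when the pole lies on the normal at a point of an almost
straight path. -/
theorem integral_inv_sub_of_nearTangent {c : ℝ → ℂ} {d : ℂ} {s α β : ℝ} (hs : s ∈ Ioo α β)
    (hd : d ≠ 0) (hc : ContinuousOn c (Icc α β)) {E : Set ℝ} (hE : E.Countable)
    (hdiff : ∀ t ∈ Ioo α β \ E, DifferentiableAt ℝ c t)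
    (hi : IntervalIntegrable (deriv c) MeasureTheory.volume α β)
    (htan : NearTangent c d s (Icc α β)) {σ : ℝ} (hσ : σ = 1 ∨ σ = -1) {ε : ℝ} (hε : 0 < ε)
    (hεα : ε < s - α) (hεβ : ε < β - s) {e : ℂ} (he : ‖e‖ ≤ ‖d‖ / 8) {ζ : ℂ}
    (hζ : ζ = c s + ε * (σ * I * d + e)) :
    0 < ((c β - ζ) / d).re ∧ 0 < ((ζ - c α) / d).re ∧
    ∫ t in α..β, 1 / (c t - ζ) * deriv c t =
      log ((c β - ζ) / d) - log ((ζ - c α) / d) + σ * (Real.pi * I) := by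
  have hσσ : σ * σ = 1 := by rcases hσ with rfl | rfl <;> norm_num
  have hdn : 0 < ‖d‖ := norm_pos_iff.2 hd
  -- coordinates along and across the tangent
  have hcoord : ∀ t ∈ Icc α β, ∃ r η : ℂ, ‖r‖ ≤ |t - s| / 3 ∧ ‖η‖ ≤ ε / 8 ∧
      (c t - ζ) / d = (t - s : ℝ) + r - σ * I * ε - η := by
    intro t ht
    refine ⟨(c t - c s - (t - s) * d) / d, ε * e / d, ?_, ?_, ?_⟩
    · rw [norm_div, div_le_iff₀ hdn]
      refine (htan t ht).trans_eq ?_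
      ring
    · rw [norm_div, norm_mul, norm_real, Real.norm_of_nonneg hε.le, div_le_iff₀ hdn]
      have := mul_le_mul_of_nonneg_left he hε.le
      linarith
    · rw [hζ]
      push_cast
      field_simp
      ring
  -- The path misses the normal ray that starts at `ζ` and points away from it. A point on that ray
  -- would give both `|t - s| ≤ |t - s|/3 + ε/8` and `ε ≤ |t - s|/3 + ε/8`, which is impossible for
  -- `ε > 0`.
  have hray : ∀ t ∈ Icc α β, σ * I / d * (c t - ζ) ∈ slitPlane := by
    intro t ht
    obtain ⟨r, η, hr, hη, h⟩ := hcoord t ht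
    have e1 : σ * I / d * (c t - ζ) = σ * I * ((c t - ζ) / d) := by ring
    have hre : (σ * I / d * (c t - ζ)).re = ε - σ * (r - η).im := by
      rw [e1, h]
      simp
      linear_combination ε * hσσ
    have him : (σ * I / d * (c t - ζ)).im = σ * (t - s + (r - η).re) := by
      rw [e1, h]
      simp only [mul_re, mul_im, ofReal_re, ofReal_im, I_re, I_im, sub_re, sub_im, add_re, add_im]
      ring
    by_contra hn
    rw [mem_slitPlane_iff, not_or, not_lt, not_not] at hn
    rw [hre, him] at hn
    obtain ⟨hn1, hn2⟩ := hn
    have hσ0 : σ ≠ 0 := by rcases hσ with rfl | rfl <;> norm_num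
    have hre0 : t - s + (r - η).re = 0 := (mul_eq_zero.1 hn2).resolve_left hσ0
    have hrη : ‖r - η‖ ≤ |t - s| / 3 + ε / 8 := (norm_sub_le _ _).trans (add_le_add hr hη)
    have h1 : |t - s| ≤ |t - s| / 3 + ε / 8 := by
      have : t - s = -(r - η).re := by linarith
      have h2 := (abs_re_le_norm (r - η)).trans hrη
      calc |t - s| = |(r - η).re| := by rw [this, abs_neg]
        _ ≤ _ := h2
    have h2 : σ * (r - η).im ≤ |t - s| / 3 + ε / 8 := by
      have : σ * (r - η).im ≤ |(r - η).im| := by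
        rcases hσ with rfl | rfl
        · rw [one_mul]; exact le_abs_self _
        · rw [neg_one_mul]; exact neg_le_abs _
      exact this.trans ((abs_im_le_norm _).trans hrη)
    linarith
  have hαβ : α ≤ β := (hs.1.trans hs.2).le
  have hint := integral_inv_sub_eq_log hαβ hc hE hdiff hi hray
  have hβ : 0 < ((c β - ζ) / d).re := by
    obtain ⟨r, η, hr, hη, h⟩ := hcoord β ⟨hαβ, le_rfl⟩
    rw [abs_of_pos (by linarith [hs.2])] at hr
    have : ((c β - ζ) / d).re = (β - s) + r.re - η.re := by rw [h]; simp
    rw [this]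
    have h1 := (abs_le.1 ((abs_re_le_norm r).trans hr)).1
    have h2 := (abs_le.1 ((abs_re_le_norm η).trans hη)).2
    linarith
  have hα : 0 < ((ζ - c α) / d).re := by
    obtain ⟨r, η, hr, hη, h⟩ := hcoord α ⟨le_rfl, hαβ⟩
    rw [abs_of_neg (by linarith [hs.1])] at hr
    have : ((ζ - c α) / d).re = -((α - s) + r.re - η.re) := by
      rw [show (ζ - c α) / d = -((c α - ζ) / d) by ring, h]
      simp
    rw [this]
    have h1 := (abs_le.1 ((abs_re_le_norm r).trans hr)).2
    have h2 := (abs_le.1 ((abs_re_le_norm η).trans hη)).1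
    linarith
  refine ⟨hβ, hα, ?_⟩
  have l1 : log (σ * I / d * (c β - ζ)) = log ((c β - ζ) / d) + σ * (Real.pi / 2 * I) := by
    rw [← log_sign_mul_I_mul hσ hβ]
    ring_nf
  have hσ' : -σ = 1 ∨ -σ = -1 := by rcases hσ with rfl | rfl <;> simp
  have l2 : log (σ * I / d * (c α - ζ)) = log ((ζ - c α) / d) - σ * (Real.pi / 2 * I) := by
    have := log_sign_mul_I_mul hσ' hα
    push_cast at this
    rw [show (σ * I / d * (c α - ζ) : ℂ) = -σ * I * ((ζ - c α) / d) by ring, this]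
    ring
  rw [hint, l1, l2]
  ring

/-- The increments of the path on `J` are close to those of a linear path of velocity `d`. -/
def NearLinear (c : ℝ → ℂ) (d : ℂ) (η : ℝ) (J : Set ℝ) : Prop :=
  ∀ t ∈ J, ∀ t' ∈ J, ‖c t - c t' - (t - t') * d‖ ≤ η * ‖d‖ * |t - t'|

theorem NearLinear.norm_sub_le_of_hasDerivAt {c : ℝ → ℂ} {d d' : ℂ} {η s : ℝ} {J : Set ℝ}
    (h : NearLinear c d η J) (hs : s ∈ J) (hJ : (𝓝[J \ {s}] s).NeBot) (hd : HasDerivAt c d' s) :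
    ‖d' - d‖ ≤ η * ‖d‖ := by
  have h1 := (hasDerivAt_iff_tendsto_slope.1 hd).mono_left
    (nhdsWithin_mono s (show J \ {s} ⊆ {s}ᶜ from fun x hx => hx.2))
  refine le_of_tendsto (h1.sub_const d).norm ?_
  filter_upwards [self_mem_nhdsWithin] with t ht
  have hts : t - s ≠ 0 := sub_ne_zero.2 ht.2
  have hts' : (t - s : ℂ) ≠ 0 := by exact_mod_cast hts
  have := h t ht.1 s hs
  rw [slope_def_module, real_smul]
  have e : ((t - s)⁻¹ : ℝ) * (c t - c s) - d = ((t - s)⁻¹ : ℝ) * (c t - c s - (t - s) * d) := by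
    push_cast
    field_simp
  rw [e, norm_mul, norm_real, Real.norm_eq_abs, abs_inv, inv_mul_le_iff₀ (abs_pos.2 hts)]
  linarith

/-- The fixed reference velocity `d` is replaced by the actual derivative `d'`. They differ by at
most `‖d‖/8`, and `‖d‖ ≤ 8/7 ‖d'‖`, so the total relative error is `2/7 < 1/3`. -/
theorem NearLinear.nearTangent {c : ℝ → ℂ} {d d' : ℂ} {s : ℝ} {J : Set ℝ}
    (h : NearLinear c d (1 / 8) J) (hs : s ∈ J) (hJ : (𝓝[J \ {s}] s).NeBot)
    (hd : HasDerivAt c d' s) : NearTangent c d' s J := by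
  have h1 := h.norm_sub_le_of_hasDerivAt hs hJ hd
  have h2 : ‖d‖ ≤ 8 / 7 * ‖d'‖ := by
    have := norm_sub_norm_le d d'
    rw [norm_sub_rev] at this
    linarith
  intro t ht
  have e : c t - c s - (t - s) * d' = (c t - c s - (t - s) * d) - (t - s : ℝ) * (d' - d) := by
    push_cast
    ring
  rw [e]
  refine (norm_sub_le _ _).trans ?_
  rw [norm_mul, norm_real, Real.norm_eq_abs]
  have h3 := h t ht s hs
  have h4 := mul_le_mul_of_nonneg_left (h1.trans (mul_le_mul_of_nonneg_left h2 (by norm_num)))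
    (abs_nonneg (t - s))
  have h5 := mul_le_mul_of_nonneg_right h2 (abs_nonneg (t - s))
  have h6 : 0 ≤ ‖d'‖ * |t - s| := by positivity
  nlinarith

theorem neBot_nhdsWithin_Icc_diff_singleton {a b s : ℝ} (hab : a < b) (hs : s ∈ Icc a b) :
    (𝓝[Icc a b \ {s}] s).NeBot := by
  rcases hs.1.eq_or_lt with rfl | h
  · refine NeBot.mono (f := 𝓝[Ioo a b] a) ?_ (nhdsWithin_mono _ fun x hx =>
      ⟨Ioo_subset_Icc_self hx, hx.1.ne'⟩)
    exact left_nhdsWithin_Ioo_neBot hab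
  · refine NeBot.mono (f := 𝓝[Ioo a s] s) ?_ (nhdsWithin_mono _ fun x hx =>
      ⟨⟨hx.1.le, hx.2.le.trans hs.2⟩, hx.2.ne⟩)
    exact right_nhdsWithin_Ioo_neBot h

namespace IsCrossing

variable {c : ℝ → ℂ} {t₁ t₀ t₂ ρ κ σ : ℝ}

/-- The deviation of the integral of the Cauchy kernel from a difference of logarithms. -/
noncomputable def winding (c : ℝ → ℂ) (t₁ t₂ : ℝ) (x : ℂ) : ℂ :=
  (∫ t in t₁..t₂, 1 / (c t - x) * deriv c t) - log (c t₂ - x) + log (x - c t₁)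

theorem re_right_sub_pos (h : IsCrossing c t₁ t₀ t₂ ρ κ) {x : ℂ} (hx : ‖x‖ < κ) :
    0 < (c t₂ - x).re := by
  have := (abs_lt.1 ((abs_re_le_norm x).trans_lt hx)).2
  have := h.re_right
  rw [sub_re]
  linarith

theorem re_sub_left_pos (h : IsCrossing c t₁ t₀ t₂ ρ κ) {x : ℂ} (hx : ‖x‖ < κ) :
    0 < (x - c t₁).re := by
  have := (abs_lt.1 ((abs_re_le_norm x).trans_lt hx)).1
  have := h.re_left
  rw [sub_re]
  linarith

/-- Consequently the values of `winding` are odd multiples of `πi`, a discrete set. -/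
theorem exp_winding (h : IsCrossing c t₁ t₀ t₂ ρ κ) {x : ℂ}
    (hxc : ∀ t ∈ Icc t₁ t₂, c t ≠ x) : exp (winding c t₁ t₂ x) = -1 := by
  have hle := (h.lt_left.trans h.lt_right).le
  have hde : (deriv fun t => c t - x) = deriv c := funext fun t => deriv_sub_const x
  have h1 := exp_integral_inv_mul_deriv (y := fun t => c t - x) hle
    (h.continuousOn.sub continuousOn_const) (fun t ht => sub_ne_zero.2 (hxc t ht))
    (countable_singleton t₀)
    (fun t ht => (h.differentiableAt t ht.1 ht.2).sub_const x)
    (by rw [hde]; exact h.integrable)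
  simp only [hde] at h1
  have a1 := sub_ne_zero.2 (hxc t₁ ⟨le_rfl, hle⟩)
  have a2 := sub_ne_zero.2 (hxc t₂ ⟨hle, le_rfl⟩)
  have a3 : x - c t₁ ≠ 0 := fun h => a1 (by rw [← neg_sub, h, neg_zero])
  rw [winding, exp_add, exp_sub, h1, exp_log a2, exp_log a3]
  rw [← neg_sub (c t₁) x]
  field_simp

theorem continuousOn_winding (h : IsCrossing c t₁ t₀ t₂ ρ κ) :
    ContinuousOn (winding c t₁ t₂) ({x | ‖x‖ < κ} \ c '' Icc t₁ t₂) := by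
  have hle := (h.lt_left.trans h.lt_right).le
  have hcl : IsClosed (c '' Icc t₁ t₂) := (isCompact_Icc.image_of_continuousOn h.continuousOn).isClosed
  intro x hx
  refine ContinuousAt.continuousWithinAt ?_
  have l1 : ContinuousAt (fun x => log (c t₂ - x)) x :=
    (continuousAt_const.sub continuousAt_id).clog (Or.inl (h.re_right_sub_pos hx.1))
  have l2 : ContinuousAt (fun x => log (x - c t₁)) x :=
    (continuousAt_id.sub continuousAt_const).clog (Or.inl (h.re_sub_left_pos hx.1))
  refine (ContinuousAt.sub ?_ l1).add l2
  obtain ⟨r, hr, hball⟩ := Metric.isOpen_iff.1 hcl.isOpen_compl x hx.2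
  have hdist : ∀ y ∈ Metric.ball x (r / 2), ∀ t ∈ Icc t₁ t₂, r / 2 ≤ ‖c t - y‖ := by
    intro y hy t ht
    have h1 : r ≤ ‖c t - x‖ := by
      by_contra hlt
      exact hball (by rw [Metric.mem_ball, dist_eq_norm]; exact not_le.1 hlt) ⟨t, ht, rfl⟩
    rw [Metric.mem_ball, dist_eq_norm] at hy
    have h2 := norm_sub_norm_le (c t - x) (y - x)
    rw [sub_sub_sub_cancel_right] at h2
    linarith
  have hmeas : ∀ y ∈ Metric.ball x (r / 2), IntervalIntegrable
      (fun t => 1 / (c t - y) * deriv c t) MeasureTheory.volume t₁ t₂ := fun y hy =>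
    h.intervalIntegrable_mul (continuousOn_const.div (h.continuousOn.sub continuousOn_const)
      fun t ht h0 => by have := hdist y hy t ht; rw [h0, norm_zero] at this; linarith)
  have hnhds := Metric.ball_mem_nhds x (half_pos hr)
  refine intervalIntegral.continuousAt_of_dominated_interval
    (bound := fun t => 2 / r * ‖deriv c t‖) ?_ ?_ ?_ ?_
  · filter_upwards [hnhds] with y hy
    have := (hmeas y hy).aestronglyMeasurable
    rwa [uIoc_of_le hle]
  · filter_upwards [hnhds] with y hy
    refine Eventually.of_forall fun t ht => ?_
    rw [uIoc_of_le hle] at ht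
    have h1 := hdist y hy t (Ioc_subset_Icc_self ht)
    rw [norm_mul]
    refine mul_le_mul_of_nonneg_right ?_ (norm_nonneg _)
    rw [norm_div, norm_one, show 2 / r = 1 / (r / 2) by field_simp]
    exact one_div_le_one_div_of_le (half_pos hr) h1
  · exact h.integrable.norm.const_mul _
  · refine Eventually.of_forall fun t ht => ?_
    rw [uIoc_of_le hle] at ht
    have h1 := hdist x (Metric.mem_ball_self (half_pos hr)) t (Ioc_subset_Icc_self ht)
    have h0 : c t - x ≠ 0 := fun h0 => by rw [h0, norm_zero] at h1; linarith
    exact (continuousAt_const.div (continuousAt_const.sub continuousAt_id) h0).mul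
      continuousAt_const

/-- A continuous function whose exponential is constantly `-1` cannot vary along a path that avoids
the curve. -/
theorem winding_eq_of_joinedIn (h : IsCrossing c t₁ t₀ t₂ ρ κ) {x y : ℂ}
    (hxy : JoinedIn ({x | ‖x‖ < κ} \ c '' Icc t₁ t₂) x y) :
    winding c t₁ t₂ x = winding c t₁ t₂ y := by
  obtain ⟨p, hp⟩ := hxy
  have hc : Continuous fun s => winding c t₁ t₂ (p s) :=
    h.continuousOn_winding.comp_continuous p.continuous hp
  have := eqOn_of_exp_eqOn (S := univ) isPreconnected_univ hc.continuousOn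
    (g := fun _ => winding c t₁ t₂ y) continuousOn_const (a := 1) ?_ (mem_univ _) (by simp) 0
    (mem_univ _)
  · simpa using this
  · intro s _
    have hy := hp 1
    rw [p.target] at hy
    rw [h.exp_winding fun t ht he => (hp s).2 ⟨t, ht, he⟩,
      h.exp_winding fun t ht he => hy.2 ⟨t, ht, he⟩]

/-- Base case next to the normal at `c s`. The half of the path containing `s` is almost straight
and its kernel integral is explicit. If `s ≠ t₀`, the other half and `ζ` lie on different sides of
the imaginary axis, so a principal logarithm serves as primitive there. If `s = t₀`,
differentiability excludes a corner and both halves are close to one tangent. -/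
theorem winding_of_start (h : IsCrossing c t₁ t₀ t₂ ρ κ) (hσ : σ = 1 ∨ σ = -1) {d₁ d₂ d : ℂ}
    (hlin₁ : NearLinear c d₁ (1 / 8) (Icc t₁ t₀)) (hlin₂ : NearLinear c d₂ (1 / 8) (Icc t₀ t₂))
    {s : ℝ} (hs : s ∈ Ioo t₁ t₂) (hd : d ≠ 0) (hds : HasDerivAt c d s) {ε : ℝ} (hε : 0 < ε)
    (hε₁ : ε < s - t₁) (hε₂ : ε < t₂ - s) (hε₀ : s ≠ t₀ → ε < |t₀ - s|) {e ζ : ℂ}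
    (he : ‖e‖ ≤ ‖d‖ / 8) (hζe : ζ = c s + ε * (σ * I * d + e)) (hζ : ‖ζ‖ < κ)
    (hneg : s < t₀ → ζ.re < 0) (hpos : t₀ < s → 0 < ζ.re)
    (hne : ∀ t ∈ Icc t₁ t₂, c t ≠ ζ) :
    winding c t₁ t₂ ζ = σ * (Real.pi * I) := by
  have hle := (h.lt_left.trans h.lt_right).le
  have hR := h.re_right_sub_pos hζ
  have hL := h.re_sub_left_pos hζ
  have hsub : ∀ a b, t₁ ≤ a → a ≤ b → b ≤ t₂ →
      IntervalIntegrable (deriv c) MeasureTheory.volume a b := fun a b h1 h2 h3 =>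
    h.integrable.mono_set (by
      rw [uIcc_of_le h2, uIcc_of_le hle]
      exact Icc_subset_Icc h1 h3)
  have hdiff : ∀ t ∈ Ioo t₁ t₂ \ {t₀}, DifferentiableAt ℝ c t := fun t ht =>
    h.differentiableAt t ht.1 ht.2
  have hsplit : ∫ t in t₁..t₂, 1 / (c t - ζ) * deriv c t =
      (∫ t in t₁..t₀, 1 / (c t - ζ) * deriv c t) + ∫ t in t₀..t₂, 1 / (c t - ζ) * deriv c t :=
    h.integral_add (f := fun t => 1 / (c t - ζ))
      (continuousOn_const.div (h.continuousOn.sub continuousOn_const)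
        fun t ht => sub_ne_zero.2 (hne t ht))
  rcases lt_trichotomy s t₀ with hst | rfl | hst
  · have hsJ : s ∈ Icc t₁ t₀ := ⟨hs.1.le, hst.le⟩
    have htan := hlin₁.nearTangent hsJ (neBot_nhdsWithin_Icc_diff_singleton h.lt_left hsJ) hds
    have hε₃ := hε₀ hst.ne
    rw [abs_of_pos (by linarith)] at hε₃
    obtain ⟨p1, p2, hI⟩ := integral_inv_sub_of_nearTangent ⟨hs.1, hst⟩ hd
      (h.continuousOn.mono (Icc_subset_Icc_right h.lt_right.le)) (countable_singleton t₀)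
      (fun t ht => hdiff t ⟨⟨ht.1.1, ht.1.2.trans h.lt_right⟩, ht.2⟩)
      (hsub _ _ le_rfl h.lt_left.le h.lt_right.le) htan hσ hε hε₁ hε₃ he hζe
    rw [h.zero] at p1 hI
    have hre := hneg hst
    have hre' : 0 < (0 - ζ).re := by rw [sub_re, zero_re]; linarith
    have hI2 := integral_inv_sub_eq_log (e := 1) (ζ := ζ) h.lt_right.le
      (h.continuousOn.mono (Icc_subset_Icc_left h.lt_left.le)) (countable_singleton t₀)
      (fun t ht => hdiff t ⟨⟨h.lt_left.trans ht.1.1, ht.1.2⟩, ht.2⟩)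
      (hsub _ _ h.lt_left.le h.lt_right.le le_rfl) (fun t ht => Or.inl ?_)
    · rw [winding, hsplit, hI, hI2, h.zero, one_mul, one_mul]
      linear_combination log_div_sub_log_div hre' hL p1 p2
    · rw [one_mul, sub_re]
      rcases h.mapsTo_right ht with h0 | h0
      · rw [h0, zero_re]; linarith
      · linarith [h0.2]
  · have htan : NearTangent c d s (Icc t₁ t₂) := by
      intro t ht
      rcases le_total t s with hts | hts
      · have hsJ : s ∈ Icc t₁ s := ⟨hs.1.le, le_rfl⟩
        exact hlin₁.nearTangent hsJ (neBot_nhdsWithin_Icc_diff_singleton h.lt_left hsJ) hds t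
          ⟨ht.1, hts⟩
      · have hsJ : s ∈ Icc s t₂ := ⟨le_rfl, hs.2.le⟩
        exact hlin₂.nearTangent hsJ (neBot_nhdsWithin_Icc_diff_singleton h.lt_right hsJ) hds t
          ⟨hts, ht.2⟩
    obtain ⟨p1, p2, hI⟩ := integral_inv_sub_of_nearTangent hs hd
      h.continuousOn (countable_singleton s) hdiff h.integrable htan hσ hε hε₁ hε₂ he hζe
    rw [winding, hI]
    linear_combination log_div_sub_log_div hR hL p1 p2
  · have hsJ : s ∈ Icc t₀ t₂ := ⟨hst.le, hs.2.le⟩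
    have htan := hlin₂.nearTangent hsJ (neBot_nhdsWithin_Icc_diff_singleton h.lt_right hsJ) hds
    have hε₃ := hε₀ hst.ne'
    rw [abs_of_neg (by linarith)] at hε₃
    obtain ⟨p1, p2, hI⟩ := integral_inv_sub_of_nearTangent ⟨hst, hs.2⟩ hd
      (h.continuousOn.mono (Icc_subset_Icc_left h.lt_left.le)) (countable_singleton t₀)
      (fun t ht => hdiff t ⟨⟨h.lt_left.trans ht.1.1, ht.1.2⟩, ht.2⟩)
      (hsub _ _ h.lt_left.le h.lt_right.le le_rfl) htan hσ hε (by linarith) hε₂ he hζe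
    rw [h.zero, sub_zero] at p2 hI
    have hre := hpos hst
    have hI2 := integral_inv_sub_eq_log (e := -1) (ζ := ζ) h.lt_left.le
      (h.continuousOn.mono (Icc_subset_Icc_right h.lt_right.le)) (countable_singleton t₀)
      (fun t ht => hdiff t ⟨⟨ht.1.1, ht.1.2.trans h.lt_right⟩, ht.2⟩)
      (hsub _ _ le_rfl h.lt_left.le h.lt_right.le) (fun t ht => Or.inl ?_)
    · rw [winding, hsplit, hI, hI2, h.zero, show (-1 : ℂ) * (0 - ζ) = ζ by ring,
        show (-1 : ℂ) * (c t₁ - ζ) = ζ - c t₁ by ring]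
      linear_combination log_div_sub_log_div hR hre p1 p2
    · rw [neg_one_mul, neg_sub, sub_re]
      rcases h.mapsTo_left ht with h0 | h0
      · rw [h0, zero_re]; linarith
      · linarith [h0.2]

/-- The side of the path on which a point lies determines the integral of the Cauchy kernel. -/
theorem integral_inv_sub_of_side (h : IsCrossing c t₁ t₀ t₂ ρ κ) (hσ : σ = 1 ∨ σ = -1)
    {d₁ d₂ d : ℂ}
    (hlin₁ : NearLinear c d₁ (1 / 8) (Icc t₁ t₀)) (hlin₂ : NearLinear c d₂ (1 / 8) (Icc t₀ t₂))
    {s : ℝ} (hs : s ∈ Ioo t₁ t₂) (hd : d ≠ 0) (hds : HasDerivAt c d s) {start : ℝ → ℂ}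
    (hstart : Tendsto (fun ε : ℝ => (start ε - c s) / ε) (𝓝[>] 0) (𝓝 (σ * I * d))) {ζ : ℂ}
    (hjoin : ∀ᶠ ε : ℝ in 𝓝[>] 0, JoinedIn ({x | ‖x‖ < κ} \ c '' Icc t₁ t₂) (start ε) ζ) :
    ∫ t in t₁..t₂, 1 / (c t - ζ) * deriv c t =
      log (c t₂ - ζ) - log (ζ - c t₁) + σ * (Real.pi * I) := by
  have hlim : Tendsto start (𝓝[>] 0) (𝓝 (c s)) := by
    have h1 : Tendsto (fun ε : ℝ => (ε : ℂ)) (𝓝[>] 0) (𝓝 0) := by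
      have : Tendsto (fun ε : ℝ => (ε : ℂ)) (𝓝 0) (𝓝 ((0 : ℝ) : ℂ)) :=
        continuous_ofReal.tendsto 0
      rw [ofReal_zero] at this
      exact this.mono_left nhdsWithin_le_nhds
    have h2 := (h1.mul hstart).add_const (c s)
    rw [zero_mul, zero_add] at h2
    refine h2.congr' ?_
    filter_upwards [self_mem_nhdsWithin] with ε hε
    have : (ε : ℂ) ≠ 0 := by exact_mod_cast (ne_of_gt hε)
    field_simp
    ring
  have hlt : ∀ a : ℝ, 0 < a → ∀ᶠ ε : ℝ in 𝓝[>] 0, ε < a := fun a ha =>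
    mem_nhdsWithin_of_mem_nhds (gt_mem_nhds ha)
  have hre : Tendsto (fun ε => (start ε).re) (𝓝[>] 0) (𝓝 (c s).re) :=
    (continuous_re.tendsto _).comp hlim
  have hneg : ∀ᶠ ε : ℝ in 𝓝[>] 0, s < t₀ → (start ε).re < 0 := by
    by_cases hst : s < t₀
    · filter_upwards [hre.eventually (gt_mem_nhds (h.re_neg s ⟨hs.1.le, hst⟩))] with ε h1 _ using h1
    · exact Eventually.of_forall fun ε h1 => absurd h1 hst
  have hpos : ∀ᶠ ε : ℝ in 𝓝[>] 0, t₀ < s → 0 < (start ε).re := by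
    by_cases hst : t₀ < s
    · filter_upwards [hre.eventually (lt_mem_nhds (h.re_pos s ⟨hst, hs.2.le⟩))] with ε h1 _ using h1
    · exact Eventually.of_forall fun ε h1 => absurd h1 hst
  have hε₀ : ∀ᶠ ε : ℝ in 𝓝[>] 0, s ≠ t₀ → ε < |t₀ - s| := by
    by_cases hst : s = t₀
    · exact Eventually.of_forall fun ε h1 => absurd hst h1
    · filter_upwards [hlt _ (abs_pos.2 (sub_ne_zero.2 (Ne.symm hst)))] with ε h1 _ using h1
  -- The starting points need lie on the normal only to first order, because a chart bends straight
  -- normals; the deviation is absorbed in the term `e`.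
  have he := hstart.eventually (Metric.closedBall_mem_nhds _
    (show 0 < ‖d‖ / 8 by have := norm_pos_iff.2 hd; positivity))
  obtain ⟨ε, hjoin, hneg, hpos, hε₀, he, h1, h2, hε⟩ := (hjoin.and (hneg.and (hpos.and (hε₀.and
    (he.and ((hlt _ (sub_pos.2 hs.1)).and ((hlt _ (sub_pos.2 hs.2)).and
      self_mem_nhdsWithin))))))).exists
  have hεc : (ε : ℂ) ≠ 0 := by exact_mod_cast (ne_of_gt hε)
  rw [dist_eq_norm] at he
  have hmem := hjoin.source_mem
  have := h.winding_of_start hσ hlin₁ hlin₂ hs hd hds hε h1 h2 hε₀ he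
    (ζ := start ε) (by field_simp; ring) hmem.1 hneg hpos fun t ht h0 => hmem.2 ⟨t, ht, h0⟩
  rw [h.winding_eq_of_joinedIn hjoin, winding] at this
  linear_combination this

end IsCrossing

/-! ### Local charts and the kernel `coth` in a chart -/

theorem norm_sinh_sub_self_le {y : ℂ} (hy : ‖y‖ ≤ 1) : ‖sinh y - y‖ ≤ ‖y‖ ^ 2 := by
  have h1 := norm_exp_sub_one_sub_id_le hy
  have h2 := norm_exp_sub_one_sub_id_le (x := -y) (by rwa [norm_neg])
  rw [norm_neg] at h2
  have e : sinh y - y = ((exp y - 1 - y) - (exp (-y) - 1 - -y)) / 2 := by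
    rw [sinh]
    ring
  rw [e, norm_div, Complex.norm_ofNat]
  linarith [norm_sub_le (exp y - 1 - y) (exp (-y) - 1 - -y)]

theorem norm_cosh_sub_one_le {y : ℂ} (hy : ‖y‖ ≤ 1) : ‖cosh y - 1‖ ≤ ‖y‖ ^ 2 := by
  have h1 := norm_exp_sub_one_sub_id_le hy
  have h2 := norm_exp_sub_one_sub_id_le (x := -y) (by rwa [norm_neg])
  rw [norm_neg] at h2
  have e : cosh y - 1 = ((exp y - 1 - y) + (exp (-y) - 1 - -y)) / 2 := by
    rw [cosh]
    ring
  rw [e, norm_div, Complex.norm_ofNat]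
  linarith [norm_add_le (exp y - 1 - y) (exp (-y) - 1 - -y)]

theorem half_norm_le_norm_sinh {y : ℂ} (hy : ‖y‖ ≤ 1 / 2) : ‖y‖ / 2 ≤ ‖sinh y‖ := by
  have h1 := norm_sinh_sub_self_le (hy.trans (by norm_num))
  have h2 := norm_sub_norm_le y (sinh y)
  rw [norm_sub_rev] at h2
  nlinarith [norm_nonneg y]

theorem norm_cosh_le_two {y : ℂ} (hy : ‖y‖ ≤ 1 / 2) : ‖cosh y‖ ≤ 2 := by
  have h1 := norm_cosh_sub_one_le (hy.trans (by norm_num))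
  have h2 := norm_sub_norm_le (cosh y) 1
  rw [norm_one] at h2
  nlinarith [norm_nonneg y]

theorem norm_cosh_le_one_add (y : ℂ) : ‖cosh y‖ ≤ 1 + ‖sinh y‖ := by
  have h := congrArg norm (cosh_sq y)
  have h2 := norm_add_le (sinh y ^ 2) 1
  rw [norm_pow] at h h2
  rw [norm_one] at h2
  nlinarith [norm_nonneg (sinh y), norm_nonneg (cosh y)]

theorem norm_coth_le {y : ℂ} {c : ℝ} (hc : 0 < c) (hy : c ≤ ‖sinh y‖) : ‖coth y‖ ≤ 1 + 1 / c := by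
  have hs : 0 < ‖sinh y‖ := hc.trans_le hy
  rw [coth, norm_div, div_le_iff₀ hs]
  have : 1 ≤ 1 / c * ‖sinh y‖ := by
    rw [one_div_mul_eq_div, le_div_iff₀ hc, one_mul]
    exact hy
  have := norm_cosh_le_one_add y
  linarith

/-- The holomorphic function `f` vanishes at `Q` and is almost linear near `Q`. -/
structure IsChart (f : ℂ → ℂ) (Q A : ℂ) (r : ℝ) : Prop where
  differentiableOn : DifferentiableOn ℂ f (Metric.ball Q (2 * r))
  approx : ∀ x ∈ Metric.ball Q (2 * r), ∀ y ∈ Metric.ball Q (2 * r),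
    ‖f x - f y - A * (x - y)‖ ≤ ‖A‖ / 32 * ‖x - y‖
  slope_ne : A ≠ 0
  radius_pos : 0 < r
  radius_le : r ≤ 1 / 4
  zero : f Q = 0

namespace IsChart

variable {f : ℂ → ℂ} {Q A z : ℂ} {r : ℝ}

theorem norm_sub_le (h : IsChart f Q A r) {x y : ℂ} (hx : x ∈ Metric.ball Q (2 * r))
    (hy : y ∈ Metric.ball Q (2 * r)) : ‖f x - f y‖ ≤ 33 / 32 * ‖A‖ * ‖x - y‖ := by
  have h1 := h.approx x hx y hy
  have h2 := norm_sub_norm_le (f x - f y) (A * (x - y))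
  rw [norm_mul] at h2
  linarith

theorem le_norm_sub (h : IsChart f Q A r) {x y : ℂ} (hx : x ∈ Metric.ball Q (2 * r))
    (hy : y ∈ Metric.ball Q (2 * r)) : 31 / 32 * ‖A‖ * ‖x - y‖ ≤ ‖f x - f y‖ := by
  have h1 := h.approx x hx y hy
  have h2 := norm_sub_norm_le (A * (x - y)) (f x - f y)
  rw [norm_sub_rev (A * (x - y)), norm_mul] at h2
  linarith

theorem norm_slope_pos (h : IsChart f Q A r) : 0 < ‖A‖ := norm_pos_iff.2 h.slope_ne

theorem injOn (h : IsChart f Q A r) : InjOn f (Metric.ball Q (2 * r)) := by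
  intro x hx y hy hxy
  have h1 := h.le_norm_sub hx hy
  rw [hxy, sub_self, norm_zero] at h1
  have h2 := h.norm_slope_pos
  by_contra hne
  have h3 := norm_pos_iff.2 (sub_ne_zero.2 hne)
  have : 0 < 31 / 32 * ‖A‖ * ‖x - y‖ := by positivity
  linarith

theorem differentiableAt (h : IsChart f Q A r) {x : ℂ} (hx : x ∈ Metric.ball Q (2 * r)) :
    DifferentiableAt ℂ f x := h.differentiableOn.differentiableAt (Metric.isOpen_ball.mem_nhds hx)

theorem norm_deriv_sub_le (h : IsChart f Q A r) {x : ℂ} (hx : x ∈ Metric.ball Q (2 * r)) :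
    ‖deriv f x - A‖ ≤ ‖A‖ / 32 := by
  have hd : HasDerivAt (fun w => f w - A * w) (deriv f x - A) x := by
    have := (h.differentiableAt hx).hasDerivAt.sub ((hasDerivAt_id x).const_mul A)
    rwa [mul_one] at this
  refine hd.le_of_lip' (by positivity) ?_
  filter_upwards [Metric.isOpen_ball.mem_nhds hx] with y hy
  have := h.approx y hy x hx
  rwa [show f y - A * y - (f x - A * x) = f y - f x - A * (y - x) by ring]

theorem le_norm_deriv (h : IsChart f Q A r) {x : ℂ} (hx : x ∈ Metric.ball Q (2 * r)) :
    ‖A‖ / 2 ≤ ‖deriv f x‖ := by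
  have h1 := h.norm_deriv_sub_le hx
  have h2 := norm_sub_norm_le A (deriv f x)
  rw [norm_sub_rev] at h2
  linarith [norm_nonneg A]

theorem deriv_ne_zero (h : IsChart f Q A r) {x : ℂ} (hx : x ∈ Metric.ball Q (2 * r)) :
    deriv f x ≠ 0 := by
  have h1 := h.le_norm_deriv hx
  have h2 := h.norm_slope_pos
  exact norm_pos_iff.1 (by linarith)

theorem closedBall_subset (h : IsChart f Q A r) :
    Metric.closedBall Q r ⊆ Metric.ball Q (2 * r) :=
  Metric.closedBall_subset_ball (by linarith [h.radius_pos])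

/-- Injectivity comes from near linearity. Surjectivity onto a disc comes from the quantitative open
mapping theorem, with radius half of the lower bound `31/32 ‖A‖ r` on the circle. The inverse is
needed to express the kernel in the coordinate `x = f w`. -/
theorem exists_inverse (h : IsChart f Q A r) : ∃ φ : ℂ → ℂ,
    (∀ x ∈ Metric.ball (0 : ℂ) (‖A‖ * r / 4), φ x ∈ Metric.closedBall Q r ∧ f (φ x) = x ∧
      HasDerivAt φ (deriv f (φ x))⁻¹ x) ∧
    ∀ w ∈ Metric.closedBall Q r, ‖f w‖ < ‖A‖ * r / 4 → φ (f w) = w := by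
  have hr := h.radius_pos
  have hA := h.norm_slope_pos
  have hQ : Q ∈ Metric.ball Q (2 * r) := Metric.mem_ball_self (by linarith)
  have hsurj : ∀ x ∈ Metric.ball (0 : ℂ) (‖A‖ * r / 4), ∃ w ∈ Metric.closedBall Q r, f w = x := by
    intro x hx
    have := DiffContOnCl.ball_subset_image_closedBall (f := f) (z₀ := Q) (r := r)
      (ε := 31 / 32 * ‖A‖ * r) (DifferentiableOn.diffContOnCl (h.differentiableOn.mono (by
        rw [closure_ball Q hr.ne']; exact h.closedBall_subset))) hr ?_ ?_
    · rw [h.zero] at this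
      refine this (Metric.ball_subset_ball ?_ hx)
      nlinarith [mul_pos hA hr]
    · intro w hw
      have hw' := h.closedBall_subset (Metric.sphere_subset_closedBall hw)
      have := h.le_norm_sub hw' hQ
      rwa [← dist_eq_norm w Q, Metric.mem_sphere.1 hw] at this
    · have hne : ∀ᶠ w in 𝓝[≠] Q, f w ≠ f Q := by
        filter_upwards [self_mem_nhdsWithin, mem_nhdsWithin_of_mem_nhds
          (Metric.isOpen_ball.mem_nhds hQ)] with w hw hwb h0
        exact hw (h.injOn hwb hQ h0)
      exact hne.frequently.filter_mono nhdsWithin_le_nhds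
  choose! φ hφ hfφ using hsurj
  have hcont : ∀ x ∈ Metric.ball (0 : ℂ) (‖A‖ * r / 4), ContinuousAt φ x := by
    intro x hx
    have hc : Tendsto (fun y => 2 / ‖A‖ * ‖y - x‖) (𝓝 x) (𝓝 0) := by
      have : Continuous fun y => 2 / ‖A‖ * ‖y - x‖ := by fun_prop
      simpa using this.tendsto x
    refine tendsto_iff_norm_sub_tendsto_zero.2 (squeeze_zero' (Eventually.of_forall fun y =>
      norm_nonneg _) ?_ hc)
    filter_upwards [Metric.isOpen_ball.mem_nhds hx] with y hy
    have := h.le_norm_sub (h.closedBall_subset (hφ y hy)) (h.closedBall_subset (hφ x hx))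
    rw [hfφ y hy, hfφ x hx] at this
    rw [div_mul_eq_mul_div, le_div_iff₀ hA]
    nlinarith [mul_nonneg hA.le (norm_nonneg (φ y - φ x))]
  refine ⟨φ, fun x hx => ⟨hφ x hx, hfφ x hx, ?_⟩, fun w hw hfw => ?_⟩
  · have hx' := h.closedBall_subset (hφ x hx)
    refine HasDerivAt.of_local_left_inverse (hcont x hx) (h.differentiableAt hx').hasDerivAt
      (h.deriv_ne_zero hx') ?_
    filter_upwards [Metric.isOpen_ball.mem_nhds hx] with y hy using hfφ y hy
  · have hx : f w ∈ Metric.ball (0 : ℂ) (‖A‖ * r / 4) := by simpa using hfw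
    exact h.injOn (h.closedBall_subset (hφ _ hx)) (h.closedBall_subset hw) (hfφ _ hx)

/-- The kernel in the chart, far from its poles. -/
theorem exists_regular_kernel (h : IsChart f Q A r) {c : ℝ} (hc : 0 < c)
    (hz : ∀ w ∈ Metric.closedBall Q r, c ≤ ‖sinh (w - z)‖) : ∃ k : ℂ → ℂ,
    DifferentiableOn ℂ k {x | ‖x‖ < ‖A‖ * r / 16} ∧
    (∀ x, ‖x‖ < ‖A‖ * r / 16 → ‖k x‖ ≤ (1 + 1 / c) * (2 / ‖A‖)) ∧
    ∀ w ∈ Metric.closedBall Q r, ‖f w‖ < ‖A‖ * r / 16 →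
      coth (w - z) = k (f w) * deriv f w := by
  obtain ⟨φ, hφ, hφf⟩ := h.exists_inverse
  have hr := h.radius_pos
  have hA := h.norm_slope_pos
  have hAr := mul_pos hA hr
  have hsub : ∀ x : ℂ, ‖x‖ < ‖A‖ * r / 16 → x ∈ Metric.ball (0 : ℂ) (‖A‖ * r / 4) := by
    intro x hx
    rw [mem_ball_zero_iff]
    linarith
  have hd : DifferentiableOn ℂ φ (Metric.ball (0 : ℂ) (‖A‖ * r / 4)) := fun x hx =>
    (hφ x hx).2.2.differentiableAt.differentiableWithinAt
  have hd' := hd.deriv Metric.isOpen_ball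
  refine ⟨fun x => coth (φ x - z) * deriv φ x, ?_, ?_, ?_⟩
  · refine DifferentiableOn.mul ?_ (hd'.mono hsub)
    refine DifferentiableOn.div (hd.mono hsub |>.sub_const z).ccosh (hd.mono hsub |>.sub_const z).csinh
      fun x hx h0 => ?_
    have := hz _ (hφ x (hsub x hx)).1
    rw [h0, norm_zero] at this
    linarith
  · intro x hx
    obtain ⟨h1, h2, h3⟩ := hφ x (hsub x hx)
    rw [norm_mul, h3.deriv, norm_inv]
    refine mul_le_mul (norm_coth_le hc (hz _ h1)) ?_ (by positivity) (by positivity)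
    rw [show 2 / ‖A‖ = (‖A‖ / 2)⁻¹ by field_simp]
    exact inv_anti₀ (by linarith) (h.le_norm_deriv (h.closedBall_subset h1))
  · intro w hw hfw
    have h1 := hφf w hw (by linarith)
    have h2 := (hφ _ (hsub _ hfw)).2.2
    rw [h1] at h2
    simp only [h2.deriv, h1]
    rw [mul_assoc, inv_mul_cancel₀ (h.deriv_ne_zero (h.closedBall_subset hw)), mul_one]

/-- The kernel in the chart, with a pole. -/
theorem exists_singular_kernel (h : IsChart f Q A r) (hz : z ∈ Metric.closedBall Q r)
    (hfz : ‖f z‖ < ‖A‖ * r / 16) : ∃ k : ℂ → ℂ,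
    DifferentiableOn ℂ k {x | ‖x‖ < ‖A‖ * r / 16} ∧
    (∀ x, ‖x‖ < ‖A‖ * r / 16 → ‖k x‖ ≤ 160 / (‖A‖ * r)) ∧
    ∀ w ∈ Metric.closedBall Q r, ‖f w‖ < ‖A‖ * r / 16 → w ≠ z →
      coth (w - z) = (1 / (f w - f z) + k (f w)) * deriv f w := by
  obtain ⟨φ, hφ, hφf⟩ := h.exists_inverse
  have hr := h.radius_pos
  have hA := h.norm_slope_pos
  have hAr := mul_pos hA hr
  set R := ‖A‖ * r with hR
  set ζ := f z with hζ
  -- Since `‖ζ‖ < R/16`, the disc of radius `R/8` about `ζ` lies between the discs of radii `R/16`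
  -- and `R/4` about `0`.
  have hsub : ∀ x : ℂ, ‖x‖ < R / 16 → x ∈ Metric.ball ζ (R / 8) := by
    intro x hx
    rw [Metric.mem_ball, dist_eq_norm]
    linarith [_root_.norm_sub_le x ζ]
  have hsub' : ∀ x ∈ Metric.ball ζ (R / 8), x ∈ Metric.ball (0 : ℂ) (R / 4) := by
    intro x hx
    rw [Metric.mem_ball, dist_eq_norm] at hx
    rw [mem_ball_zero_iff]
    linarith [norm_sub_norm_le x ζ]
  have hζm : ζ ∈ Metric.ball ζ (R / 8) := Metric.mem_ball_self (by linarith)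
  have hφζ : φ ζ = z := hφf z hz (by linarith)
  have hd : DifferentiableOn ℂ φ (Metric.ball ζ (R / 8)) := fun x hx =>
    (hφ x (hsub' x hx)).2.2.differentiableAt.differentiableWithinAt
  have hd' := hd.deriv Metric.isOpen_ball
  have hnhds : Metric.ball ζ (R / 8) ∈ 𝓝 ζ := Metric.isOpen_ball.mem_nhds hζm
  have hdist : ∀ x ∈ Metric.ball ζ (R / 8), ‖φ x - z‖ ≤ 1 / 2 := by
    intro x hx
    have h1 := (hφ x (hsub' x hx)).1
    rw [Metric.mem_closedBall, dist_eq_norm] at h1 hz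
    have := _root_.norm_sub_le (φ x - Q) (z - Q)
    rw [sub_sub_sub_cancel_right] at this
    linarith [h.radius_le]
  set s : ℂ → ℂ := fun x => sinh (φ x - z) with hs
  have hsd : DifferentiableOn ℂ s (Metric.ball ζ (R / 8)) := (hd.sub_const z).csinh
  have hsζ : s ζ = 0 := by rw [hs]; simp [hφζ]
  -- Dividing out the simple zero of `sinh (φ x - z)` at `ζ` makes `g = (x - ζ) coth (φ x - z)
  -- φ'(x)` holomorphic, with `g ζ = 1`.
  set q := dslope s ζ with hq
  have hqd : DifferentiableOn ℂ q (Metric.ball ζ (R / 8)) := (differentiableOn_dslope hnhds).2 hsd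
  have hφinj : ∀ x ∈ Metric.ball ζ (R / 8), x ≠ ζ → φ x ≠ z := by
    intro x hx hne h0
    apply hne
    rw [← (hφ x (hsub' x hx)).2.1, h0]
  have hqne : ∀ x ∈ Metric.ball ζ (R / 8), x ≠ ζ → q x = s x / (x - ζ) := by
    intro x _ hne
    rw [hq, dslope_of_ne _ hne, slope_def_module, hsζ, sub_zero, smul_eq_mul]
    field_simp
  have hderφ : deriv φ ζ ≠ 0 := by
    rw [(hφ ζ (hsub' ζ hζm)).2.2.deriv]
    exact inv_ne_zero (h.deriv_ne_zero (h.closedBall_subset (hφ ζ (hsub' ζ hζm)).1))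
  have hqζ : q ζ = deriv φ ζ := by
    rw [hq, dslope_same]
    have h1 := (hφ ζ (hsub' ζ hζm)).2.2
    have h2 := (h1.sub_const z).csinh
    rw [h2.deriv, h1.deriv, hφζ]
    simp
  have hsne : ∀ x ∈ Metric.ball ζ (R / 8), x ≠ ζ → ‖φ x - z‖ / 2 ≤ ‖s x‖ ∧ s x ≠ 0 := by
    intro x hx hne
    have h1 := half_norm_le_norm_sinh (hdist x hx)
    have h2 := norm_pos_iff.2 (sub_ne_zero.2 (hφinj x hx hne))
    exact ⟨h1, norm_pos_iff.1 (show 0 < ‖s x‖ by simp only [hs]; linarith)⟩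
  have hq0 : ∀ x ∈ Metric.ball ζ (R / 8), q x ≠ 0 := by
    intro x hx
    by_cases hne : x = ζ
    · rw [hne, hqζ]
      exact hderφ
    · rw [hqne x hx hne]
      exact div_ne_zero (hsne x hx hne).2 (sub_ne_zero.2 hne)
  set g : ℂ → ℂ := fun x => cosh (φ x - z) * deriv φ x / q x with hg
  have hgd : DifferentiableOn ℂ g (Metric.ball ζ (R / 8)) :=
    ((hd.sub_const z).ccosh.mul hd').div hqd hq0
  have hgζ : g ζ = 1 := by
    simp only [hg, hφζ, hqζ, sub_self, cosh_zero, one_mul]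
    exact div_self hderφ
  have hgne : ∀ x ∈ Metric.ball ζ (R / 8), x ≠ ζ →
      g x = (x - ζ) * coth (φ x - z) * deriv φ x := by
    intro x hx hne
    have h1 := sub_ne_zero.2 hne
    have h2 := (hsne x hx hne).2
    simp only [hg, hqne x hx hne, coth]
    change _ = (x - ζ) * (cosh (φ x - z) / s x) * deriv φ x
    field_simp
  have hderle : ∀ x ∈ Metric.ball ζ (R / 8), ‖deriv φ x‖ ≤ 2 / ‖A‖ := by
    intro x hx
    obtain ⟨h1, h2, h3⟩ := hφ x (hsub' x hx)
    rw [h3.deriv, norm_inv, show 2 / ‖A‖ = (‖A‖ / 2)⁻¹ by field_simp]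
    exact inv_anti₀ (by linarith) (h.le_norm_deriv (h.closedBall_subset h1))
  have hgle : ∀ x ∈ Metric.ball ζ (R / 8), ‖g x‖ ≤ 9 := by
    intro x hx
    by_cases hne : x = ζ
    · rw [hne, hgζ, norm_one]
      norm_num
    · rw [hgne x hx hne, coth, norm_mul, norm_mul, norm_div]
      obtain ⟨h1, h2⟩ := hsne x hx hne
      have h3 := norm_pos_iff.2 h2
      have h4 := norm_cosh_le_two (hdist x hx)
      have h5 : ‖x - ζ‖ ≤ 33 / 32 * ‖A‖ * ‖φ x - z‖ := by
        have := h.norm_sub_le (h.closedBall_subset (hφ x (hsub' x hx)).1) (h.closedBall_subset hz)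
        rwa [(hφ x (hsub' x hx)).2.1] at this
      have h6 : ‖x - ζ‖ * (‖cosh (φ x - z)‖ / ‖sinh (φ x - z)‖) ≤ 9 / 2 * ‖A‖ := by
        change ‖x - ζ‖ * (‖cosh (φ x - z)‖ / ‖s x‖) ≤ 9 / 2 * ‖A‖
        rw [mul_div_assoc', div_le_iff₀ h3]
        calc ‖x - ζ‖ * ‖cosh (φ x - z)‖ ≤ (33 / 32 * ‖A‖ * (2 * ‖s x‖)) * 2 := by
              refine mul_le_mul (h5.trans ?_) h4 (norm_nonneg _) (by positivity)
              exact mul_le_mul_of_nonneg_left (by linarith) (by positivity)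
          _ ≤ _ := by nlinarith [mul_pos hA h3]
      calc _ ≤ 9 / 2 * ‖A‖ * (2 / ‖A‖) :=
            mul_le_mul h6 (hderle x hx) (norm_nonneg _) (by positivity)
        _ = 9 := by field_simp
  -- The regular part is `(g - 1)/(x - ζ)`. The Schwarz lemma with `|g - 1| ≤ 20` on a disc of
  -- radius `R/8` gives the bound `160/R`.
  refine ⟨dslope g ζ, ?_, ?_, ?_⟩
  · exact ((differentiableOn_dslope hnhds).2 hgd).mono hsub
  · intro x hx
    have := norm_dslope_le_div_of_mapsTo_ball (R₂ := 20) hgd (fun y hy => ?_) (hsub x hx)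
    · refine this.trans_eq ?_
      field_simp
      norm_num
    · rw [Metric.mem_closedBall, dist_eq_norm, hgζ]
      have := _root_.norm_sub_le (g y) 1
      rw [norm_one] at this
      linarith [hgle y hy]
  · intro w hw hfw hwz
    have h1 := hφf w hw (by linarith)
    have hm := hsub _ hfw
    have h2 := (hφ _ (hsub' _ hm)).2.2
    have hne : f w ≠ ζ := by
      intro h0
      apply hwz
      rw [← h1, h0, hφζ]
    have h3 := hgne _ hm hne
    rw [h1] at h2
    rw [h2.deriv, h1] at h3
    have h4 := sub_ne_zero.2 hne
    have h5 := h.deriv_ne_zero (h.closedBall_subset hw)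
    rw [dslope_of_ne _ hne, slope_def_module, hgζ, smul_eq_mul, h3]
    field_simp
    ring

end IsChart

/-! ### Arcs of the contour through a zero -/

/-- A short part of the path near a simple zero `Q` of `f`; along it the real part of `f` changes
its sign from minus to plus. -/
structure IsNearArc (f : ℂ → ℂ) (γ : ℝ → ℂ) (t₁ t₀ t₂ : ℝ) (Q A : ℂ) (r κ : ℝ) (e₁ e₂ : ℂ) :
    Prop where
  chart : IsChart f Q A r
  lt_left : t₁ < t₀
  lt_right : t₀ < t₂
  continuousOn : ContinuousOn γ (Icc t₁ t₂)
  differentiableAt : ∀ t ∈ Ioo t₁ t₂, t ≠ t₀ → DifferentiableAt ℝ γ t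
  integrable : IntervalIntegrable (deriv γ) MeasureTheory.volume t₁ t₂
  near : ∀ t ∈ Icc t₁ t₂, ‖γ t - Q‖ ≤ r / 20
  center : γ t₀ = Q
  re_neg : ∀ t ∈ Ico t₁ t₀, (f (γ t)).re < 0
  re_pos : ∀ t ∈ Ioc t₀ t₂, 0 < (f (γ t)).re
  re_left : (f (γ t₁)).re ≤ -κ
  re_right : κ ≤ (f (γ t₂)).re
  kappa_pos : 0 < κ
  kappa_lt : 2 * κ < ‖A‖ * r / 16
  nearLinear_left : NearLinear γ e₁ (1 / 16) (Icc t₁ t₀)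
  nearLinear_right : NearLinear γ e₂ (1 / 16) (Icc t₀ t₂)

namespace IsNearArc

variable {f : ℂ → ℂ} {γ : ℝ → ℂ} {t₁ t₀ t₂ : ℝ} {Q A e₁ e₂ : ℂ} {r κ : ℝ}

theorem le (h : IsNearArc f γ t₁ t₀ t₂ Q A r κ e₁ e₂) : t₁ ≤ t₂ := (h.lt_left.trans h.lt_right).le

theorem mem_closedBall (h : IsNearArc f γ t₁ t₀ t₂ Q A r κ e₁ e₂) {t : ℝ} (ht : t ∈ Icc t₁ t₂) :
    γ t ∈ Metric.closedBall Q r := by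
  rw [Metric.mem_closedBall, dist_eq_norm]
  linarith [h.near t ht, h.chart.radius_pos]

theorem mem_ball (h : IsNearArc f γ t₁ t₀ t₂ Q A r κ e₁ e₂) {t : ℝ} (ht : t ∈ Icc t₁ t₂) :
    γ t ∈ Metric.ball Q (2 * r) := h.chart.closedBall_subset (h.mem_closedBall ht)

theorem norm_lt (h : IsNearArc f γ t₁ t₀ t₂ Q A r κ e₁ e₂) {t : ℝ} (ht : t ∈ Icc t₁ t₂) :
    ‖f (γ t)‖ < ‖A‖ * r / 16 := by
  have h1 := h.chart.norm_sub_le (h.mem_ball ht)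
    (Metric.mem_ball_self (by linarith [h.chart.radius_pos]))
  rw [h.chart.zero, sub_zero] at h1
  have h2 := mul_le_mul_of_nonneg_left (h.near t ht)
    (show 0 ≤ 33 / 32 * ‖A‖ by positivity)
  nlinarith [mul_pos h.chart.norm_slope_pos h.chart.radius_pos]

theorem hasDerivAt (h : IsNearArc f γ t₁ t₀ t₂ Q A r κ e₁ e₂) {t : ℝ} (ht : t ∈ Icc t₁ t₂)
    (hd : DifferentiableAt ℝ γ t) :
    HasDerivAt (fun t => f (γ t)) (deriv f (γ t) * deriv γ t) t :=
  (h.chart.differentiableAt (h.mem_ball ht)).hasDerivAt.comp_of_eq t hd.hasDerivAt rfl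

theorem ae_deriv (h : IsNearArc f γ t₁ t₀ t₂ Q A r κ e₁ e₂) :
    ∀ᵐ t, t ∈ uIoc t₁ t₂ → DifferentiableAt ℝ γ t := by
  have hfin : (({t₀, t₂} : Set ℝ)ᶜ) ∈ MeasureTheory.ae MeasureTheory.volume :=
    MeasureTheory.compl_mem_ae_iff.2 ((toFinite {t₀, t₂}).measure_zero _)
  filter_upwards [hfin] with t ht hmem
  rw [uIoc_of_le h.le] at hmem
  simp only [mem_compl_iff, mem_insert_iff, mem_singleton_iff, not_or] at ht
  exact h.differentiableAt t ⟨hmem.1, lt_of_le_of_ne hmem.2 ht.2⟩ ht.1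

theorem crossing (h : IsNearArc f γ t₁ t₀ t₂ Q A r κ e₁ e₂) :
    IsCrossing (fun t => f (γ t)) t₁ t₀ t₂ (‖A‖ * r / 16) κ where
  lt_left := h.lt_left
  lt_right := h.lt_right
  continuousOn := h.chart.differentiableOn.continuousOn.comp h.continuousOn fun t ht => h.mem_ball ht
  differentiableAt t ht hne :=
    (h.hasDerivAt (Ioo_subset_Icc_self ht) (h.differentiableAt t ht hne)).differentiableAt
  integrable := by
    have hc : ContinuousOn (fun t => deriv f (γ t)) (uIcc t₁ t₂) := by
      rw [uIcc_of_le h.le]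
      exact (h.chart.differentiableOn.deriv Metric.isOpen_ball).continuousOn.comp h.continuousOn
        fun t ht => h.mem_ball ht
    refine (h.integrable.continuousOn_mul hc).congr_ae ?_
    refine (MeasureTheory.ae_restrict_iff' measurableSet_uIoc).2 ?_
    filter_upwards [h.ae_deriv] with t hd ht
    rw [(h.hasDerivAt (by rw [← uIcc_of_le h.le]; exact uIoc_subset_uIcc ht) (hd ht)).deriv]
  norm_lt t ht := h.norm_lt ht
  zero := by rw [h.center, h.chart.zero]
  re_neg := h.re_neg
  re_pos := h.re_pos
  re_left := h.re_left
  re_right := h.re_right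
  kappa_pos := h.kappa_pos
  kappa_lt := h.kappa_lt

/-- The relative errors of path and chart add up to `1/16 + (17/16)/32 < 1/8`. -/
theorem _root_.Sommerfeld.IsChart.nearLinear (h : IsChart f Q A r) {J : Set ℝ} {e : ℂ}
    (hJ : MapsTo γ J (Metric.ball Q (2 * r))) (hγ : NearLinear γ e (1 / 16) J) :
    NearLinear (fun t => f (γ t)) (A * e) (1 / 8) J := by
  intro t ht t' ht'
  have h1 := h.approx _ (hJ ht) _ (hJ ht')
  have h2 := hγ t ht t' ht'
  have h3 : ‖γ t - γ t'‖ ≤ 17 / 16 * (‖e‖ * |t - t'|) := by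
    have e0 : γ t - γ t' = (γ t - γ t' - (t - t') * e) + (t - t' : ℝ) * e := by push_cast; ring
    rw [e0]
    refine (norm_add_le _ _).trans ?_
    rw [norm_mul _ e, norm_real, Real.norm_eq_abs]
    linarith
  have e1 : f (γ t) - f (γ t') - (t - t') * (A * e) =
      (f (γ t) - f (γ t') - A * (γ t - γ t')) + A * (γ t - γ t' - (t - t') * e) := by ring
  rw [e1, norm_mul A e]
  refine (norm_add_le _ _).trans ?_
  rw [norm_mul A]
  have h4 := mul_le_mul_of_nonneg_left h3 (show 0 ≤ ‖A‖ / 32 by positivity)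
  have h5 := mul_le_mul_of_nonneg_left h2 (norm_nonneg A)
  have h6 : 0 ≤ ‖A‖ * (‖e‖ * |t - t'|) := by positivity
  nlinarith

theorem norm_integral_regular_le (h : IsNearArc f γ t₁ t₀ t₂ Q A r κ e₁ e₂) {T : ℝ} (hT : 0 < T)
    (hTκ : 8 * T ≤ κ) {c : ℝ} (hc : 0 < c) {z : ℂ}
    (hz : ∀ w ∈ Metric.closedBall Q r, c ≤ ‖sinh (w - z)‖) :
    ‖∫ t in t₁..t₂, coth (γ t - z) * thermalLog (f (γ t) / T) * deriv γ t‖ ≤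
      480 * (‖A‖ * r / 16) * ((1 + 1 / c) * (2 / ‖A‖)) / κ * T := by
  obtain ⟨k, hk, hkM, hkeq⟩ := h.chart.exists_regular_kernel hc hz
  have := h.crossing.norm_integral_mul_thermalLog_le hT hTκ hk hkM
  refine (congrArg norm (intervalIntegral.integral_congr_ae ?_)).trans_le this
  filter_upwards [h.ae_deriv] with t hd ht
  have ht' : t ∈ Icc t₁ t₂ := by rw [← uIcc_of_le h.le]; exact uIoc_subset_uIcc ht
  rw [(h.hasDerivAt ht' (hd ht)).deriv, hkeq _ (h.mem_closedBall ht') (h.norm_lt ht')]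
  ring

/-- In the coordinate `x = f w` the kernel is a Cauchy kernel with pole `f z` plus a bounded
holomorphic part. The bounded part contributes `O(T)`, the Cauchy kernel the residue term. As `f` is
injective, joining paths off `γ` are mapped to joining paths off `f ∘ γ`, so the side is preserved.
-/
theorem norm_integral_singular_le (h : IsNearArc f γ t₁ t₀ t₂ Q A r κ e₁ e₂) {T : ℝ} (hT : 0 < T)
    (hTκ : 8 * T ≤ κ) {σ : ℝ} (hσ : σ = 1 ∨ σ = -1) {V : Set ℂ} (hV : V ⊆ Metric.closedBall Q r)
    (hfV : ∀ w ∈ V, ‖f w‖ < κ / 2) {s : ℝ} (hs : s ∈ Ioo t₁ t₂) (hd : DifferentiableAt ℝ γ s)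
    (hd0 : deriv γ s ≠ 0) {z : ℂ}
    (hjoin : ∀ᶠ ε : ℝ in 𝓝[>] 0, JoinedIn (V \ γ '' Icc t₁ t₂) (γ s + ε * σ * I * deriv γ s) z) :
    ‖(∫ t in t₁..t₂, coth (γ t - z) * thermalLog (f (γ t) / T) * deriv γ t) +
      σ * (2 * Real.pi * I) * scaledRemainder T σ (f z)‖ ≤
      (480 * (‖A‖ * r / 16) * (160 / (‖A‖ * r)) / κ + 960 * (‖A‖ * r / 16) / κ ^ 2) * T := by
  have hcr := h.crossing
  have hκ := h.kappa_pos
  have hlt := h.kappa_lt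
  have hinj : ∀ w ∈ V, ∀ t ∈ Icc t₁ t₂, f (γ t) = f w → γ t = w := fun w hw t ht he =>
    h.chart.injOn (h.mem_ball ht) (h.chart.closedBall_subset (hV hw)) he
  obtain ⟨hzV, hzγ⟩ : z ∈ V \ γ '' Icc t₁ t₂ := hjoin.exists.choose_spec.target_mem
  have hne : ∀ t ∈ Icc t₁ t₂, γ t ≠ z := fun t ht he => hzγ ⟨t, ht, he⟩
  have hfne : ∀ t ∈ Icc t₁ t₂, f (γ t) ≠ f z := fun t ht he => hne t ht (hinj z hzV t ht he)
  have hfz := hfV z hzV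
  have hsI := Ioo_subset_Icc_self hs
  have hW := hcr.integral_inv_sub_of_side hσ
    (h.chart.nearLinear (fun t ht => h.mem_ball ⟨ht.1, ht.2.trans h.lt_right.le⟩) h.nearLinear_left)
    (h.chart.nearLinear (fun t ht => h.mem_ball ⟨h.lt_left.le.trans ht.1, ht.2⟩) h.nearLinear_right)
    hs (mul_ne_zero (h.chart.deriv_ne_zero (h.mem_ball hsI)) hd0) (h.hasDerivAt hsI hd)
    (start := fun ε => f (γ s + ε * σ * I * deriv γ s)) (ζ := f z) ?_ ?_
  · obtain ⟨k, hk, hkM, hkeq⟩ := h.chart.exists_singular_kernel (hV hzV) (by linarith)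
    have b1 := hcr.norm_integral_mul_thermalLog_le hT hTκ hk hkM
    have b2 := hcr.norm_integral_inv_sub_mul_thermalLog_le hT hTκ hσ hfz hfne hW
    have hth : ContinuousOn (fun t => thermalLog (f (γ t) / T)) (Icc t₁ t₂) := by
      refine continuousOn_thermalLog.comp (hcr.continuousOn.div_const _) fun t ht => ?_
      rcases hcr.re_ne_zero_or ht with h1 | h1
      · left
        rw [div_ofReal_re]
        exact div_ne_zero h1 hT.ne'
      · right
        have h1' : f (γ t) = 0 := h1
        rw [h1', zero_div]
    have e : ∫ t in t₁..t₂, coth (γ t - z) * thermalLog (f (γ t) / T) * deriv γ t =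
        (∫ t in t₁..t₂, k (f (γ t)) * thermalLog (f (γ t) / T) * deriv (fun t => f (γ t)) t) +
        ∫ t in t₁..t₂, 1 / (f (γ t) - f z) * thermalLog (f (γ t) / T) *
          deriv (fun t => f (γ t)) t := by
      rw [← intervalIntegral.integral_add]
      · refine intervalIntegral.integral_congr_ae ?_
        filter_upwards [h.ae_deriv] with t hd ht
        have ht' : t ∈ Icc t₁ t₂ := by rw [← uIcc_of_le h.le]; exact uIoc_subset_uIcc ht
        rw [(h.hasDerivAt ht' (hd ht)).deriv, hkeq _ (h.mem_closedBall ht') (h.norm_lt ht')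
          (hne t ht')]
        ring
      · exact hcr.intervalIntegrable_mul ((hk.continuousOn.comp hcr.continuousOn
          fun t ht => h.norm_lt ht).mul hth)
      · exact hcr.intervalIntegrable_mul ((continuousOn_const.div (hcr.continuousOn.sub
          continuousOn_const) fun t ht => sub_ne_zero.2 (hfne t ht)).mul hth)
    rw [e, add_assoc]
    refine (norm_add_le _ _).trans ((add_le_add b1 b2).trans_eq ?_)
    ring
  -- Conformality: the image of the normal leaves `f (γ s)` with velocity `σi` times that of `f ∘
  -- γ`.
  · have hv : HasDerivAt (fun ε : ℝ => γ s + ε * σ * I * deriv γ s) (σ * I * deriv γ s) 0 := by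
      have := ((((hasDerivAt_id (0 : ℝ)).ofReal_comp.mul_const (σ : ℂ)).mul_const I).mul_const
        (deriv γ s)).const_add (γ s)
      simpa using this
    have hf : HasDerivAt f (deriv f (γ s)) (γ s + (0 : ℝ) * σ * I * deriv γ s) := by
      simpa using (h.chart.differentiableAt (h.mem_ball hsI)).hasDerivAt
    have h1 := (hasDerivAt_iff_tendsto_slope_zero.1 (hf.comp_of_eq (0 : ℝ) hv rfl)).mono_left
      (nhdsWithin_mono 0 (show Ioi (0 : ℝ) ⊆ {0}ᶜ from fun x hx => ne_of_gt hx))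
    rw [mul_left_comm]
    convert h1 using 2 with ε
    · simp only [Function.comp_apply, zero_add, ofReal_zero, zero_mul, add_zero, real_smul,
        ofReal_inv]
      ring
  · filter_upwards [hjoin] with ε hε
    have hfc : ContinuousOn f (V \ γ '' Icc t₁ t₂) :=
      h.chart.differentiableOn.continuousOn.mono fun w hw => h.chart.closedBall_subset (hV hw.1)
    refine (hε.map_continuousOn hfc).mono ?_
    rintro _ ⟨w, ⟨hw, hwγ⟩, rfl⟩
    refine ⟨(hfV w hw).trans (by linarith), ?_⟩
    rintro ⟨t, ht, he⟩
    exact hwγ ⟨t, ht, hinj w hw t ht he⟩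

end IsNearArc

/-! ### Cauchy integrals over almost straight arcs, uniformly in the pole -/

theorem cos_int_mul_pi_sq (k : ℤ) : cos (k * Real.pi) ^ 2 = 1 := by
  have h := cos_sq_add_sin_sq (k * Real.pi)
  rwa [sin_int_mul_pi, zero_pow two_ne_zero, add_zero] at h

theorem sinh_sub_int_mul_pi_mul_I (y : ℂ) (k : ℤ) :
    sinh (y - k * (Real.pi * I)) = sinh y * cos (k * Real.pi) := by
  rw [← mul_assoc, sinh_sub, cosh_mul_I, sinh_mul_I, sin_int_mul_pi]
  ring

theorem cosh_sub_int_mul_pi_mul_I (y : ℂ) (k : ℤ) :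
    cosh (y - k * (Real.pi * I)) = cosh y * cos (k * Real.pi) := by
  rw [← mul_assoc, cosh_sub, cosh_mul_I, sinh_mul_I, sin_int_mul_pi]
  ring

theorem norm_sinh_sub_int_mul_pi_mul_I (y : ℂ) (k : ℤ) :
    ‖sinh (y - k * (Real.pi * I))‖ = ‖sinh y‖ := by
  have h := congrArg norm (cos_int_mul_pi_sq k)
  rw [norm_pow, norm_one] at h
  have h1 : ‖cos ((k : ℂ) * Real.pi)‖ = 1 :=
    (pow_eq_one_iff_of_nonneg (norm_nonneg _) two_ne_zero).1 h
  rw [sinh_sub_int_mul_pi_mul_I, norm_mul, h1, mul_one]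

theorem coth_sub_int_mul_pi_mul_I (y : ℂ) (k : ℤ) : coth (y - k * (Real.pi * I)) = coth y := by
  rw [coth, sinh_sub_int_mul_pi_mul_I, cosh_sub_int_mul_pi_mul_I, coth]
  refine mul_div_mul_right _ _ fun h => ?_
  have := cos_int_mul_pi_sq k
  rw [h] at this
  norm_num at this

/-- One has `|sinh y|² = sinh²(Re y) + sin²(Im y)`; the second term is handled by Jordan's
inequality together with `2/π ≥ 1/2`. -/
theorem norm_le_two_mul_norm_sinh {y : ℂ} (hy : |y.im| ≤ Real.pi / 2) : ‖y‖ ≤ 2 * ‖sinh y‖ := by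
  have hsq : ‖sinh y‖ ^ 2 = Real.sinh y.re ^ 2 + Real.sin y.im ^ 2 := by
    have e : sinh y = (Real.sinh y.re * Real.cos y.im : ℝ) + (Real.cosh y.re * Real.sin y.im : ℝ) * I := by
      conv_lhs => rw [← re_add_im y]
      rw [sinh_add, cosh_mul_I, sinh_mul_I]
      push_cast
      ring
    rw [e, ← normSq_eq_norm_sq, normSq_add_mul_I]
    have h1 := Real.cosh_sq y.re
    have h2 := Real.sin_sq_add_cos_sq y.im
    linear_combination Real.sin y.im ^ 2 * h1 + Real.sinh y.re ^ 2 * h2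
  have h1 : y.re ^ 2 ≤ Real.sinh y.re ^ 2 := by
    rw [sq_le_sq, Real.abs_sinh]
    exact Real.self_le_sinh_iff.2 (abs_nonneg _)
  have h2 : (y.im / 2) ^ 2 ≤ Real.sin y.im ^ 2 := by
    rw [sq_le_sq, abs_div, abs_of_pos (zero_lt_two' ℝ)]
    refine le_trans ?_ (Real.mul_abs_le_abs_sin hy)
    have : 1 / 2 ≤ 2 / Real.pi := by
      rw [div_le_div_iff₀ two_pos Real.pi_pos]
      linarith [Real.pi_lt_four]
    nlinarith [abs_nonneg y.im]
  have h3 : ‖y‖ ^ 2 = y.re ^ 2 + y.im ^ 2 := by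
    rw [← normSq_eq_norm_sq, normSq_apply]
    ring
  refine abs_le_of_sq_le_sq' ?_ (by positivity) |>.2
  nlinarith [sq_nonneg y.re]

/-- A small `|sinh (w - z)|` forces `w` to be close to some translate of `z` by `πi ℤ`, so `|sinh|`
can replace the distance modulo the period. -/
theorem exists_int_norm_sub_le (y : ℂ) : ∃ k : ℤ, ‖y - k * (Real.pi * I)‖ ≤ 2 * ‖sinh y‖ := by
  refine ⟨round (y.im / Real.pi), ?_⟩
  rw [← norm_sinh_sub_int_mul_pi_mul_I y (round (y.im / Real.pi))]
  refine norm_le_two_mul_norm_sinh ?_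
  have h := abs_sub_round (y.im / Real.pi)
  have e : (y - (round (y.im / Real.pi) : ℤ) * (Real.pi * I)).im =
      Real.pi * (y.im / Real.pi - round (y.im / Real.pi)) := by
    have : (((round (y.im / Real.pi) : ℤ) : ℂ) * (Real.pi * I)).im =
        round (y.im / Real.pi) * Real.pi := by simp
    rw [sub_im, this]
    field_simp
  rw [e, abs_mul, abs_of_pos Real.pi_pos]
  nlinarith [Real.pi_pos]

theorem norm_sinh_le {y : ℂ} (hy : ‖y‖ ≤ 1 / 2) : ‖sinh y‖ ≤ 3 / 2 * ‖y‖ := by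
  have h1 := norm_sinh_sub_self_le (hy.trans (by norm_num))
  have h2 := norm_sub_norm_le (sinh y) y
  nlinarith [norm_nonneg y]

theorem norm_coth_sub_inv_le {y : ℂ} (hy : ‖y‖ ≤ 1 / 2) (h0 : y ≠ 0) : ‖coth y - 1 / y‖ ≤ 3 := by
  have hn := norm_pos_iff.2 h0
  have h1 := norm_sinh_sub_self_le (hy.trans (by norm_num))
  have h2 := norm_cosh_sub_one_le (hy.trans (by norm_num))
  have h3 := half_norm_le_norm_sinh hy
  have hs : sinh y ≠ 0 := norm_pos_iff.1 (by linarith)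
  have e : coth y - 1 / y = (y * (cosh y - 1) - (sinh y - y)) / (y * sinh y) := by
    rw [coth]
    field_simp
    ring
  rw [e, norm_div, norm_mul y (sinh y), div_le_iff₀ (by positivity)]
  have h4 := norm_sub_le (y * (cosh y - 1)) (sinh y - y)
  rw [norm_mul] at h4
  have h5 := mul_le_mul_of_nonneg_left h2 hn.le
  have h6 := mul_le_mul_of_nonneg_left h3 hn.le
  have h7 : ‖y‖ * ‖y‖ ^ 2 ≤ 1 / 2 * ‖y‖ ^ 2 := mul_le_mul_of_nonneg_right hy (by positivity)
  nlinarith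

namespace NearLinear

variable {γ : ℝ → ℂ} {d : ℂ} {α β : ℝ}

theorem norm_sub_le {J : Set ℝ} (h : NearLinear γ d (1 / 4) J) {t t' : ℝ} (ht : t ∈ J)
    (ht' : t' ∈ J) : ‖γ t - γ t'‖ ≤ 5 / 4 * ‖d‖ * |t - t'| := by
  have e : γ t - γ t' = (γ t - γ t' - (t - t') * d) + (t - t' : ℝ) * d := by push_cast; ring
  have h1 := h t ht t' ht'
  rw [e]
  refine (norm_add_le _ _).trans ?_
  rw [norm_mul _ d, norm_real, Real.norm_eq_abs]
  linarith

theorem le_norm_sub {J : Set ℝ} (h : NearLinear γ d (1 / 4) J) {t t' : ℝ} (ht : t ∈ J)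
    (ht' : t' ∈ J) : 3 / 4 * ‖d‖ * |t - t'| ≤ ‖γ t - γ t'‖ := by
  have h1 := h t ht t' ht'
  have h2 := norm_sub_norm_le ((t - t' : ℝ) * d) (γ t - γ t')
  rw [norm_mul _ d, norm_real, Real.norm_eq_abs, norm_sub_rev ((t - t' : ℝ) * d)] at h2
  push_cast at h2
  linarith

theorem continuousOn {J : Set ℝ} (h : NearLinear γ d (1 / 4) J) : ContinuousOn γ J := by
  refine LipschitzOnWith.continuousOn (K := ⟨5 / 4 * ‖d‖, by positivity⟩)
    (LipschitzOnWith.of_dist_le_mul fun t ht t' ht' => ?_)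
  rw [dist_eq_norm, Real.dist_eq]
  exact h.norm_sub_le ht ht'

theorem norm_deriv_le (h : NearLinear γ d (1 / 4) (Icc α β)) {t : ℝ} (ht : t ∈ Ioo α β)
    (hd : DifferentiableAt ℝ γ t) : ‖deriv γ t‖ ≤ 5 / 4 * ‖d‖ := by
  have := h.norm_sub_le_of_hasDerivAt (Ioo_subset_Icc_self ht)
    (neBot_nhdsWithin_Icc_diff_singleton (ht.1.trans ht.2) (Ioo_subset_Icc_self ht)) hd.hasDerivAt
  have h2 := norm_sub_norm_le (deriv γ t) d
  linarith

/-- An almost straight path avoids one of the two normal rays at each point off the path. -/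
theorem exists_slit {J : Set ℝ} (h : NearLinear γ d (1 / 4) J) (hd : d ≠ 0) {w : ℂ}
    (hw : ∀ t ∈ J, γ t ≠ w) : ∃ e : ℂ, e ≠ 0 ∧ ∀ t ∈ J, e * (γ t - w) ∈ slitPlane := by
  by_cases h1 : ∀ t ∈ J, I / d * (γ t - w) ∈ slitPlane
  · exact ⟨I / d, div_ne_zero I_ne_zero hd, h1⟩
  by_cases h2 : ∀ t ∈ J, -I / d * (γ t - w) ∈ slitPlane
  · exact ⟨-I / d, div_ne_zero (neg_ne_zero.2 I_ne_zero) hd, h2⟩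
  -- If the path met both normal rays from `w`, at `t` and `t'`, its increment would be normal to
  -- `d`. Near linearity then forces `t = t'` and puts `w` on the path.
  exfalso
  push Not at h1 h2
  obtain ⟨t, ht, h1⟩ := h1
  obtain ⟨t', ht', h2⟩ := h2
  rw [mem_slitPlane_iff, not_or, not_lt, not_not] at h1 h2
  have e1 : γ t - w = (I / d * (γ t - w)) * (-I * d) := by field_simp; rw [I_sq]; ring
  have e2 : γ t' - w = (-I / d * (γ t' - w)) * (I * d) := by field_simp; rw [I_sq]; ring
  set a := I / d * (γ t - w)
  set b := -I / d * (γ t' - w)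
  have ha : a = a.re := Complex.ext (by simp) (by simp [h1.2])
  have hb : b = b.re := Complex.ext (by simp) (by simp [h2.2])
  have hlin := h t ht t' ht'
  have e3 : γ t - γ t' - (t - t') * d = ((-(t - t') : ℝ) + (-(a.re + b.re) : ℝ) * I) * d := by
    have : γ t - γ t' = (γ t - w) - (γ t' - w) := by ring
    rw [this, e1, e2, ha, hb]
    push_cast
    simp only [ofReal_re]
    ring
  have hdn := norm_pos_iff.2 hd
  rw [e3, norm_mul, mul_right_comm, mul_le_mul_iff_left₀ hdn] at hlin
  have h3 := abs_re_le_norm ((-(t - t') : ℝ) + (-(a.re + b.re) : ℝ) * I)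
  have h4 := abs_im_le_norm ((-(t - t') : ℝ) + (-(a.re + b.re) : ℝ) * I)
  rw [add_re, re_ofReal_mul, I_re, mul_zero, add_zero, ofReal_re, abs_neg] at h3
  rw [add_im, im_ofReal_mul, I_im, mul_one, ofReal_im, zero_add, abs_neg] at h4
  have h5 : |t - t'| = 0 := le_antisymm (by linarith) (abs_nonneg _)
  have h6 := abs_nonpos_iff.1 (h4.trans (by linarith : _ ≤ (0 : ℝ)))
  have h7 : a.re = 0 := by linarith [h1.1, h2.1]
  apply hw t ht
  rw [← sub_eq_zero, e1, ha, h7, ofReal_zero, zero_mul]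

end NearLinear

theorem norm_log_sub_real_log_le {x : ℂ} : ‖log x - Real.log ‖x‖‖ ≤ Real.pi := by
  have e : log x - Real.log ‖x‖ = arg x * I := by
    rw [log]
    ring
  rw [e, norm_mul, norm_I, mul_one, norm_real, Real.norm_eq_abs]
  exact abs_arg_le_pi x

section kernel

variable {γ g : ℝ → ℂ} {d : ℂ} {α β ε : ℝ}

theorem norm_integral_le_of_norm_le_Ioo {F : ℝ → ℂ} {C : ℝ} (hαβ : α ≤ β)
    (h : ∀ t ∈ Ioo α β, ‖F t‖ ≤ C) : ‖∫ t in α..β, F t‖ ≤ C * (β - α) := by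
  have := intervalIntegral.norm_integral_le_of_norm_le_const_ae (a := α) (b := β) (f := F) (C := C) ?_
  · rwa [abs_of_nonneg (by linarith)] at this
  · have hfin : (({β} : Set ℝ)ᶜ) ∈ MeasureTheory.ae MeasureTheory.volume :=
      MeasureTheory.compl_mem_ae_iff.2 ((toFinite {β}).measure_zero _)
    filter_upwards [hfin] with t ht hmem
    rw [uIoc_of_le hαβ] at hmem
    exact h t ⟨hmem.1, lt_of_le_of_ne hmem.2 ht⟩

/-- The Cauchy integral over an almost straight path, uniformly in the pole. -/
theorem norm_integral_inv_sub_mul_le (hαβ : α ≤ β) (hd : d ≠ 0)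
    (hlin : NearLinear γ d (1 / 4) (Icc α β)) (hdiff : ∀ t ∈ Ioo α β, DifferentiableAt ℝ γ t)
    (hi : IntervalIntegrable (deriv γ) MeasureTheory.volume α β)
    (hg : ∀ t ∈ Icc α β, ‖g t‖ ≤ ε)
    (hgl : ∀ t ∈ Icc α β, ∀ t' ∈ Icc α β, ‖g t - g t'‖ ≤ ε * |t - t'|)
    (hgc : ContinuousOn g (Icc α β)) {w : ℂ}
    (hw : ∀ t ∈ Icc α β, γ t ≠ w) (hw1 : ∀ t ∈ Icc α β, ‖γ t - w‖ ≤ 1) :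
    ‖(∫ t in α..β, 1 / (γ t - w) * g t * deriv γ t) -
      (g β * Real.log ‖γ β - w‖ - g α * Real.log ‖γ α - w‖)‖ ≤
      (4 * (β - α) + 7 + 6 / ‖d‖) * ε := by
  have hε : 0 ≤ ε := (norm_nonneg _).trans (hg α ⟨le_rfl, hαβ⟩)
  have hdn := norm_pos_iff.2 hd
  have hα : α ∈ Icc α β := ⟨le_rfl, hαβ⟩
  have hβ : β ∈ Icc α β := ⟨hαβ, le_rfl⟩
  -- With `s` the parameter closest to `w`, the distance to `w` grows at least linearly in `|t -
  -- s|`. Subtracting the constant `g s` then makes the integrand bounded, and only the pure kernel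
  -- integral keeps a logarithm.
  obtain ⟨s, hs, hmin⟩ := isCompact_Icc.exists_isMinOn ⟨α, hα⟩
    ((hlin.continuousOn.sub continuousOn_const).norm : ContinuousOn (fun t => ‖γ t - w‖) (Icc α β))
  have hdist : ∀ t ∈ Icc α β, 3 / 8 * ‖d‖ * |t - s| ≤ ‖γ t - w‖ := by
    intro t ht
    have h1 := hlin.le_norm_sub ht hs
    have h2 := norm_sub_le (γ t - w) (γ s - w)
    rw [sub_sub_sub_cancel_right] at h2
    have h3 : ‖γ s - w‖ ≤ ‖γ t - w‖ := hmin ht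
    linarith
  obtain ⟨e, he, hslit⟩ := hlin.exists_slit hd hw
  have hΛ := integral_inv_sub_eq_log hαβ hlin.continuousOn countable_empty
    (fun t ht => hdiff t ht.1) hi hslit
  have hinv : ContinuousOn (fun t => 1 / (γ t - w)) (Icc α β) :=
    continuousOn_const.div (hlin.continuousOn.sub continuousOn_const)
      fun t ht => sub_ne_zero.2 (hw t ht)
  have hint : ∀ {f : ℝ → ℂ}, ContinuousOn f (Icc α β) →
      IntervalIntegrable (fun t => f t * deriv γ t) MeasureTheory.volume α β := fun hf =>
    hi.continuousOn_mul (by rwa [uIcc_of_le hαβ])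
  have hsplit : ∫ t in α..β, 1 / (γ t - w) * g t * deriv γ t =
      (∫ t in α..β, 1 / (γ t - w) * (g t - g s) * deriv γ t) +
        g s * ∫ t in α..β, 1 / (γ t - w) * deriv γ t := by
    rw [← intervalIntegral.integral_const_mul, ← intervalIntegral.integral_add
      (hint (f := fun t => 1 / (γ t - w) * (g t - g s)) (hinv.mul (hgc.sub continuousOn_const)))
      ((hint hinv).const_mul _)]
    congr 1
    ext t
    ring
  have bA : ‖∫ t in α..β, 1 / (γ t - w) * (g t - g s) * deriv γ t‖ ≤ 4 * ε * (β - α) := by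
    refine norm_integral_le_of_norm_le_Ioo hαβ fun t ht => ?_
    have ht' := Ioo_subset_Icc_self ht
    have h1 := norm_pos_iff.2 (sub_ne_zero.2 (hw t ht'))
    have h2 := hlin.norm_deriv_le ht (hdiff t ht)
    have h3 := hgl t ht' s hs
    have h4 := hdist t ht'
    rw [norm_mul, norm_mul, norm_div, norm_one, one_div_mul_eq_div, div_mul_eq_mul_div,
      div_le_iff₀ h1]
    calc ‖g t - g s‖ * ‖deriv γ t‖ ≤ ε * |t - s| * (5 / 4 * ‖d‖) :=
          mul_le_mul h3 h2 (norm_nonneg _) (by positivity)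
      _ ≤ 4 * ε * (3 / 8 * ‖d‖ * |t - s|) := by
          have : 0 ≤ ε * |t - s| * ‖d‖ := by positivity
          linarith
      _ ≤ _ := mul_le_mul_of_nonneg_left h4 (by positivity)
  -- The direction `e` of the slit is not controlled, but `log ‖e‖` cancels between the two ends,
  -- and each argument costs at most `π`.
  have hlog : ∀ t ∈ Icc α β, ‖log (e * (γ t - w)) - (Real.log ‖e‖ + Real.log ‖γ t - w‖)‖ ≤
      Real.pi := by
    intro t ht
    have h1 := norm_pos_iff.2 (sub_ne_zero.2 (hw t ht))
    have := norm_log_sub_real_log_le (x := e * (γ t - w))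
    rw [norm_mul, Real.log_mul (norm_pos_iff.2 he).ne' h1.ne'] at this
    push_cast at this
    exact this
  -- Replacing `g s` by the end values costs a multiple of `|t - s| · |log ‖γ t - w‖|`, which is
  -- bounded because `x |log x| ≤ 1` on `(0, 1]`.
  have bC : ∀ t ∈ Icc α β, ‖(g s - g t) * Real.log ‖γ t - w‖‖ ≤ 3 / ‖d‖ * ε := by
    intro t ht
    have h1 := norm_pos_iff.2 (sub_ne_zero.2 (hw t ht))
    have h2 := Real.abs_log_mul_self_lt _ h1 (hw1 t ht)
    rw [abs_mul, abs_of_pos h1] at h2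
    have h3 := hgl s hs t ht
    rw [abs_sub_comm] at h3
    have h4 := hdist t ht
    rw [norm_mul, norm_real, Real.norm_eq_abs, div_mul_eq_mul_div, le_div_iff₀ hdn]
    have h5 := mul_le_mul_of_nonneg_right h4 (abs_nonneg (Real.log ‖γ t - w‖))
    have h6 := mul_le_mul_of_nonneg_right h3 (abs_nonneg (Real.log ‖γ t - w‖))
    have h7 : |t - s| * |Real.log ‖γ t - w‖| * ‖d‖ ≤ 3 := by nlinarith
    calc ‖g s - g t‖ * |Real.log ‖γ t - w‖| * ‖d‖
        ≤ ε * |t - s| * |Real.log ‖γ t - w‖| * ‖d‖ := mul_le_mul_of_nonneg_right h6 hdn.le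
      _ = ε * (|t - s| * |Real.log ‖γ t - w‖| * ‖d‖) := by ring
      _ ≤ ε * 3 := mul_le_mul_of_nonneg_left h7 hε
      _ = 3 * ε := by ring
  rw [hsplit, hΛ]
  set Lα := log (e * (γ α - w))
  set Lβ := log (e * (γ β - w))
  set ℓα := Real.log ‖γ α - w‖
  set ℓβ := Real.log ‖γ β - w‖
  set ℓe := Real.log ‖e‖
  have e1 : (∫ t in α..β, 1 / (γ t - w) * (g t - g s) * deriv γ t) + g s * (Lβ - Lα) -
      (g β * ℓβ - g α * ℓα) = (∫ t in α..β, 1 / (γ t - w) * (g t - g s) * deriv γ t) +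
      g s * ((Lβ - (ℓe + ℓβ)) - (Lα - (ℓe + ℓα))) + ((g s - g β) * ℓβ - (g s - g α) * ℓα) := by
    ring
  rw [e1]
  refine (norm_add₃_le).trans ?_
  have b2 : ‖g s * ((Lβ - (ℓe + ℓβ)) - (Lα - (ℓe + ℓα)))‖ ≤ ε * (Real.pi + Real.pi) := by
    rw [norm_mul]
    exact mul_le_mul (hg s hs) ((norm_sub_le _ _).trans (add_le_add (hlog β hβ) (hlog α hα)))
      (norm_nonneg _) hε
  have b3 := (norm_sub_le ((g s - g β) * ℓβ) ((g s - g α) * ℓα)).trans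
    (add_le_add (bC β hβ) (bC α hα))
  have hpi : ε * (Real.pi + Real.pi) ≤ ε * 7 :=
    mul_le_mul_of_nonneg_left (by linarith [Real.pi_lt_d2]) hε
  have e2 : 3 / ‖d‖ * ε + 3 / ‖d‖ * ε = 6 / ‖d‖ * ε := by ring
  linarith

/-- The logarithm of `|sinh y|`, cut off at `0`. -/
noncomputable def logSinh (y : ℂ) : ℝ := Real.log (min 1 ‖sinh y‖)

theorem abs_logSinh_le {y : ℂ} {c : ℝ} (hc : 0 < c) (hy : c ≤ ‖sinh y‖) :
    |logSinh y| ≤ |Real.log c| := by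
  rw [logSinh]
  rcases le_total 1 ‖sinh y‖ with h | h
  · rw [min_eq_left h, Real.log_one, abs_zero]
    exact abs_nonneg _
  · rw [min_eq_right h]
    have h1 := Real.log_le_log hc hy
    have h2 := Real.log_nonpos (hc.le.trans hy) h
    rw [abs_of_nonpos h2, abs_of_nonpos (h1.trans h2)]
    linarith

theorem abs_logSinh_sub_le {y : ℂ} (hy : ‖y‖ ≤ 1 / 2) (h0 : y ≠ 0) :
    |logSinh y - Real.log ‖y‖| ≤ 1 := by
  have hn := norm_pos_iff.2 h0
  have h1 := half_norm_le_norm_sinh hy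
  have h2 := norm_sinh_le hy
  have hs : 0 < ‖sinh y‖ := by linarith
  rw [logSinh, min_eq_right (by linarith), ← Real.log_div hs.ne' hn.ne', abs_le]
  have hl2 := Real.log_two_lt_d9
  constructor
  · have : Real.log (1 / 2) ≤ Real.log (‖sinh y‖ / ‖y‖) :=
      Real.log_le_log (by norm_num) (by rw [le_div_iff₀ hn]; linarith)
    rw [one_div, Real.log_inv] at this
    linarith
  · have : Real.log (‖sinh y‖ / ‖y‖) ≤ Real.log 2 :=
      Real.log_le_log (by positivity) (by rw [div_le_iff₀ hn]; linarith)
    linarith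

/-- The integral with the kernel `coth` over a short almost straight path, uniformly in the
pole. -/
theorem norm_integral_coth_mul_sub_le (hαβ : α ≤ β) (hd : d ≠ 0)
    (hlin : NearLinear γ d (1 / 4) (Icc α β)) (hdiff : ∀ t ∈ Ioo α β, DifferentiableAt ℝ γ t)
    (hi : IntervalIntegrable (deriv γ) MeasureTheory.volume α β) (hshort : ‖d‖ * (β - α) ≤ 1 / 8)
    (hg : ∀ t ∈ Icc α β, ‖g t‖ ≤ ε)
    (hgl : ∀ t ∈ Icc α β, ∀ t' ∈ Icc α β, ‖g t - g t'‖ ≤ ε * |t - t'|)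
    (hgc : ContinuousOn g (Icc α β)) {z : ℂ} (hz : ∀ t ∈ Icc α β, sinh (γ t - z) ≠ 0) :
    ‖(∫ t in α..β, coth (γ t - z) * g t * deriv γ t) -
      (g β * logSinh (γ β - z) - g α * logSinh (γ α - z))‖ ≤
      (4 * (β - α) + 11 + 6 / ‖d‖ + 2 * |Real.log (1 / 8)|) * ε := by
  have hε : 0 ≤ ε := (norm_nonneg _).trans (hg α ⟨le_rfl, hαβ⟩)
  have hdn := norm_pos_iff.2 hd
  have hα : α ∈ Icc α β := ⟨le_rfl, hαβ⟩
  have hβ : β ∈ Icc α β := ⟨hαβ, le_rfl⟩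
  have hℓ : 0 ≤ β - α := by linarith
  have hm : ∀ t ∈ Icc α β, ∀ M C : ℝ, |M| ≤ C → ‖g t * (M : ℂ)‖ ≤ C * ε := by
    intro t ht M C hM
    rw [norm_mul, norm_real, Real.norm_eq_abs, mul_comm]
    exact mul_le_mul hM (hg t ht) (norm_nonneg _) ((abs_nonneg _).trans hM)
  -- Either the kernel is bounded on the arc and everything is trivial, or some translate `w` of `z`
  -- by the period is within `1/2` of the whole short arc; then `z` is replaced by `w`, and `coth`
  -- by `1/y` up to a bounded error.
  by_cases hfar : ∀ t ∈ Icc α β, 1 / 8 ≤ ‖sinh (γ t - z)‖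
  · have b1 : ‖∫ t in α..β, coth (γ t - z) * g t * deriv γ t‖ ≤ 9 * ε * (5 / 4 * ‖d‖) * (β - α) := by
      refine norm_integral_le_of_norm_le_Ioo hαβ fun t ht => ?_
      have ht' := Ioo_subset_Icc_self ht
      have h1 := norm_coth_le (by norm_num) (hfar t ht')
      rw [norm_mul, norm_mul]
      refine mul_le_mul (mul_le_mul (h1.trans (by norm_num)) (hg t ht') (norm_nonneg _)
        (by norm_num)) (hlin.norm_deriv_le ht (hdiff t ht)) (norm_nonneg _) (by positivity)
    have b2 := hm β hβ _ _ (abs_logSinh_le (by norm_num) (hfar β hβ))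
    have b3 := hm α hα _ _ (abs_logSinh_le (by norm_num) (hfar α hα))
    refine (norm_sub_le _ _).trans ((add_le_add b1 ((norm_sub_le _ _).trans
      (add_le_add b2 b3))).trans ?_)
    have h1 := mul_le_mul_of_nonneg_left hshort hε
    have h2 : 0 ≤ 6 / ‖d‖ * ε := by positivity
    have h3 : 0 ≤ (β - α) * ε := by positivity
    nlinarith
  · push Not at hfar
    obtain ⟨t₀, ht₀, hlt⟩ := hfar
    obtain ⟨k, hk⟩ := exists_int_norm_sub_le (γ t₀ - z)
    set w := z + k * (Real.pi * I) with hw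
    have ew : ∀ t, γ t - w = γ t - z - k * (Real.pi * I) := fun t => by rw [hw]; ring
    have hclose : ∀ t ∈ Icc α β, ‖γ t - w‖ ≤ 1 / 2 := by
      intro t ht
      have h1 := hlin.norm_sub_le ht ht₀
      have h2 : |t - t₀| ≤ β - α := abs_le.2 ⟨by linarith [ht.1, ht₀.2], by linarith [ht.2, ht₀.1]⟩
      have h3 := mul_le_mul_of_nonneg_left h2 hdn.le
      rw [← ew] at hk
      have h4 := norm_add_le (γ t - γ t₀) (γ t₀ - w)
      rw [sub_add_sub_cancel] at h4
      linarith
    have hsinh : ∀ t, ‖sinh (γ t - w)‖ = ‖sinh (γ t - z)‖ := fun t => by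
      rw [ew, norm_sinh_sub_int_mul_pi_mul_I]
    have hcoth : ∀ t, coth (γ t - w) = coth (γ t - z) := fun t => by
      rw [ew, coth_sub_int_mul_pi_mul_I]
    have hlogs : ∀ t, logSinh (γ t - w) = logSinh (γ t - z) := fun t => by
      rw [logSinh, logSinh, hsinh]
    have hne : ∀ t ∈ Icc α β, γ t - w ≠ 0 := by
      intro t ht h0
      have h1 := hsinh t
      rw [h0, sinh_zero, norm_zero] at h1
      exact hz t ht (norm_eq_zero.1 h1.symm)
    simp only [← hcoth, ← hlogs]
    have hγc := hlin.continuousOn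
    have hint : ∀ {f : ℝ → ℂ}, ContinuousOn f (Icc α β) →
        IntervalIntegrable (fun t => f t * deriv γ t) MeasureTheory.volume α β := fun hf =>
      hi.continuousOn_mul (by rwa [uIcc_of_le hαβ])
    have hinv : ContinuousOn (fun t => 1 / (γ t - w)) (Icc α β) :=
      continuousOn_const.div (hγc.sub continuousOn_const) hne
    have hcothc : ContinuousOn (fun t => coth (γ t - w)) (Icc α β) := by
      refine ContinuousOn.div ?_ ?_ fun t ht h0 => ?_
      · exact continuous_cosh.comp_continuousOn (hγc.sub continuousOn_const)
      · exact continuous_sinh.comp_continuousOn (hγc.sub continuousOn_const)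
      · have h1 := hsinh t
        rw [h0, norm_zero] at h1
        exact hz t ht (norm_eq_zero.1 h1.symm)
    have hsplit : ∫ t in α..β, coth (γ t - w) * g t * deriv γ t =
        (∫ t in α..β, (coth (γ t - w) - 1 / (γ t - w)) * g t * deriv γ t) +
          ∫ t in α..β, 1 / (γ t - w) * g t * deriv γ t := by
      rw [← intervalIntegral.integral_add
        (hint (f := fun t => (coth (γ t - w) - 1 / (γ t - w)) * g t) ((hcothc.sub hinv).mul hgc))
        (hint (f := fun t => 1 / (γ t - w) * g t) (hinv.mul hgc))]
      congr 1
      ext t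
      ring
    have b1 : ‖∫ t in α..β, (coth (γ t - w) - 1 / (γ t - w)) * g t * deriv γ t‖ ≤
        3 * ε * (5 / 4 * ‖d‖) * (β - α) := by
      refine norm_integral_le_of_norm_le_Ioo hαβ fun t ht => ?_
      have ht' := Ioo_subset_Icc_self ht
      rw [norm_mul, norm_mul]
      exact mul_le_mul (mul_le_mul (norm_coth_sub_inv_le (hclose t ht') (hne t ht')) (hg t ht')
        (norm_nonneg _) (by norm_num)) (hlin.norm_deriv_le ht (hdiff t ht)) (norm_nonneg _)
        (by positivity)
    have b2 := norm_integral_inv_sub_mul_le hαβ hd hlin hdiff hi hg hgl hgc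
      (fun t ht => sub_ne_zero.1 (hne t ht)) (fun t ht => (hclose t ht).trans (by norm_num))
    have b3 := hm β hβ _ _ (abs_logSinh_sub_le (hclose β hβ) (hne β hβ))
    have b4 := hm α hα _ _ (abs_logSinh_sub_le (hclose α hα) (hne α hα))
    rw [hsplit]
    set X := ∫ t in α..β, (coth (γ t - w) - 1 / (γ t - w)) * g t * deriv γ t
    set Y := ∫ t in α..β, 1 / (γ t - w) * g t * deriv γ t
    push_cast at b3 b4
    have e1 : X + Y - (g β * logSinh (γ β - w) - g α * logSinh (γ α - w)) =
        X + (Y - (g β * Real.log ‖γ β - w‖ - g α * Real.log ‖γ α - w‖)) +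
        (g α * (logSinh (γ α - w) - Real.log ‖γ α - w‖) -
          g β * (logSinh (γ β - w) - Real.log ‖γ β - w‖)) := by ring
    rw [e1]
    refine (norm_add₃_le).trans ((add_le_add (add_le_add b1 b2) ((norm_sub_le _ _).trans
      (add_le_add b4 b3))).trans ?_)
    have h1 := mul_le_mul_of_nonneg_left hshort hε
    have h3 : 0 ≤ |Real.log (1 / 8)| * ε := by positivity
    nlinarith

end kernel

/-! ### Regularity of admissible contours -/

namespace Mesh

variable (m : Mesh)

theorem knot_le {i j : ℕ} (hij : i ≤ j) (hj : j ≤ m.n) : m.knot i ≤ m.knot j := by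
  induction j, hij using Nat.le_induction with
  | base => exact le_rfl
  | succ k hik ih => exact (ih (by omega)).trans (m.knot_lt k (by omega)).le

theorem piece_subset {i : ℕ} (hi : i < m.n) : m.piece i ⊆ m.domain :=
  Icc_subset_Icc (m.knot_le (Nat.zero_le i) hi.le) (m.knot_le hi le_rfl)

theorem exists_left_piece {x : ℝ} (hx : x ∈ Ioc m.first m.last) :
    ∃ i < m.n, m.knot i < x ∧ x ≤ m.knot (i + 1) := by
  classical
  have hex : ∃ i, x ≤ m.knot i := ⟨m.n, hx.2⟩
  have h0 : Nat.find hex ≠ 0 := fun h0 => by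
    have := Nat.find_spec hex
    rw [h0] at this
    exact absurd hx.1 (not_lt.2 this)
  obtain ⟨i, hi⟩ := Nat.exists_eq_succ_of_ne_zero h0
  have hle : Nat.find hex ≤ m.n := Nat.find_min' hex hx.2
  refine ⟨i, by omega, not_le.1 (Nat.find_min hex (by omega)), ?_⟩
  have := Nat.find_spec hex
  rwa [hi] at this

theorem exists_right_piece {x : ℝ} (hx : x ∈ Ico m.first m.last) :
    ∃ i < m.n, m.knot i ≤ x ∧ x < m.knot (i + 1) := by
  classical
  have hex : ∃ i, x < m.knot i := ⟨m.n, hx.2⟩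
  have h0 : Nat.find hex ≠ 0 := fun h0 => by
    have := Nat.find_spec hex
    rw [h0] at this
    exact absurd hx.1 (not_le.2 this)
  obtain ⟨i, hi⟩ := Nat.exists_eq_succ_of_ne_zero h0
  have hle : Nat.find hex ≤ m.n := Nat.find_min' hex hx.2
  refine ⟨i, by omega, not_lt.1 (Nat.find_min hex (by omega)), ?_⟩
  have := Nat.find_spec hex
  rwa [hi] at this

theorem first_lt_last : m.first < m.last := m.first_lt.trans (m.minus_lt_plus.trans m.lt_last)

theorem tMinus_mem : m.tMinus ∈ Ioo m.first m.last := ⟨m.first_lt, m.minus_lt_plus.trans m.lt_last⟩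

theorem tPlus_mem : m.tPlus ∈ Ioo m.first m.last := ⟨m.first_lt.trans m.minus_lt_plus, m.lt_last⟩

end Mesh

namespace IsAdmissible

variable {m : Mesh} {U : Set ℂ} {u : ℂ → ℂ} {γ : ℝ → ℂ}

theorem continuousOn (h : IsAdmissible m U u γ) : ContinuousOn γ m.domain := by
  have hk : ∀ k ≤ m.n, ContinuousOn γ (Icc (m.knot 0) (m.knot k)) := by
    intro k
    induction k with
    | zero =>
      intro _
      rw [Icc_self]
      exact continuousOn_singleton _ _
    | succ k ih =>
      intro hk
      rw [← Icc_union_Icc_eq_Icc (m.knot_le (Nat.zero_le k) (by omega)) (m.knot_lt k (by omega)).le]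
      exact (ih (by omega)).union_of_isClosed (h.contDiffOn k (by omega)).continuousOn
        isClosed_Icc isClosed_Icc
  exact hk m.n le_rfl

theorem hasDerivWithinAt (h : IsAdmissible m U u γ) {i : ℕ} (hi : i < m.n) {t : ℝ}
    (ht : t ∈ m.piece i) : HasDerivWithinAt γ (derivWithin γ (m.piece i) t) (m.piece i) t :=
  ((h.contDiffOn i hi).differentiableOn one_ne_zero t ht).hasDerivWithinAt

theorem continuousOn_derivWithin (h : IsAdmissible m U u γ) {i : ℕ} (hi : i < m.n) :
    ContinuousOn (derivWithin γ (m.piece i)) (m.piece i) :=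
  (h.contDiffOn i hi).continuousOn_derivWithin (uniqueDiffOn_Icc (m.knot_lt i hi)) le_rfl

theorem differentiableAt (h : IsAdmissible m U u γ) {i : ℕ} (hi : i < m.n) {t : ℝ}
    (ht : t ∈ Ioo (m.knot i) (m.knot (i + 1))) : DifferentiableAt ℝ γ t :=
  ((h.hasDerivWithinAt hi (Ioo_subset_Icc_self ht)).hasDerivAt (Icc_mem_nhds ht.1 ht.2)).differentiableAt

theorem intervalIntegrable_deriv (h : IsAdmissible m U u γ) :
    IntervalIntegrable (deriv γ) MeasureTheory.volume m.first m.last := by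
  refine IntervalIntegrable.trans_iterate fun k hk => ?_
  have hlt := m.knot_lt k hk
  have hc : ContinuousOn (derivWithin γ (m.piece k)) (uIcc (m.knot k) (m.knot (k + 1))) := by
    rw [uIcc_of_le hlt.le]
    exact h.continuousOn_derivWithin hk
  refine hc.intervalIntegrable.congr_uIoo fun t ht => ?_
  rw [uIoo_of_le hlt.le] at ht
  exact derivWithin_of_mem_nhds (Icc_mem_nhds ht.1 ht.2)

theorem intervalIntegrable_mul (h : IsAdmissible m U u γ) {F : ℝ → ℂ} {a b : ℝ}
    (ha : m.first ≤ a) (hab : a ≤ b) (hb : b ≤ m.last) (hF : ContinuousOn F (Icc a b)) :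
    IntervalIntegrable (fun t => F t * deriv γ t) MeasureTheory.volume a b := by
  refine IntervalIntegrable.continuousOn_mul (h.intervalIntegrable_deriv.mono_set ?_) ?_
  · rw [uIcc_of_le hab, uIcc_of_le m.first_lt_last.le]
    exact Icc_subset_Icc ha hb
  · rwa [uIcc_of_le hab]

theorem intervalIntegrable_deriv_of_le (h : IsAdmissible m U u γ) {a b : ℝ}
    (ha : m.first ≤ a) (hab : a ≤ b) (hb : b ≤ m.last) :
    IntervalIntegrable (deriv γ) MeasureTheory.volume a b := by
  simpa using h.intervalIntegrable_mul (F := fun _ => 1) ha hab hb continuousOn_const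

end IsAdmissible

theorem uBar_re (u : ℂ → ℂ) (p : ℤ) (T : ℝ) (z : ℂ) : (uBar u p T z).re = (u z).re := by
  rw [uBar, sub_re]
  simp

theorem uBar_im (u : ℂ → ℂ) (p : ℤ) (T : ℝ) (z : ℂ) :
    (uBar u p T z).im = (u z).im - 2 * Real.pi * p * T := by
  rw [uBar, sub_im]
  simp

theorem uBar_sub_uBar (u : ℂ → ℂ) (p : ℤ) (T : ℝ) (z w : ℂ) :
    uBar u p T z - uBar u p T w = u z - u w := by
  rw [uBar, uBar]
  ring

/-! ### Families converging at low temperature -/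

/-- The functions and contours depend on the temperature and converge at low temperature. -/
structure IsFamily (m : Mesh) (U : Set ℂ) (𝒯 : Set ℝ) (u : ℝ → ℂ → ℂ) (γ : ℝ → ℝ → ℂ) (p : ℝ → ℤ)
    (u₀ : ℂ → ℂ) (γ₀ : ℝ → ℂ) : Prop where
  pos : ∀ T ∈ 𝒯, 0 < T
  adm : ∀ T ∈ 𝒯, IsAdmissible m U (u T) (γ T)
  im_minus : ∀ T ∈ 𝒯, (u T (γ T m.tMinus)).im = 2 * Real.pi * p T * T
  im_plus : ∀ T ∈ 𝒯, (u T (γ T m.tPlus)).im = 2 * Real.pi * p T * T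
  adm₀ : IsAdmissible m U u₀ γ₀
  tendsto_u : TendstoUniformlyOn u u₀ (𝓝[𝒯] 0) U
  tendsto_γ : TendstoC1 m γ γ₀ (𝓝[𝒯] 0)

namespace IsFamily

variable {m : Mesh} {U : Set ℂ} {𝒯 : Set ℝ} {u : ℝ → ℂ → ℂ} {γ : ℝ → ℝ → ℂ} {p : ℝ → ℤ}
  {u₀ : ℂ → ℂ} {γ₀ : ℝ → ℂ}

theorem eventually_mem (_ : IsFamily m U 𝒯 u γ p u₀ γ₀) : ∀ᶠ T in 𝓝[𝒯] (0 : ℝ), T ∈ 𝒯 :=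
  self_mem_nhdsWithin

theorem eventually_pos (h : IsFamily m U 𝒯 u γ p u₀ γ₀) : ∀ᶠ T in 𝓝[𝒯] (0 : ℝ), 0 < T :=
  h.eventually_mem.mono h.pos

theorem eventually_lt (_ : IsFamily m U 𝒯 u γ p u₀ γ₀) {a : ℝ} (ha : 0 < a) :
    ∀ᶠ T in 𝓝[𝒯] (0 : ℝ), T < a := mem_nhdsWithin_of_mem_nhds (gt_mem_nhds ha)

theorem eventually_dist_path_lt (h : IsFamily m U 𝒯 u γ p u₀ γ₀) {η : ℝ} (hη : 0 < η) :
    ∀ᶠ T in 𝓝[𝒯] (0 : ℝ), ∀ t ∈ m.domain, ‖γ T t - γ₀ t‖ < η := by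
  filter_upwards [Metric.tendstoUniformlyOn_iff.1 h.tendsto_γ.1 η hη] with T hT t ht
  rw [← dist_eq_norm, dist_comm]
  exact hT t ht

/-- Uniform convergence of `u` is combined with the continuity of `u₀`, uniform near the compact
limiting contour. -/
theorem eventually_dist_fun_lt (h : IsFamily m U 𝒯 u γ p u₀ γ₀) {η : ℝ} (hη : 0 < η) :
    ∀ᶠ T in 𝓝[𝒯] (0 : ℝ), ∀ t ∈ m.domain, ‖u T (γ T t) - u₀ (γ₀ t)‖ < η := by
  have hK : IsCompact (γ₀ '' m.domain) := isCompact_Icc.image_of_continuousOn h.adm₀.continuousOn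
  have hu := hK.uniformContinuousAt_of_continuousAt u₀ (fun z hz => by
    obtain ⟨t, ht, rfl⟩ := hz
    exact (h.adm₀.holomorphic.differentiableAt
      (h.adm₀.isOpen.mem_nhds (h.adm₀.mapsTo ht))).continuousAt)
    (Metric.dist_mem_uniformity (half_pos hη))
  obtain ⟨ε, hε, hsub⟩ := Metric.mem_uniformity_dist.1 hu
  filter_upwards [h.eventually_mem, h.eventually_dist_path_lt hε,
    Metric.tendstoUniformlyOn_iff.1 h.tendsto_u (η / 2) (half_pos hη)] with T hT h1 h2 t ht
  have h3 := h2 (γ T t) ((h.adm T hT).mapsTo ht)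
  have h4 : dist (u₀ (γ₀ t)) (u₀ (γ T t)) < η / 2 :=
    hsub (a := γ₀ t) (b := γ T t) (by rw [dist_comm, dist_eq_norm]; exact h1 t ht) ⟨t, ht, rfl⟩
  rw [← dist_eq_norm, dist_comm]
  linarith [dist_triangle (u₀ (γ₀ t)) (u₀ (γ T t)) (u T (γ T t))]

/-- By Weierstrass' theorem locally uniform convergence of holomorphic functions carries over to
their derivatives. The radius `R` is independent of `T`. -/
theorem eventually_deriv_near (h : IsFamily m U 𝒯 u γ p u₀ γ₀) {z : ℂ} (hz : z ∈ U) {η : ℝ}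
    (hη : 0 < η) : ∃ R > 0, Metric.ball z R ⊆ U ∧
      ∀ᶠ T in 𝓝[𝒯] (0 : ℝ), ∀ w ∈ Metric.ball z R, ‖deriv (u T) w - deriv u₀ z‖ ≤ η := by
  have hU := h.adm₀.isOpen
  have hloc := h.tendsto_u.tendstoLocallyUniformlyOn.deriv
    (h.eventually_mem.mono fun T hT => (h.adm T hT).holomorphic) hU
  obtain ⟨s, hs, hT⟩ := Metric.tendstoLocallyUniformlyOn_iff.1 hloc (η / 2) (half_pos hη) z hz
  rw [hU.nhdsWithin_eq hz] at hs
  have hc : ContinuousAt (deriv u₀) z :=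
    ((h.adm₀.holomorphic.deriv hU).differentiableAt (hU.mem_nhds hz)).continuousAt
  have hc' := hc (Metric.ball_mem_nhds _ (half_pos hη))
  obtain ⟨R, hR, hsub⟩ := Metric.mem_nhds_iff.1
    (inter_mem (inter_mem hs (hU.mem_nhds hz)) hc')
  refine ⟨R, hR, fun w hw => (hsub hw).1.2, ?_⟩
  filter_upwards [hT] with T hT w hw
  have h1 := hT w (hsub hw).1.1
  have h2 : dist (deriv u₀ w) (deriv u₀ z) < η / 2 := (hsub hw).2
  rw [← dist_eq_norm]
  have := dist_triangle_left (deriv (u T) w) (deriv u₀ z) (deriv u₀ w)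
  exact this.trans (by simp only [Function.comp] at h1; linarith)

/-- The mean value inequality is applied to `γ T s - s d` within one piece. The reference velocity
and the size of the interval are those of the limiting contour, so neither depends on `T`. -/
theorem eventually_nearLinear (h : IsFamily m U 𝒯 u γ p u₀ γ₀) {i : ℕ} (hi : i < m.n) {x : ℝ}
    (hx : x ∈ m.piece i) {η : ℝ} (hη : 0 < η) : ∃ ε > 0, ∀ᶠ T in 𝓝[𝒯] (0 : ℝ),
      NearLinear (γ T) (derivWithin γ₀ (m.piece i) x) η (m.piece i ∩ Ioo (x - ε) (x + ε)) := by
  set d := derivWithin γ₀ (m.piece i) x with hd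
  have hdn : 0 < ‖d‖ := norm_pos_iff.2 (h.adm₀.deriv_ne_zero i hi x hx)
  have hpos : 0 < η * ‖d‖ / 2 := by positivity
  obtain ⟨ε, hε, hsub⟩ := Metric.mem_nhdsWithin_iff.1
    (h.adm₀.continuousOn_derivWithin hi x hx (Metric.ball_mem_nhds _ hpos))
  refine ⟨ε, hε, ?_⟩
  filter_upwards [h.eventually_mem, Metric.tendstoUniformlyOn_iff.1 (h.tendsto_γ.2 i hi) _ hpos]
    with T hT h1 t ht t' ht'
  have hder : ∀ s ∈ m.piece i ∩ Ioo (x - ε) (x + ε), HasDerivWithinAt (fun s : ℝ => γ T s - s * d)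
      (derivWithin (γ T) (m.piece i) s - d) (m.piece i ∩ Ioo (x - ε) (x + ε)) s := by
    intro s hs
    have := (((h.adm T hT).hasDerivWithinAt hi hs.1).mono inter_subset_left).sub
      (((hasDerivAt_id s).ofReal_comp.mul_const d).hasDerivWithinAt
        (s := m.piece i ∩ Ioo (x - ε) (x + ε)))
    simp only [ofReal_one, one_mul] at this
    exact this
  have hbd : ∀ s ∈ m.piece i ∩ Ioo (x - ε) (x + ε),
      ‖derivWithin (γ T) (m.piece i) s - d‖ ≤ η * ‖d‖ := by
    intro s hs
    have h2 := h1 s hs.1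
    have h3 : dist (derivWithin γ₀ (m.piece i) s) d < η * ‖d‖ / 2 :=
      hsub ⟨by
        rw [Metric.mem_ball, Real.dist_eq, abs_lt]
        constructor <;> linarith [hs.2.1, hs.2.2], hs.1⟩
    rw [← dist_eq_norm]
    have := dist_triangle_left (derivWithin (γ T) (m.piece i) s) d (derivWithin γ₀ (m.piece i) s)
    linarith
  have := Convex.norm_image_sub_le_of_norm_hasDerivWithin_le hder hbd
    ((convex_Icc _ _).inter (convex_Ioo _ _)) ht' ht
  rw [Real.norm_eq_abs] at this
  rwa [show γ T t - γ T t' - (t - t') * d = γ T t - t * d - (γ T t' - t' * d) by ring]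

end IsFamily

/-! ### Arcs away from the zeros -/

theorem norm_thermalLog_sub_le {a : ℝ} (ha : 1 ≤ a) {x y : ℂ} (hx : a ≤ x.re) (hy : a ≤ y.re) :
    ‖thermalLog x - thermalLog y‖ ≤ 2 * Real.exp (-a) * ‖x - y‖ := by
  rw [thermalLog_of_nonneg (by linarith : (0 : ℝ) ≤ x.re),
    thermalLog_of_nonneg (by linarith : (0 : ℝ) ≤ y.re)]
  have hconv : Convex ℝ {w : ℂ | a ≤ w.re} := convex_halfSpace_re_ge a
  refine Convex.norm_image_sub_le_of_norm_hasDerivWithin_le (𝕜 := ℂ)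
    (f := fun w => log (1 + exp (-w))) (f' := fun w => -exp (-w) / (1 + exp (-w)))
    (s := {w : ℂ | a ≤ w.re}) (fun w hw => ?_) (fun w hw => ?_) hconv hy hx
  · have hw0 : 0 < w.re := by have : a ≤ w.re := hw; linarith
    have := (((hasDerivAt_neg w).cexp).const_add 1).clog (one_add_exp_neg_mem_slitPlane hw0)
    simpa using this.hasDerivWithinAt
  · have hw' : a ≤ w.re := hw
    have hn : ‖exp (-w)‖ ≤ Real.exp (-a) := by
      rw [norm_exp, neg_re]
      exact Real.exp_le_exp.2 (by linarith)
    have hhalf : Real.exp (-a) ≤ 1 / 2 := by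
      rw [Real.exp_neg, one_div]
      exact inv_anti₀ two_pos (by linarith [Real.add_one_le_exp a])
    have h1 : 1 / 2 ≤ ‖1 + exp (-w)‖ := by
      have := norm_sub_norm_le (1 : ℂ) (-exp (-w))
      rw [norm_one, norm_neg, sub_neg_eq_add] at this
      linarith
    rw [norm_div, norm_neg, div_le_iff₀ (by linarith)]
    have := mul_le_mul_of_nonneg_left h1 (Real.exp_pos (-a)).le
    linarith

theorem exp_neg_le_inv {y : ℝ} (hy : 0 < y) : Real.exp (-y) ≤ 1 / y := by
  rw [Real.exp_neg, one_div]
  exact inv_anti₀ hy (by linarith [Real.add_one_le_exp y])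

theorem exp_neg_le_two_div_sq {y : ℝ} (hy : 0 < y) : Real.exp (-y) ≤ 2 / y ^ 2 := by
  rw [Real.exp_neg, show 2 / y ^ 2 = (y ^ 2 / 2)⁻¹ by field_simp]
  exact inv_anti₀ (by positivity) (by linarith [Real.quadratic_le_exp_of_nonneg hy.le])

/-- The low temperature logarithm along the path. -/
noncomputable def thermalPath (u : ℂ → ℂ) (γ : ℝ → ℂ) (p : ℤ) (T t : ℝ) : ℂ :=
  thermalLog (uBar u p T (γ t) / T)

/-- The deviation of the Cauchy type integral over a part of the path from its boundary terms. -/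
noncomputable def boundaryError (u : ℂ → ℂ) (γ : ℝ → ℂ) (p : ℤ) (T : ℝ) (z : ℂ) (a b : ℝ) : ℂ :=
  (∫ t in a..b, coth (γ t - z) * thermalPath u γ p T t * deriv γ t) -
    (thermalPath u γ p T b * logSinh (γ b - z) - thermalPath u γ p T a * logSinh (γ a - z))

theorem continuousOn_coth_sub {γ : ℝ → ℂ} {z : ℂ} {s : Set ℝ} (hγ : ContinuousOn γ s)
    (hz : ∀ t ∈ s, sinh (γ t - z) ≠ 0) : ContinuousOn (fun t => coth (γ t - z)) s :=
  (continuous_cosh.comp_continuousOn (hγ.sub continuousOn_const)).div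
    (continuous_sinh.comp_continuousOn (hγ.sub continuousOn_const)) hz

namespace IsFamily

variable {m : Mesh} {U : Set ℂ} {𝒯 : Set ℝ} {u : ℝ → ℂ → ℂ} {γ : ℝ → ℝ → ℂ} {p : ℝ → ℤ}
  {u₀ : ℂ → ℂ} {γ₀ : ℝ → ℂ}

theorem eventually_le_sign_mul_re (h : IsFamily m U 𝒯 u γ p u₀ γ₀) {a b τ : ℝ} (ha : m.first ≤ a)
    (hb : b ≤ m.last) (hτ : τ = 1 ∨ τ = -1)
    (hsign : ∀ t ∈ Icc a b, 0 < τ * (u₀ (γ₀ t)).re) :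
    ∃ κ > 0, ∀ᶠ T in 𝓝[𝒯] (0 : ℝ), ∀ t ∈ Icc a b, κ ≤ τ * (u T (γ T t)).re := by
  have hsub : Icc a b ⊆ m.domain := Icc_subset_Icc ha hb
  have hc : ContinuousOn (fun t => τ * (u₀ (γ₀ t)).re) (Icc a b) :=
    continuousOn_const.mul (continuous_re.comp_continuousOn
      ((h.adm₀.holomorphic.continuousOn.comp h.adm₀.continuousOn h.adm₀.mapsTo).mono hsub))
  obtain ⟨κ, hκ, hle⟩ := isCompact_Icc.exists_forall_le' hc hsign
  refine ⟨κ / 2, half_pos hκ, ?_⟩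
  filter_upwards [h.eventually_dist_fun_lt (half_pos hκ)] with T hT t ht
  have h1 := (abs_re_le_norm _).trans_lt (hT t (hsub ht))
  rw [sub_re, abs_lt] at h1
  have h2 := hle t ht
  rcases hτ with rfl | rfl <;> linarith [h1.1, h1.2]

/-- Where `|Re u| ≥ κ`, the thermal logarithm and its Lipschitz constant along the path are of order
`e^{-κ/T}` and `e^{-κ/T}/T`, both `O(T)`. This is the smallness required by the uniform Cauchy
estimate for short arcs. -/
theorem exists_short_arc (h : IsFamily m U 𝒯 u γ p u₀ γ₀) {a b τ κ : ℝ} (hτ : τ = 1 ∨ τ = -1) (hκ : 0 < κ)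
    (hκT : ∀ᶠ T in 𝓝[𝒯] (0 : ℝ), ∀ t ∈ Icc a b, κ ≤ τ * (u T (γ T t)).re) {i : ℕ} (hi : i < m.n)
    {x : ℝ} (hx : x ∈ m.piece i) :
    ∃ ε > 0, ∀ α β, α ≤ β → Icc α β ⊆ Icc a b ∩ (m.piece i ∩ Ioo (x - ε) (x + ε)) →
      ∃ C, ∀ᶠ T in 𝓝[𝒯] (0 : ℝ), ∀ z, (∀ t ∈ Icc a b, sinh (γ T t - z) ≠ 0) →
        ‖boundaryError (u T) (γ T) (p T) T z α β‖ ≤ C * T := by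
  obtain ⟨ε₁, hε₁, hlin⟩ := h.eventually_nearLinear hi hx (show (0 : ℝ) < 1 / 4 by norm_num)
  have hd := h.adm₀.deriv_ne_zero i hi x hx
  set d := derivWithin γ₀ (m.piece i) x
  have hdn := norm_pos_iff.2 hd
  have hxd := m.piece_subset hi hx
  obtain ⟨R, hR, hRU, hder⟩ := h.eventually_deriv_near (h.adm₀.mapsTo hxd) one_pos
  obtain ⟨ε₂, hε₂, hcont⟩ := Metric.mem_nhdsWithin_iff.1
    (h.adm₀.continuousOn x hxd (Metric.ball_mem_nhds _ (half_pos hR)))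
  set M := ‖deriv u₀ (γ₀ x)‖ + 1 with hM
  have hM0 : 0 < M := by positivity
  -- The last bound makes the arc short: `‖d‖ (β - α) ≤ 1/8`.
  set ε := min (min ε₁ ε₂) (1 / (16 * ‖d‖)) with hε
  have hε0 : 0 < ε := lt_min (lt_min hε₁ hε₂) (by positivity)
  refine ⟨ε, hε0, fun α β hαβ hsub => ?_⟩
  -- The first term comes from `e^{-y} ≤ 1/y` and bounds the size, the second from `e^{-y} ≤ 2/y²`
  -- and bounds the Lipschitz constant, with `y = κ/T`.
  set K := 2 / κ + 5 * M * ‖d‖ / κ ^ 2 with hK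
  refine ⟨(4 * (β - α) + 11 + 6 / ‖d‖ + 2 * |Real.log (1 / 8)|) * K, ?_⟩
  filter_upwards [hlin, hder, hκT, h.eventually_mem, h.eventually_pos, h.eventually_lt hκ,
    h.eventually_dist_path_lt (half_pos hR)] with T hlin hder hκT hT hT0 hTκ hpath z hz
  have hadm := h.adm T hT
  have hsubJ : Icc α β ⊆ m.piece i ∩ Ioo (x - ε₁) (x + ε₁) := by
    intro t ht
    have h1 := (hsub ht).2
    have h2 : ε ≤ ε₁ := (min_le_left _ _).trans (min_le_left _ _)
    exact ⟨h1.1, by linarith [h1.2.1], by linarith [h1.2.2]⟩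
  have hdom : ∀ t ∈ Icc α β, t ∈ m.domain := fun t ht => m.piece_subset hi (hsub ht).2.1
  have hball : ∀ t ∈ Icc α β, γ T t ∈ Metric.ball (γ₀ x) R := by
    intro t ht
    have h1 := (hsub ht).2
    have h2 : ε ≤ ε₂ := (min_le_left _ _).trans (min_le_right _ _)
    have h3 : dist (γ₀ t) (γ₀ x) < R / 2 := hcont ⟨by
      rw [Metric.mem_ball, Real.dist_eq, abs_lt]
      constructor <;> linarith [h1.2.1, h1.2.2], hdom t ht⟩
    have h4 := hpath t (hdom t ht)
    rw [← dist_eq_norm] at h4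
    rw [Metric.mem_ball]
    linarith [dist_triangle (γ T t) (γ₀ t) (γ₀ x)]
  have hlin' : NearLinear (γ T) d (1 / 4) (Icc α β) := fun t ht t' ht' =>
    hlin t (hsubJ ht) t' (hsubJ ht')
  have huT : ∀ t ∈ Icc α β, ∀ t' ∈ Icc α β,
      ‖u T (γ T t) - u T (γ T t')‖ ≤ M * (5 / 4 * ‖d‖ * |t - t'|) := by
    intro t ht t' ht'
    refine ((convex_ball (γ₀ x) R).norm_image_sub_le_of_norm_deriv_le (𝕜 := ℂ)
      (fun w hw => hadm.holomorphic.differentiableAt (hadm.isOpen.mem_nhds (hRU hw)))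
      (fun w hw => ?_) (hball t' ht') (hball t ht)).trans
      (mul_le_mul_of_nonneg_left (hlin'.norm_sub_le ht ht') hM0.le)
    have := norm_sub_norm_le (deriv (u T) w) (deriv u₀ (γ₀ x))
    linarith [hder w hw]
  have hy : 1 ≤ κ / T := by rw [le_div_iff₀ hT0]; linarith
  have hτc : (τ : ℂ) * τ = 1 := by rcases hτ with rfl | rfl <;> simp
  have hre : ∀ t ∈ Icc α β, κ / T ≤ (τ * (uBar (u T) (p T) T (γ T t) / T)).re := by
    intro t ht
    rw [re_ofReal_mul, div_ofReal_re, uBar_re, mul_div_assoc']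
    exact div_le_div_of_nonneg_right (hκT t (hsub ht).1) hT0.le
  have hpath_eq : ∀ t ∈ Icc α β, thermalPath (u T) (γ T) (p T) T t =
      thermalLog (τ * (uBar (u T) (p T) T (γ T t) / T)) := by
    intro t ht
    rw [thermalPath]
    rcases hτ with rfl | rfl
    · simp
    · have h1 := hre t ht
      have h2 : (uBar (u T) (p T) T (γ T t) / T).re ≠ 0 := by
        rw [re_ofReal_mul] at h1
        intro h0
        rw [h0] at h1
        linarith
      rw [show ((-1 : ℝ) : ℂ) * (uBar (u T) (p T) T (γ T t) / T) =
        -(uBar (u T) (p T) T (γ T t) / T) by push_cast; ring, thermalLog_neg (Or.inl h2)]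
  have hG : ∀ t ∈ Icc α β, ‖thermalPath (u T) (γ T) (p T) T t‖ ≤ K * T := by
    intro t ht
    rw [hpath_eq t ht]
    have h1 := hre t ht
    have h2 := norm_thermalLog_le (x := τ * (uBar (u T) (p T) T (γ T t) / T))
      (by rw [abs_of_nonneg (by linarith)]; linarith)
    rw [abs_of_nonneg (by linarith)] at h2
    have h3 : Real.exp (-(τ * (uBar (u T) (p T) T (γ T t) / T)).re) ≤ Real.exp (-(κ / T)) :=
      Real.exp_le_exp.2 (by linarith)
    have h4 := exp_neg_le_inv (show 0 < κ / T by linarith)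
    rw [one_div_div] at h4
    have h5 : 0 ≤ 5 * M * ‖d‖ / κ ^ 2 * T := by positivity
    calc _ ≤ 2 * (T / κ) := by linarith
      _ = 2 / κ * T := by ring
      _ ≤ K * T := by rw [hK]; linarith
  have hGl : ∀ t ∈ Icc α β, ∀ t' ∈ Icc α β,
      ‖thermalPath (u T) (γ T) (p T) T t - thermalPath (u T) (γ T) (p T) T t'‖ ≤
        K * T * |t - t'| := by
    intro t ht t' ht'
    rw [hpath_eq t ht, hpath_eq t' ht']
    refine (norm_thermalLog_sub_le hy (hre t ht) (hre t' ht')).trans ?_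
    rw [← mul_sub, ← sub_div, uBar_sub_uBar, norm_mul, norm_div, norm_real, norm_real,
      Real.norm_eq_abs, Real.norm_eq_abs, abs_of_pos hT0,
      show |τ| = 1 by rcases hτ with rfl | rfl <;> simp, one_mul]
    have h4 := exp_neg_le_two_div_sq (show 0 < κ / T by linarith)
    have h5 : 0 ≤ 2 / κ * T * |t - t'| := by positivity
    calc _ ≤ 2 * (2 / (κ / T) ^ 2) * (M * (5 / 4 * ‖d‖ * |t - t'|) / T) := by
          refine mul_le_mul (by linarith) (div_le_div_of_nonneg_right (huT t ht t' ht') hT0.le)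
            (by positivity) (by positivity)
      _ = 5 * M * ‖d‖ / κ ^ 2 * T * |t - t'| := by field_simp; ring
      _ ≤ K * T * |t - t'| := by rw [hK]; linarith
  have hGc : ContinuousOn (thermalPath (u T) (γ T) (p T) T) (Icc α β) := by
    have hK0 : 0 ≤ K * T := by positivity
    refine LipschitzOnWith.continuousOn (K := ⟨K * T, hK0⟩)
      (LipschitzOnWith.of_dist_le_mul fun t ht t' ht' => ?_)
    rw [dist_eq_norm, Real.dist_eq]
    exact hGl t ht t' ht'
  have hshort : ‖d‖ * (β - α) ≤ 1 / 8 := by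
    have h1 := (hsub ⟨le_rfl, hαβ⟩).2.2.1
    have h2 := (hsub ⟨hαβ, le_rfl⟩).2.2.2
    have h3 : ε ≤ 1 / (16 * ‖d‖) := min_le_right _ _
    rw [le_div_iff₀ (by positivity)] at h3
    nlinarith
  have hα := hdom α ⟨le_rfl, hαβ⟩
  have hβ := hdom β ⟨hαβ, le_rfl⟩
  have := norm_integral_coth_mul_sub_le hαβ hd hlin' (fun t ht => hadm.differentiableAt hi
    ⟨(hsub ⟨le_rfl, hαβ⟩).2.1.1.trans_lt ht.1, ht.2.trans_le (hsub ⟨hαβ, le_rfl⟩).2.1.2⟩)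
    (hadm.intervalIntegrable_deriv_of_le hα.1 hαβ hβ.2) hshort hG hGl hGc
    (fun t ht => hz t (hsub ht).1)
  rw [boundaryError]
  linarith

end IsFamily

theorem continuousOn_thermalPath {U : Set ℂ} {u : ℂ → ℂ} {γ : ℝ → ℂ} {p : ℤ} {T : ℝ} (hT : 0 < T)
    {s : Set ℝ} (hu : ContinuousOn u U) (hγ : ContinuousOn γ s) (hU : MapsTo γ s U)
    (hs : ∀ t ∈ s, (u (γ t)).re ≠ 0 ∨ uBar u p T (γ t) = 0) :
    ContinuousOn (thermalPath u γ p T) s := by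
  refine continuousOn_thermalLog.comp (ContinuousOn.div_const ?_ _) fun t ht => ?_
  · exact (hu.comp hγ hU).sub continuousOn_const
  · rcases hs t ht with h1 | h1
    · left
      rw [div_ofReal_re, uBar_re]
      exact div_ne_zero h1 hT.ne'
    · right
      rw [h1, zero_div]

/-- On the circle of radius `ρ` the chart gives `|ū| ≥ 31/32 ‖A‖ ρ ≥ δ/2`, so a connected part of
`{|ū| < δ/2}` containing `Q` cannot leave the disc. If `Q` itself is not in that set, the component
is empty by convention. -/
theorem nbhd_subset_ball {f ubar : ℂ → ℂ} {Q A : ℂ} {r : ℝ} (h : IsChart f Q A r) {U : Set ℂ}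
    (hf : ∀ z, ‖ubar z‖ = ‖f z‖) {δ ρ : ℝ} (hρ : 0 < ρ) (hρr : ρ ≤ r)
    (hδ : δ / 2 ≤ 31 / 32 * ‖A‖ * ρ) : nbhd U ubar δ Q ⊆ Metric.ball Q ρ := by
  by_cases hQ : Q ∈ {z ∈ U | ‖ubar z‖ < δ / 2}
  · refine isPreconnected_connectedComponentIn.subset_left_of_subset_union Metric.isOpen_ball
      (v := (Metric.closedBall Q ρ)ᶜ) Metric.isClosed_closedBall.isOpen_compl
      (disjoint_compl_right.mono_left Metric.ball_subset_closedBall) (fun z hz => ?_)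
      ⟨Q, mem_connectedComponentIn hQ, Metric.mem_ball_self hρ⟩
    by_contra hn
    rw [mem_union, not_or, notMem_compl_iff, Metric.mem_ball, Metric.mem_closedBall, not_lt] at hn
    have hzd : ‖z - Q‖ = ρ := by rw [← dist_eq_norm]; exact le_antisymm hn.2 hn.1
    have h0 := h.radius_pos
    have h1 := h.le_norm_sub (x := z) (y := Q) (by rw [Metric.mem_ball, dist_eq_norm]; linarith)
      (Metric.mem_ball_self (by linarith))
    rw [h.zero, sub_zero, hzd, ← hf] at h1
    have h2 := (connectedComponentIn_subset _ _ hz).2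
    linarith
  · rw [nbhd, connectedComponentIn_eq_empty hQ]
    exact empty_subset _

theorem nbhd_subset {ubar : ℂ → ℂ} {Q : ℂ} {U : Set ℂ} {δ : ℝ} :
    nbhd U ubar δ Q ⊆ {z | ‖ubar z‖ < δ / 2} := fun _ hz => (connectedComponentIn_subset _ _ hz).2

namespace IsFamily

variable {m : Mesh} {U : Set ℂ} {𝒯 : Set ℝ} {u : ℝ → ℂ → ℂ} {γ : ℝ → ℝ → ℂ} {p : ℝ → ℤ}
  {u₀ : ℂ → ℂ} {γ₀ : ℝ → ℂ}

/-- The contribution of a part of the contour on which the real part of `u` does not vanish. -/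
theorem exists_norm_boundaryError_le (h : IsFamily m U 𝒯 u γ p u₀ γ₀) {a b τ : ℝ}
    (ha : m.first ≤ a) (hab : a ≤ b) (hb : b ≤ m.last) (hτ : τ = 1 ∨ τ = -1)
    (hsign : ∀ t ∈ Icc a b, 0 < τ * (u₀ (γ₀ t)).re) :
    ∃ C, ∀ᶠ T in 𝓝[𝒯] (0 : ℝ), (∀ t ∈ Icc a b, ‖thermalPath (u T) (γ T) (p T) T t‖ ≤ C * T) ∧
      ∀ z, (∀ t ∈ Icc a b, sinh (γ T t - z) ≠ 0) →
        ‖boundaryError (u T) (γ T) (p T) T z a b‖ ≤ C * T := by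
  have hdom : Icc a b ⊆ m.domain := Icc_subset_Icc ha hb
  obtain ⟨κ, hκ, hκT⟩ := h.eventually_le_sign_mul_re ha hb hτ hsign
  have hne : ∀ᶠ T in 𝓝[𝒯] (0 : ℝ), ∀ t ∈ Icc a b, (u T (γ T t)).re ≠ 0 := by
    filter_upwards [hκT] with T hT t ht h0
    have := hT t ht
    rw [h0, mul_zero] at this
    linarith
  -- Boundary terms at an intermediate point cancel, so the error is additive and short arcs
  -- suffice. If `x` is a knot, the arcs on its two sides belong to different pieces.
  have hP := interval_additive_induction (P := fun α β => ∃ C, ∀ᶠ T in 𝓝[𝒯] (0 : ℝ), ∀ z,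
      (∀ t ∈ Icc a b, sinh (γ T t - z) ≠ 0) →
        ‖boundaryError (u T) (γ T) (p T) T z α β‖ ≤ C * T) hab ?_ ?_
  · obtain ⟨C, hC⟩ := hP
    refine ⟨max C (2 / κ), ?_⟩
    filter_upwards [hC, hκT, h.eventually_pos, h.eventually_lt hκ] with T hC hκT hT0 hTκ
    refine ⟨fun t ht => ?_, fun z hz => (hC z hz).trans
      (mul_le_mul_of_nonneg_right (le_max_left _ _) hT0.le)⟩
    have hy : 1 ≤ κ / T := by rw [le_div_iff₀ hT0]; linarith
    have h1 : κ / T ≤ |(uBar (u T) (p T) T (γ T t) / T).re| := by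
      rw [div_ofReal_re, uBar_re, abs_div, abs_of_pos hT0]
      refine div_le_div_of_nonneg_right ((hκT t ht).trans ?_) hT0.le
      rcases hτ with rfl | rfl
      · rw [one_mul]; exact le_abs_self _
      · rw [neg_one_mul]; exact neg_le_abs _
    refine (norm_thermalLog_le (hy.trans h1)).trans ?_
    have h3 := Real.exp_le_exp.2 (neg_le_neg h1)
    have h4 := exp_neg_le_inv (show 0 < κ / T by linarith)
    rw [one_div_div] at h4
    calc _ ≤ 2 * (T / κ) := by linarith
      _ = 2 / κ * T := by ring
      _ ≤ _ := mul_le_mul_of_nonneg_right (le_max_right _ _) hT0.le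
  · rintro α β δ h1 h2 h3 h4 ⟨C, hC⟩ ⟨C', hC'⟩
    refine ⟨C + C', ?_⟩
    filter_upwards [hC, hC', hne, h.eventually_mem, h.eventually_pos]
      with T hC hC' hne hT hT0 z hz
    have hadm := h.adm T hT
    have hc : ContinuousOn (fun t => coth (γ T t - z) * thermalPath (u T) (γ T) (p T) T t)
        (Icc a b) := (continuousOn_coth_sub (hadm.continuousOn.mono hdom) hz).mul
      (continuousOn_thermalPath hT0 hadm.holomorphic.continuousOn (hadm.continuousOn.mono hdom)
        (hadm.mapsTo.mono_left hdom) fun t ht => Or.inl (hne t ht))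
    have e : boundaryError (u T) (γ T) (p T) T z α δ =
        boundaryError (u T) (γ T) (p T) T z α β + boundaryError (u T) (γ T) (p T) T z β δ := by
      rw [boundaryError, boundaryError, boundaryError,
        ← intervalIntegral.integral_add_adjacent_intervals
          (hadm.intervalIntegrable_mul (ha.trans h1) h2 (h3.trans (h4.trans hb))
            (hc.mono (Icc_subset_Icc h1 (h3.trans h4))))
          (hadm.intervalIntegrable_mul (ha.trans (h1.trans h2)) h3 (h4.trans hb)
            (hc.mono (Icc_subset_Icc (h1.trans h2) h4)))]
      ring
    rw [e, add_mul]
    exact (norm_add_le _ _).trans (add_le_add (hC z hz) (hC' z hz))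
  · intro x hx
    have hleft : ∃ ε > 0, ∀ α β, a ≤ α → x - ε < α → α ≤ β → β ≤ x →
        ∃ C, ∀ᶠ T in 𝓝[𝒯] (0 : ℝ), ∀ z, (∀ t ∈ Icc a b, sinh (γ T t - z) ≠ 0) →
          ‖boundaryError (u T) (γ T) (p T) T z α β‖ ≤ C * T := by
      rcases hx.1.eq_or_lt with rfl | hax
      · refine ⟨1, one_pos, fun α β h1 _ h2 h3 => ⟨0, Eventually.of_forall fun T z _ => ?_⟩⟩
        obtain rfl : α = β := by linarith
        simp [boundaryError]
      · obtain ⟨i, hi, hki, hik⟩ := m.exists_left_piece ⟨ha.trans_lt hax, hx.2.trans hb⟩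
        obtain ⟨ε, hε, H⟩ := h.exists_short_arc hτ hκ hκT hi (x := x) ⟨hki.le, hik⟩
        refine ⟨min ε (x - m.knot i), lt_min hε (by linarith), fun α β h1 h2 h3 h4 => ?_⟩
        have e1 := min_le_left ε (x - m.knot i)
        have e2 := min_le_right ε (x - m.knot i)
        exact H α β h3 fun t ht => ⟨⟨h1.trans ht.1, ht.2.trans (h4.trans hx.2)⟩,
          ⟨by linarith [ht.1], by linarith [ht.2]⟩, by linarith [ht.1], by linarith [ht.2]⟩
    have hright : ∃ ε > 0, ∀ α β, x ≤ α → α ≤ β → β < x + ε → β ≤ b →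
        ∃ C, ∀ᶠ T in 𝓝[𝒯] (0 : ℝ), ∀ z, (∀ t ∈ Icc a b, sinh (γ T t - z) ≠ 0) →
          ‖boundaryError (u T) (γ T) (p T) T z α β‖ ≤ C * T := by
      rcases hx.2.eq_or_lt with rfl | hxb
      · refine ⟨1, one_pos, fun α β h1 h2 _ h3 => ⟨0, Eventually.of_forall fun T z _ => ?_⟩⟩
        obtain rfl : α = β := by linarith
        simp [boundaryError]
      · obtain ⟨i, hi, hki, hik⟩ := m.exists_right_piece ⟨ha.trans hx.1, hxb.trans_le hb⟩
        obtain ⟨ε, hε, H⟩ := h.exists_short_arc hτ hκ hκT hi (x := x) ⟨hki, hik.le⟩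
        refine ⟨min ε (m.knot (i + 1) - x), lt_min hε (by linarith), fun α β h1 h2 h3 h4 => ?_⟩
        have e1 := min_le_left ε (m.knot (i + 1) - x)
        have e2 := min_le_right ε (m.knot (i + 1) - x)
        exact H α β h2 fun t ht => ⟨⟨hx.1.trans (h1.trans ht.1), ht.2.trans h4⟩,
          ⟨by linarith [ht.1], by linarith [ht.2]⟩, by linarith [ht.1], by linarith [ht.2]⟩
    obtain ⟨ε, hε, hl⟩ := hleft
    obtain ⟨ε', hε', hr⟩ := hright
    exact ⟨min ε ε', lt_min hε hε', fun α β h1 h2 => hl α β h1 (by linarith [min_le_left ε ε']),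
      fun α β h1 h2 h3 => hr α β h1 h2 (by linarith [min_le_right ε ε'])⟩

/-- Compactness and uniform continuity of `sinh` turn incongruence modulo `πi` on the limiting
contour into a bound that is stable under small changes of both points and of `T`. -/
theorem exists_le_norm_sinh (h : IsFamily m U 𝒯 u γ p u₀ γ₀) {s : ℝ} (hs : s ∈ m.domain) {K : Set ℝ}
    (hK : IsCompact K) (hKm : K ⊆ m.domain) (hinc : ∀ t ∈ K, sinh (γ₀ t - γ₀ s) ≠ 0) :
    ∃ c > 0, ∃ ρ > 0, ∀ᶠ T in 𝓝[𝒯] (0 : ℝ), ∀ z, ‖z - γ T s‖ ≤ ρ → ∀ t ∈ K, ∀ w,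
      ‖w - γ T t‖ ≤ ρ → c ≤ ‖sinh (w - z)‖ := by
  have hc : ContinuousOn (fun t => γ₀ t - γ₀ s) K :=
    (h.adm₀.continuousOn.mono hKm).sub continuousOn_const
  obtain ⟨c, hc0, hle⟩ := hK.exists_forall_le' (continuous_sinh.comp_continuousOn hc).norm
    fun t ht => norm_pos_iff.2 (hinc t ht)
  have hu := (hK.image_of_continuousOn hc).uniformContinuousAt_of_continuousAt sinh
    (fun z _ => continuous_sinh.continuousAt) (Metric.dist_mem_uniformity (half_pos hc0))
  obtain ⟨ε, hε, hsub⟩ := Metric.mem_uniformity_dist.1 hu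
  refine ⟨c / 2, half_pos hc0, ε / 4, by linarith, ?_⟩
  filter_upwards [h.eventually_dist_path_lt (show 0 < ε / 4 by linarith)] with T hT z hz t ht w hw
  have h1 := hT t (hKm ht)
  have h2 := hT s hs
  have h3 : dist (γ₀ t - γ₀ s) (w - z) < ε := by
    rw [dist_comm, dist_eq_norm, show w - z - (γ₀ t - γ₀ s) =
      ((γ T t - γ₀ t) - (γ T s - γ₀ s)) + ((w - γ T t) - (z - γ T s)) by ring]
    refine (norm_add_le _ _).trans_lt ?_
    linarith [norm_sub_le (γ T t - γ₀ t) (γ T s - γ₀ s), norm_sub_le (w - γ T t) (z - γ T s)]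
  have h4 : dist (sinh (γ₀ t - γ₀ s)) (sinh (w - z)) < c / 2 := hsub h3 ⟨t, ht, rfl⟩
  rw [dist_eq_norm] at h4
  have h5 := norm_sub_norm_le (sinh (γ₀ t - γ₀ s)) (sinh (w - z))
  have h6 := hle t ht
  simp only [Function.comp] at h6
  linarith

/-- The sign `τ` makes `Re (τu)` pass from minus to plus: `-1` at the first zero, `+1` at the
second. All data of the arc except its centre are read off from the limiting pair, and the strict
inequalities persist for small `T`. -/
theorem exists_isNearArc (h : IsFamily m U 𝒯 u γ p u₀ γ₀) {τ t₀ a b : ℝ} (hτ : τ = 1 ∨ τ = -1)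
    (ha : m.first ≤ a) (hat : a < t₀) (htb : t₀ < b) (hb : b ≤ m.last)
    (hneg : ∀ T ∈ 𝒯, ∀ t ∈ Ico a t₀, τ * (u T (γ T t)).re < 0)
    (hpos : ∀ T ∈ 𝒯, ∀ t ∈ Ioc t₀ b, 0 < τ * (u T (γ T t)).re)
    (hneg₀ : ∀ t ∈ Ico a t₀, τ * (u₀ (γ₀ t)).re < 0)
    (hpos₀ : ∀ t ∈ Ioc t₀ b, 0 < τ * (u₀ (γ₀ t)).re)
    (hz : ∀ T ∈ 𝒯, uBar (u T) (p T) T (γ T t₀) = 0) (hd : deriv u₀ (γ₀ t₀) ≠ 0) {R : ℝ}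
    (hR : 0 < R) :
    ∃ r > 0, r ≤ R ∧ ∃ t₁ t₂ κ : ℝ, ∃ A e₁ e₂ : ℂ, a < t₁ ∧ t₁ < t₀ ∧ t₀ < t₂ ∧ t₂ < b ∧ 0 < κ ∧
      A ≠ 0 ∧ ∀ᶠ T in 𝓝[𝒯] (0 : ℝ), IsNearArc (fun z => τ * uBar (u T) (p T) T z) (γ T) t₁ t₀ t₂
        (γ T t₀) A r κ e₁ e₂ := by
  have ht₀ : t₀ ∈ m.domain := ⟨ha.trans hat.le, htb.le.trans hb⟩
  set Q₀ := γ₀ t₀ with hQ₀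
  set A : ℂ := τ * deriv u₀ Q₀ with hA
  have hτ1 : ‖(τ : ℂ)‖ = 1 := by rcases hτ with rfl | rfl <;> simp
  have hτ0 : (τ : ℂ) ≠ 0 := norm_pos_iff.1 (by rw [hτ1]; exact one_pos)
  have hA0 : A ≠ 0 := mul_ne_zero hτ0 hd
  have hAn := norm_pos_iff.2 hA0
  have hAeq : ‖A‖ = ‖deriv u₀ Q₀‖ := by rw [hA, norm_mul, hτ1, one_mul]
  obtain ⟨R₁, hR₁, hRU, hder⟩ := h.eventually_deriv_near (h.adm₀.mapsTo ht₀)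
    (show 0 < ‖A‖ / 32 by positivity)
  -- With `r ≤ R₁/4` the disc of radius `2r` about the moving zero stays inside the disc of radius
  -- `R₁` about the limiting zero.
  set r := min (min R (1 / 4)) (R₁ / 4) with hr
  have hr0 : 0 < r := lt_min (lt_min hR (by norm_num)) (by linarith)
  have hrR : r ≤ R := (min_le_left _ _).trans (min_le_left _ _)
  have hr4 : r ≤ 1 / 4 := (min_le_left _ _).trans (min_le_right _ _)
  have hrR₁ : r ≤ R₁ / 4 := min_le_right _ _
  obtain ⟨i, hi, hki, hik⟩ := m.exists_left_piece ⟨ha.trans_lt hat, htb.le.trans hb⟩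
  obtain ⟨j, hj, hkj, hjk⟩ := m.exists_right_piece ⟨ha.trans hat.le, htb.trans_le hb⟩
  obtain ⟨ε₁, hε₁, hlin₁⟩ := h.eventually_nearLinear hi (x := t₀) ⟨hki.le, hik⟩
    (show (0 : ℝ) < 1 / 16 by norm_num)
  obtain ⟨ε₂, hε₂, hlin₂⟩ := h.eventually_nearLinear hj (x := t₀) ⟨hkj, hjk.le⟩
    (show (0 : ℝ) < 1 / 16 by norm_num)
  -- Three errors of size `r/60` (the limiting path and two perturbations) make up the required
  -- `r/20`.
  obtain ⟨ε₃, hε₃, hcont⟩ := Metric.mem_nhdsWithin_iff.1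
    (h.adm₀.continuousOn t₀ ht₀ (Metric.ball_mem_nhds _ (show 0 < r / 60 by linarith)))
  obtain ⟨t₁, ht₁, ht₁'⟩ := exists_between (show max (max (t₀ - ε₁) (t₀ - ε₃)) (max a (m.knot i)) < t₀
    from max_lt (max_lt (by linarith) (by linarith)) (max_lt hat hki))
  obtain ⟨t₂, ht₂', ht₂⟩ := exists_between (show t₀ <
    min (min (t₀ + ε₂) (t₀ + ε₃)) (min b (m.knot (j + 1)))
    from lt_min (lt_min (by linarith) (by linarith)) (lt_min htb hjk))
  simp only [max_lt_iff] at ht₁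
  simp only [lt_min_iff] at ht₂
  obtain ⟨⟨l1, l2⟩, l3, l4⟩ := ht₁
  obtain ⟨⟨r1, r2⟩, r3, r4⟩ := ht₂
  have hdom : Icc t₁ t₂ ⊆ m.domain := Icc_subset_Icc (ha.trans l3.le) (r3.le.trans hb)
  have hv₁ : 0 < -(τ * (u₀ (γ₀ t₁)).re) := by linarith [hneg₀ t₁ ⟨l3.le, ht₁'⟩]
  have hv₂ := hpos₀ t₂ ⟨ht₂', r3.le⟩
  -- Half of the limiting values of `|Re u|` at the ends of the arc, so that a perturbation of size
  -- `κ` still leaves `κ`.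
  set κ := min (min (-(τ * (u₀ (γ₀ t₁)).re)) (τ * (u₀ (γ₀ t₂)).re)) (‖A‖ * r / 32) / 2 with hκ
  have hκ0 : 0 < κ := half_pos (lt_min (lt_min hv₁ hv₂) (by positivity))
  have hκ1 : 2 * κ ≤ -(τ * (u₀ (γ₀ t₁)).re) := by
    rw [hκ]; linarith [(min_le_left (min (-(τ * (u₀ (γ₀ t₁)).re)) (τ * (u₀ (γ₀ t₂)).re))
      (‖A‖ * r / 32)).trans (min_le_left _ _)]
  have hκ2 : 2 * κ ≤ τ * (u₀ (γ₀ t₂)).re := by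
    rw [hκ]; linarith [(min_le_left (min (-(τ * (u₀ (γ₀ t₁)).re)) (τ * (u₀ (γ₀ t₂)).re))
      (‖A‖ * r / 32)).trans (min_le_right _ _)]
  have hκ3 : 2 * κ ≤ ‖A‖ * r / 32 := by
    rw [hκ]; linarith [min_le_right (min (-(τ * (u₀ (γ₀ t₁)).re)) (τ * (u₀ (γ₀ t₂)).re))
      (‖A‖ * r / 32)]
  refine ⟨r, hr0, hrR, t₁, t₂, κ, A, derivWithin γ₀ (m.piece i) t₀, derivWithin γ₀ (m.piece j) t₀,
    l3, ht₁', ht₂', r3, hκ0, hA0, ?_⟩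
  filter_upwards [h.eventually_mem, hder, hlin₁, hlin₂,
    h.eventually_dist_path_lt (show 0 < r / 60 by linarith), h.eventually_dist_fun_lt hκ0]
    with T hT hder hlin₁ hlin₂ hpath hfun
  have hadm := h.adm T hT
  have hre : ∀ z, (τ * uBar (u T) (p T) T z).re = τ * (u T z).re := fun z => by
    rw [re_ofReal_mul, uBar_re]
  have hball : Metric.ball (γ T t₀) (2 * r) ⊆ Metric.ball Q₀ R₁ := by
    refine Metric.ball_subset_ball' ?_
    have := hpath t₀ ht₀
    rw [dist_eq_norm]
    linarith
  have hval : ∀ t ∈ m.domain, |τ * (u T (γ T t)).re - τ * (u₀ (γ₀ t)).re| ≤ κ := by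
    intro t ht
    rw [← mul_sub, abs_mul, show |τ| = 1 by rcases hτ with rfl | rfl <;> simp, one_mul, ← sub_re]
    exact (abs_re_le_norm _).trans (hfun t ht).le
  refine ⟨⟨?_, ?_, hA0, hr0, hr4, ?_⟩, ht₁', ht₂', hadm.continuousOn.mono hdom, ?_,
    hadm.intervalIntegrable_deriv_of_le (ha.trans l3.le) (ht₁'.trans ht₂').le (r3.le.trans hb), ?_,
    rfl, ?_, ?_, ?_, ?_, hκ0, ?_, ?_, ?_⟩
  · refine DifferentiableOn.const_mul ?_ _
    exact (hadm.holomorphic.mono (hball.trans hRU)).sub_const _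
  · intro x hx y hy
    have hdiff : ∀ w ∈ Metric.ball Q₀ R₁, HasDerivWithinAt (fun w => u T w - deriv u₀ Q₀ * w)
        (deriv (u T) w - deriv u₀ Q₀) (Metric.ball Q₀ R₁) w := by
      intro w hw
      have := ((hadm.holomorphic.differentiableAt
        (hadm.isOpen.mem_nhds (hRU hw))).hasDerivAt.sub
          ((hasDerivAt_id w).const_mul (deriv u₀ Q₀))).hasDerivWithinAt (s := Metric.ball Q₀ R₁)
      rw [mul_one] at this
      exact this
    have := Convex.norm_image_sub_le_of_norm_hasDerivWithin_le hdiff hder (convex_ball _ _)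
      (hball hy) (hball hx)
    rw [show τ * uBar (u T) (p T) T x - τ * uBar (u T) (p T) T y - A * (x - y) =
      τ * (u T x - deriv u₀ Q₀ * x - (u T y - deriv u₀ Q₀ * y)) by
        rw [← mul_sub, uBar_sub_uBar, hA]; ring, norm_mul, hτ1, one_mul]
    exact this
  · rw [hz T hT, mul_zero]
  · intro t ht hne
    rcases lt_or_gt_of_ne hne with hlt | hlt
    · exact hadm.differentiableAt hi ⟨by linarith [ht.1], by linarith⟩
    · exact hadm.differentiableAt hj ⟨by linarith, by linarith [ht.2]⟩
  · intro t ht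
    have h1 := hpath t (hdom ht)
    have h2 := hpath t₀ ht₀
    have h3 : dist (γ₀ t) (γ₀ t₀) < r / 60 := hcont ⟨by
      rw [Metric.mem_ball, Real.dist_eq, abs_lt]
      constructor <;> linarith [ht.1, ht.2], hdom ht⟩
    rw [dist_eq_norm] at h3
    rw [show γ T t - γ T t₀ = (γ T t - γ₀ t) + (γ₀ t - γ₀ t₀) - (γ T t₀ - γ₀ t₀) by ring]
    have h4 := norm_sub_le ((γ T t - γ₀ t) + (γ₀ t - γ₀ t₀)) (γ T t₀ - γ₀ t₀)
    have h5 := norm_add_le (γ T t - γ₀ t) (γ₀ t - γ₀ t₀)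
    linarith
  · intro t ht
    rw [hre]
    exact hneg T hT t ⟨l3.le.trans ht.1, ht.2⟩
  · intro t ht
    rw [hre]
    exact hpos T hT t ⟨ht.1, ht.2.trans r3.le⟩
  · rw [hre]
    linarith [(abs_le.1 (hval t₁ (hdom ⟨le_rfl, (ht₁'.trans ht₂').le⟩))).2]
  · rw [hre]
    linarith [(abs_le.1 (hval t₂ (hdom ⟨(ht₁'.trans ht₂').le, le_rfl⟩))).1]
  · have := mul_pos hAn hr0
    linarith
  · exact fun t ht t' ht' => hlin₁ t ⟨⟨by linarith [ht.1], by linarith [ht.2]⟩, by linarith [ht.1],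
      by linarith [ht.2]⟩ t' ⟨⟨by linarith [ht'.1], by linarith [ht'.2]⟩, by linarith [ht'.1],
      by linarith [ht'.2]⟩
  · exact fun t ht t' ht' => hlin₂ t ⟨⟨by linarith [ht.1], by linarith [ht.2]⟩, by linarith [ht.1],
      by linarith [ht.2]⟩ t' ⟨⟨by linarith [ht'.1], by linarith [ht'.2]⟩, by linarith [ht'.1],
      by linarith [ht'.2]⟩

end IsFamily

/-! ### The branch of the logarithm and the reduction to the thermal integral -/

/-- The point of `[t₋, t₊]` closest to `t`. -/
def Mesh.clamp (m : Mesh) (t : ℝ) : ℝ := max m.tMinus (min m.tPlus t)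

/-- The branch of `ln(1 + exp(-u / T))` along the contour. -/
noncomputable def branch (m : Mesh) (u : ℂ → ℂ) (γ : ℝ → ℂ) (p : ℤ) (T t : ℝ) : ℂ :=
  thermalPath u γ p T t - uBar u p T (γ (m.clamp t)) / T

/-- The integral of the low temperature logarithm over a part of the path. -/
noncomputable def thermalIntegral (u : ℂ → ℂ) (γ : ℝ → ℂ) (p : ℤ) (T : ℝ) (z : ℂ) (a b : ℝ) : ℂ :=
  ∫ t in a..b, coth (γ t - z) * thermalPath u γ p T t * deriv γ t

namespace Mesh

variable (m : Mesh)

theorem continuous_clamp : Continuous m.clamp :=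
  continuous_const.max (continuous_const.min continuous_id)

theorem clamp_mem (t : ℝ) : m.clamp t ∈ m.domain :=
  ⟨m.first_lt.le.trans (le_max_left _ _),
    max_le (m.minus_lt_plus.trans m.lt_last).le ((min_le_left _ _).trans m.lt_last.le)⟩

theorem clamp_of_le {t : ℝ} (ht : t ≤ m.tMinus) : m.clamp t = m.tMinus := by
  rw [clamp, min_eq_right (ht.trans m.minus_lt_plus.le), max_eq_left ht]

theorem clamp_of_ge {t : ℝ} (ht : m.tPlus ≤ t) : m.clamp t = m.tPlus := by
  rw [clamp, min_eq_left ht, max_eq_right m.minus_lt_plus.le]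

theorem clamp_of_mem {t : ℝ} (ht : t ∈ Icc m.tMinus m.tPlus) : m.clamp t = t := by
  rw [clamp, min_eq_right ht.2, max_eq_right ht.1]

end Mesh

/-- An admissible pair whose function takes the same imaginary part `2 π p T` at both zeros of its
real part. -/
structure IsPinned (m : Mesh) (U : Set ℂ) (u : ℂ → ℂ) (γ : ℝ → ℂ) (p : ℤ) (T : ℝ) : Prop where
  adm : IsAdmissible m U u γ
  pos : 0 < T
  im_minus : (u (γ m.tMinus)).im = 2 * Real.pi * p * T
  im_plus : (u (γ m.tPlus)).im = 2 * Real.pi * p * T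

namespace IsPinned

variable {m : Mesh} {U : Set ℂ} {u : ℂ → ℂ} {γ : ℝ → ℂ} {p : ℤ} {T : ℝ}

theorem uBar_minus (h : IsPinned m U u γ p T) : uBar u p T (γ m.tMinus) = 0 := by
  apply Complex.ext
  · rw [uBar_re, h.adm.re_minus, zero_re]
  · rw [uBar_im, h.im_minus, sub_self, zero_im]

theorem uBar_plus (h : IsPinned m U u γ p T) : uBar u p T (γ m.tPlus) = 0 := by
  apply Complex.ext
  · rw [uBar_re, h.adm.re_plus, zero_re]
  · rw [uBar_im, h.im_plus, sub_self, zero_im]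

theorem re_ne_zero_or (h : IsPinned m U u γ p T) {t : ℝ} (ht : t ∈ m.domain) :
    (u (γ t)).re ≠ 0 ∨ uBar u p T (γ t) = 0 := by
  rcases lt_trichotomy t m.tMinus with h1 | rfl | h1
  · exact Or.inl (h.adm.re_pos_left t ⟨ht.1, h1⟩).ne'
  · exact Or.inr h.uBar_minus
  rcases lt_trichotomy t m.tPlus with h2 | rfl | h2
  · exact Or.inl (h.adm.re_neg t ⟨h1, h2⟩).ne
  · exact Or.inr h.uBar_plus
  · exact Or.inl (h.adm.re_pos_right t ⟨h2, ht.2⟩).ne'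

theorem continuousOn_thermalPath (h : IsPinned m U u γ p T) :
    ContinuousOn (thermalPath u γ p T) m.domain :=
  Sommerfeld.continuousOn_thermalPath h.pos h.adm.holomorphic.continuousOn h.adm.continuousOn
    h.adm.mapsTo fun _ ht => h.re_ne_zero_or ht

theorem continuousOn_uBar (h : IsPinned m U u γ p T) :
    ContinuousOn (fun t => uBar u p T (γ t)) m.domain :=
  (h.adm.holomorphic.continuousOn.comp h.adm.continuousOn h.adm.mapsTo).sub continuousOn_const

theorem continuousOn_clamped (h : IsPinned m U u γ p T) :
    ContinuousOn (fun t => uBar u p T (γ (m.clamp t)) / T) m.domain :=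
  (h.continuousOn_uBar.comp m.continuous_clamp.continuousOn fun t _ => m.clamp_mem t).div_const _

/-- Between the zeros `1 + e^{-x} = e^{-x} (1 + e^{x})`. Outside, clamping evaluates `ū` at a zero,
so the subtracted term vanishes. As `p` is an integer, `ū` may replace `u` in the exponential. -/
theorem isContinuousLog_branch (h : IsPinned m U u γ p T) :
    IsContinuousLog (fun t => 1 + exp (-(u (γ t) / T))) m.first m.last (branch m u γ p T) := by
  refine ⟨h.continuousOn_thermalPath.sub h.continuousOn_clamped, fun t ht => ?_⟩
  have hT : (T : ℂ) ≠ 0 := by exact_mod_cast h.pos.ne'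
  have hexp : exp (-(u (γ t) / T)) = exp (-(uBar u p T (γ t) / T)) := by
    rw [exp_eq_exp_iff_exists_int]
    refine ⟨-p, ?_⟩
    rw [uBar]
    push_cast
    field_simp
    ring
  have hre : ∀ t, (uBar u p T (γ t) / T).re = (u (γ t)).re / T := fun t => by
    rw [div_ofReal_re, uBar_re]
  have hout : 0 < (u (γ t)).re → exp (thermalPath u γ p T t) = 1 + exp (-(u (γ t) / T)) := by
    intro hpos
    have h1 : 0 < (uBar u p T (γ t) / T).re := by rw [hre]; exact div_pos hpos h.pos
    rw [thermalPath, thermalLog_of_nonneg h1.le,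
      exp_log (slitPlane_ne_zero (one_add_exp_neg_mem_slitPlane h1)), hexp]
  have hzero : uBar u p T (γ t) = 0 → exp (thermalPath u γ p T t) = 1 + exp (-(u (γ t) / T)) := by
    intro h0
    rw [hexp, thermalPath, h0, zero_div, neg_zero, exp_zero, thermalLog_zero,
      ← ofReal_exp, Real.exp_log two_pos]
    norm_num
  dsimp only
  rw [branch, exp_sub]
  rcases le_or_gt t m.tMinus with h1 | h1
  · rw [m.clamp_of_le h1, h.uBar_minus, zero_div, exp_zero, div_one]
    rcases h1.eq_or_lt with rfl | h1
    · exact hzero h.uBar_minus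
    · exact hout (h.adm.re_pos_left t ⟨ht.1, h1⟩)
  rcases le_or_gt m.tPlus t with h2 | h2
  · rw [m.clamp_of_ge h2, h.uBar_plus, zero_div, exp_zero, div_one]
    rcases h2.eq_or_lt with rfl | h2
    · exact hzero h.uBar_plus
    · exact hout (h.adm.re_pos_right t ⟨h2, ht.2⟩)
  rw [m.clamp_of_mem ⟨h1.le, h2.le⟩, hexp, thermalPath]
  set x := uBar u p T (γ t) / T with hx
  have hneg : x.re < 0 := by
    rw [hx, hre]
    exact div_neg_of_neg_of_pos (h.adm.re_neg t ⟨h1, h2⟩) h.pos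
  have h3 := one_add_exp_neg_mem_slitPlane (x := -x) (by rw [neg_re]; linarith)
  rw [neg_neg] at h3
  rw [thermalLog_of_neg hneg, exp_log (slitPlane_ne_zero h3), exp_neg]
  field_simp [exp_ne_zero x]
  ring

variable {z : ℂ}

theorem intervalIntegrable_coth_mul (h : IsPinned m U u γ p T)
    (hz : ∀ t ∈ m.domain, sinh (γ t - z) ≠ 0) {F : ℝ → ℂ} (hF : ContinuousOn F m.domain) {a b : ℝ}
    (ha : m.first ≤ a) (hab : a ≤ b) (hb : b ≤ m.last) :
    IntervalIntegrable (fun t => coth (γ t - z) * F t * deriv γ t) MeasureTheory.volume a b :=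
  h.adm.intervalIntegrable_mul ha hab hb
    (((continuousOn_coth_sub h.adm.continuousOn hz).mul hF).mono (Icc_subset_Icc ha hb))

theorem thermalIntegral_add (h : IsPinned m U u γ p T)
    (hz : ∀ t ∈ m.domain, sinh (γ t - z) ≠ 0) {a b c : ℝ}
    (ha : m.first ≤ a) (hab : a ≤ b) (hbc : b ≤ c) (hc : c ≤ m.last) :
    thermalIntegral u γ p T z a c =
      thermalIntegral u γ p T z a b + thermalIntegral u γ p T z b c :=
  (intervalIntegral.integral_add_adjacent_intervals
    (h.intervalIntegrable_coth_mul hz h.continuousOn_thermalPath ha hab (hbc.trans hc))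
    (h.intervalIntegrable_coth_mul hz h.continuousOn_thermalPath (ha.trans hab) hbc hc)).symm

/-- The clamped term is supported between the zeros, where it is the integrand of `farExpansion`.
All error estimates thus concern the thermal integral alone. -/
theorem cauchyIntegral_branch (h : IsPinned m U u γ p T)
    (hz : ∀ t ∈ m.domain, sinh (γ t - z) ≠ 0) :
    cauchyIntegral m γ (branch m u γ p T) z =
      farExpansion m γ (uBar u p T) T z + thermalIntegral u γ p T z m.first m.last := by
  have hi := @intervalIntegrable_coth_mul m U u γ p T z h hz
  have h1 : cauchyIntegral m γ (branch m u γ p T) z =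
      thermalIntegral u γ p T z m.first m.last -
      ∫ t in m.first..m.last, coth (γ t - z) * (uBar u p T (γ (m.clamp t)) / T) * deriv γ t := by
    rw [thermalIntegral, ← intervalIntegral.integral_sub
      (hi h.continuousOn_thermalPath le_rfl m.first_lt_last.le le_rfl)
      (hi h.continuousOn_clamped le_rfl m.first_lt_last.le le_rfl)]
    rw [cauchyIntegral, contourIntegral]
    congr 1
    ext t
    rw [branch]
    ring
  have f1 : m.first ≤ m.tMinus := m.first_lt.le
  have f2 : m.tMinus ≤ m.tPlus := m.minus_lt_plus.le
  have f3 : m.tPlus ≤ m.last := m.lt_last.le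
  have hc := h.continuousOn_clamped
  have e1 : ∫ t in m.first..m.tMinus, coth (γ t - z) * (uBar u p T (γ (m.clamp t)) / T) * deriv γ t
      = 0 := by
    refine (intervalIntegral.integral_congr (g := fun _ => 0) fun t ht => ?_).trans
      intervalIntegral.integral_zero
    rw [uIcc_of_le f1] at ht
    simp only [m.clamp_of_le ht.2, h.uBar_minus]
    ring
  have e2 : ∫ t in m.tPlus..m.last, coth (γ t - z) * (uBar u p T (γ (m.clamp t)) / T) * deriv γ t
      = 0 := by
    refine (intervalIntegral.integral_congr (g := fun _ => 0) fun t ht => ?_).trans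
      intervalIntegral.integral_zero
    rw [uIcc_of_le f3] at ht
    simp only [m.clamp_of_ge ht.1, h.uBar_plus]
    ring
  have e3 : ∫ t in m.tMinus..m.tPlus,
      coth (γ t - z) * (uBar u p T (γ (m.clamp t)) / T) * deriv γ t =
      -farExpansion m γ (uBar u p T) T z := by
    rw [farExpansion, neg_neg, contourIntegral]
    refine intervalIntegral.integral_congr fun t ht => ?_
    rw [uIcc_of_le f2] at ht
    simp only [m.clamp_of_mem ht]
  rw [h1, ← intervalIntegral.integral_add_adjacent_intervals
      (hi hc le_rfl f1 (f2.trans f3)) (hi hc f1 (f2.trans f3) le_rfl),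
    ← intervalIntegral.integral_add_adjacent_intervals (hi hc f1 f2 f3) (hi hc (f1.trans f2) f3 le_rfl),
    e1, e2, e3]
  ring

/-- The thermal logarithm is even. -/
theorem thermalPath_eq (h : IsPinned m U u γ p T) {τ : ℝ} (hτ : τ = 1 ∨ τ = -1) {t : ℝ}
    (ht : t ∈ m.domain) : thermalPath u γ p T t = thermalLog (τ * uBar u p T (γ t) / T) := by
  rw [thermalPath]
  rcases hτ with rfl | rfl
  · simp
  · rw [show ((-1 : ℝ) : ℂ) * uBar u p T (γ t) / T = -(uBar u p T (γ t) / T) by push_cast; ring,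
      thermalLog_neg]
    rcases h.re_ne_zero_or ht with h1 | h1
    · left
      rw [div_ofReal_re, uBar_re]
      exact div_ne_zero h1 h.pos.ne'
    · right
      rw [h1, zero_div]

theorem thermalIntegral_eq (h : IsPinned m U u γ p T) {τ : ℝ} (hτ : τ = 1 ∨ τ = -1) {a b : ℝ}
    (ha : m.first ≤ a) (hab : a ≤ b) (hb : b ≤ m.last) : thermalIntegral u γ p T z a b =
      ∫ t in a..b, coth (γ t - z) * thermalLog (τ * uBar u p T (γ t) / T) * deriv γ t := by
  refine intervalIntegral.integral_congr fun t ht => ?_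
  rw [uIcc_of_le hab] at ht
  simp only [h.thermalPath_eq hτ ⟨ha.trans ht.1, ht.2.trans hb⟩]

end IsPinned

/-! ### The near expansions as exact identities -/

namespace IsAdmissible

variable {m : Mesh} {U : Set ℂ} {u : ℂ → ℂ} {γ : ℝ → ℂ} {z : ℂ}

theorem differentiableAt_of_notMem_range (h : IsAdmissible m U u γ) {t : ℝ}
    (ht : t ∈ Ioo m.first m.last) (hk : t ∉ range m.knot) : DifferentiableAt ℝ γ t := by
  obtain ⟨i, hi, h1, h2⟩ := m.exists_left_piece ⟨ht.1, ht.2.le⟩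
  exact h.differentiableAt hi ⟨h1, lt_of_le_of_ne h2 fun h0 => hk ⟨i + 1, h0.symm⟩⟩

theorem exp_integral_coth (h : IsAdmissible m U u γ)
    (hz : ∀ t ∈ m.domain, sinh (γ t - z) ≠ 0) {a b : ℝ} (ha : m.first < a) (hab : a ≤ b)
    (hb : b < m.last) :
    exp (∫ t in a..b, coth (γ t - z) * deriv γ t) = sinh (γ b - z) / sinh (γ a - z) := by
  have hsub : Icc a b ⊆ m.domain := Icc_subset_Icc ha.le hb.le
  have hγ := h.continuousOn.mono hsub
  have hcount : (range m.knot).Countable := countable_range _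
  have hder : ∀ t ∈ Icc a b, t ∉ range m.knot → HasDerivAt (fun t => sinh (γ t - z))
      (cosh (γ t - z) * deriv γ t) t := fun t ht hk =>
    (hasDerivAt_sinh _).comp_of_eq t ((h.differentiableAt_of_notMem_range
      ⟨ha.trans_le ht.1, ht.2.trans_lt hb⟩ hk).hasDerivAt.sub_const z) rfl
  have hae : ∀ᵐ t, t ∈ uIoc a b → HasDerivAt (fun t => sinh (γ t - z))
      (cosh (γ t - z) * deriv γ t) t := by
    filter_upwards [hcount.ae_notMem MeasureTheory.volume] with t hk ht
    rw [uIoc_of_le hab] at ht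
    exact hder t (Ioc_subset_Icc_self ht) hk
  have hi : IntervalIntegrable (deriv fun t => sinh (γ t - z)) MeasureTheory.volume a b := by
    refine (h.intervalIntegrable_mul (F := fun t => cosh (γ t - z)) ha.le hab hb.le
      (continuous_cosh.comp_continuousOn (hγ.sub continuousOn_const))).congr_ae ?_
    refine (MeasureTheory.ae_restrict_iff' measurableSet_uIoc).2 ?_
    filter_upwards [hae] with t hd ht
    exact (hd ht).deriv.symm
  have := exp_integral_inv_mul_deriv (y := fun t => sinh (γ t - z)) hab
    (continuous_sinh.comp_continuousOn (hγ.sub continuousOn_const)) (fun t ht => hz t (hsub ht))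
    hcount (fun t ht => (hder t (Ioo_subset_Icc_self ht.1) ht.2).differentiableAt) hi
  rw [← this]
  congr 1
  refine intervalIntegral.integral_congr_ae ?_
  filter_upwards [hae] with t hd ht
  rw [(hd ht).deriv, coth]
  ring

/-- As `coth` is the logarithmic derivative of `sinh`, its indefinite integral along the contour is
the required continuous logarithm. Hence `ℓ` is the very integral that arises from subtracting
`ū(z)` in `regularPart`. -/
theorem isLogSinhRatio (h : IsAdmissible m U u γ) (hz : ∀ t ∈ m.domain, sinh (γ t - z) ≠ 0) :
    IsLogSinhRatio m γ z (∫ t in m.tMinus..m.tPlus, coth (γ t - z) * deriv γ t) := by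
  have hle := m.minus_lt_plus.le
  have hi : IntervalIntegrable (fun t => coth (γ t - z) * deriv γ t) MeasureTheory.volume
      m.tMinus m.tPlus := h.intervalIntegrable_mul m.first_lt.le hle m.lt_last.le
    ((continuousOn_coth_sub h.continuousOn hz).mono (Icc_subset_Icc m.first_lt.le m.lt_last.le))
  refine ⟨fun s => ∫ t in m.tMinus..s, coth (γ t - z) * deriv γ t, ⟨?_, fun s hs => ?_⟩,
    intervalIntegral.integral_same, rfl⟩
  · have := intervalIntegral.continuousOn_primitive_interval' hi left_mem_uIcc
    rwa [uIcc_of_le hle] at this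
  · exact h.exp_integral_coth hz m.first_lt hs.1 (hs.2.trans_lt m.lt_last)

end IsAdmissible

namespace IsPinned

variable {m : Mesh} {U : Set ℂ} {u : ℂ → ℂ} {γ : ℝ → ℂ} {p : ℤ} {T : ℝ} {z : ℂ}

theorem regularPart_eq (h : IsPinned m U u γ p T) (hz : ∀ t ∈ m.domain, sinh (γ t - z) ≠ 0) :
    regularPart m γ (uBar u p T) T z = farExpansion m γ (uBar u p T) T z +
      uBar u p T z / T * ∫ t in m.tMinus..m.tPlus, coth (γ t - z) * deriv γ t := by
  have hsub : Icc m.tMinus m.tPlus ⊆ m.domain := Icc_subset_Icc m.first_lt.le m.lt_last.le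
  have hc := continuousOn_coth_sub h.adm.continuousOn hz
  rw [regularPart, farExpansion, contourIntegral, contourIntegral,
    ← intervalIntegral.integral_const_mul, ← sub_eq_neg_add, ← neg_inj, neg_neg, neg_sub,
    ← intervalIntegral.integral_sub]
  · congr 1
    ext t
    ring
  · exact h.adm.intervalIntegrable_mul m.first_lt.le m.minus_lt_plus.le m.lt_last.le
      ((hc.mul (h.continuousOn_uBar.div_const _)).mono hsub)
  · exact (h.adm.intervalIntegrable_mul m.first_lt.le m.minus_lt_plus.le m.lt_last.le
      (hc.mono hsub)).const_mul _

/-- The term with `ℓ` cancels the subtraction made in `regularPart`. The Gamma function, the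
logarithm and the constants then combine to Stirling's remainder at `w = σū(z)/(2πiT)`, because `σ
2πi w = ū(z)/T`; no error is committed. -/
theorem nearPlusExpansion_eq (h : IsPinned m U u γ p T)
    (hz : ∀ t ∈ m.domain, sinh (γ t - z) ≠ 0) {σ : ℝ} (hσ : σ = 1 ∨ σ = -1) :
    nearPlusExpansion m γ (uBar u p T) T σ z
      (∫ t in m.tMinus..m.tPlus, coth (γ t - z) * deriv γ t) =
    farExpansion m γ (uBar u p T) T z -
      σ * (2 * Real.pi * I) * scaledRemainder T σ (uBar u p T z) := by
  have hT : (T : ℂ) ≠ 0 := by exact_mod_cast h.pos.ne'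
  have hpi : (Real.pi : ℂ) ≠ 0 := by exact_mod_cast Real.pi_ne_zero
  have hσσ : (σ : ℂ) * σ = 1 := by rcases hσ with rfl | rfl <;> simp
  have hσ0 : (σ : ℂ) ≠ 0 := by rcases hσ with rfl | rfl <;> simp
  rw [nearPlusExpansion, h.regularPart_eq hz, scaledRemainder, stirlingRemainder]
  set ζ := uBar u p T z
  set w := σ * ζ / T / (2 * Real.pi * I) with hw
  have e1 : (σ : ℂ) * (ζ / (2 * Real.pi * I * T)) = w := by rw [hw]; field_simp
  have e2 : ζ / (σ * (2 * Real.pi * I * T)) = w := by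
    rw [hw]
    field_simp
    linear_combination -ζ * hσσ
  have e3 : (σ : ℂ) * (2 * Real.pi * I) * w = ζ / T := by
    rw [hw]
    field_simp
    linear_combination ζ * hσσ
  rw [e1, e2]
  linear_combination (-(log w) + 1) * e3

/-- The same identity with `-ū(z)` for `ū(z)`, since the coordinate at the first zero is `-ū`. -/
theorem nearMinusExpansion_eq (h : IsPinned m U u γ p T)
    (hz : ∀ t ∈ m.domain, sinh (γ t - z) ≠ 0) {σ : ℝ} (hσ : σ = 1 ∨ σ = -1) :
    nearMinusExpansion m γ (uBar u p T) T σ z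
      (∫ t in m.tMinus..m.tPlus, coth (γ t - z) * deriv γ t) =
    farExpansion m γ (uBar u p T) T z -
      σ * (2 * Real.pi * I) * scaledRemainder T σ (-uBar u p T z) := by
  have hT : (T : ℂ) ≠ 0 := by exact_mod_cast h.pos.ne'
  have hpi : (Real.pi : ℂ) ≠ 0 := by exact_mod_cast Real.pi_ne_zero
  have hσσ : (σ : ℂ) * σ = 1 := by rcases hσ with rfl | rfl <;> simp
  have hσ0 : (σ : ℂ) ≠ 0 := by rcases hσ with rfl | rfl <;> simp
  rw [nearMinusExpansion, h.regularPart_eq hz, scaledRemainder, stirlingRemainder]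
  set ζ := uBar u p T z
  set w := σ * -ζ / T / (2 * Real.pi * I) with hw
  have e1 : (1 : ℂ) / 2 - σ * (ζ / (2 * Real.pi * I * T)) = 1 / 2 + w := by
    rw [hw]
    field_simp
    ring
  have e2 : ζ / (-σ * (2 * Real.pi * I * T)) = w := by
    rw [hw]
    field_simp
    linear_combination ζ * hσσ
  have e3 : (σ : ℂ) * (2 * Real.pi * I) * w = -ζ / T := by
    rw [hw]
    field_simp
    linear_combination -ζ * hσσ
  rw [e1, e2]
  linear_combination (-(log w) + 1) * e3

end IsPinned

/-- If `|sinh (w - z)|` were smaller than `r/4`, some translate of `z` by the period would be within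
`r/2` of `w` and hence within `r` of `q`. -/
theorem IsAwayFrom.le_norm_sinh {r : ℝ} {z w q : ℂ} (h : IsAwayFrom r z q) (hw : ‖w - q‖ ≤ r / 2) :
    r / 4 ≤ ‖sinh (w - z)‖ := by
  obtain ⟨k, hk⟩ := exists_int_norm_sub_le (w - z)
  have h1 := h (-k)
  have h2 := norm_sub_le (w - q) (w - z - k * (Real.pi * I))
  rw [show w - q - (w - z - k * (Real.pi * I)) = z - (q + (-k : ℤ) * (Real.pi * I)) by
    push_cast; ring] at h2
  linarith

theorem thermalIntegral_eq_boundaryError (u : ℂ → ℂ) (γ : ℝ → ℂ) (p : ℤ) (T : ℝ) (z : ℂ)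
    (a b : ℝ) : thermalIntegral u γ p T z a b = boundaryError u γ p T z a b +
      (thermalPath u γ p T b * logSinh (γ b - z) - thermalPath u γ p T a * logSinh (γ a - z)) := by
  rw [boundaryError, sub_add_cancel, thermalIntegral]

/-! ### Uniform bounds and assembly -/

namespace IsFamily

variable {m : Mesh} {U : Set ℂ} {𝒯 : Set ℝ} {u : ℝ → ℂ → ℂ} {γ : ℝ → ℝ → ℂ} {p : ℝ → ℤ}
  {u₀ : ℂ → ℂ} {γ₀ : ℝ → ℂ}

theorem isPinned (h : IsFamily m U 𝒯 u γ p u₀ γ₀) {T : ℝ} (hT : T ∈ 𝒯) :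
    IsPinned m U (u T) (γ T) (p T) T :=
  ⟨h.adm T hT, h.pos T hT, h.im_minus T hT, h.im_plus T hT⟩

theorem exists_lt_of_eventually (h : IsFamily m U 𝒯 u γ p u₀ γ₀) {P : ℝ → Prop}
    (hP : ∀ᶠ T in 𝓝[𝒯] (0 : ℝ), P T) : ∃ T₀ > 0, ∀ T ∈ 𝒯, T < T₀ → P T := by
  obtain ⟨ε, hε, hsub⟩ := Metric.mem_nhdsWithin_iff.1 hP
  refine ⟨ε, hε, fun T hT hTε => hsub ⟨?_, hT⟩⟩
  rw [Metric.mem_ball, Real.dist_eq, sub_zero, abs_of_pos (h.pos T hT)]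
  exact hTε

/-- The contour without the two arcs around the zeros. The boundary terms at the four cuts are
`O(T)` times `|log c|`. -/
theorem exists_norm_far_le (h : IsFamily m U 𝒯 u γ p u₀ γ₀) {s₁ s₂ t₁ t₂ : ℝ}
    (h1 : m.first ≤ s₁) (h2 : s₁ < m.tMinus) (h3 : m.tMinus < s₂) (h4 : s₂ ≤ t₁)
    (h5 : t₁ < m.tPlus) (h6 : m.tPlus < t₂) (h7 : t₂ ≤ m.last) {c : ℝ} (hc : 0 < c) :
    ∃ C, ∀ᶠ T in 𝓝[𝒯] (0 : ℝ), ∀ z, (∀ t ∈ m.domain, sinh (γ T t - z) ≠ 0) →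
      (∀ t ∈ ({s₁, s₂, t₁, t₂} : Set ℝ), c ≤ ‖sinh (γ T t - z)‖) →
      (γ T m.first = γ T m.last ∨
        c ≤ ‖sinh (γ T m.first - z)‖ ∧ c ≤ ‖sinh (γ T m.last - z)‖) →
      ‖thermalIntegral (u T) (γ T) (p T) T z m.first s₁ +
        thermalIntegral (u T) (γ T) (p T) T z s₂ t₁ +
        thermalIntegral (u T) (γ T) (p T) T z t₂ m.last‖ ≤ C * T := by
  have k1 : s₂ ≤ m.last := h4.trans (h5.trans (h6.trans_le h7)).le
  have k2 : m.first ≤ s₂ := h1.trans (h2.trans h3).le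
  obtain ⟨C₁, hC₁⟩ := h.exists_norm_boundaryError_le le_rfl h1
    ((h2.trans h3).le.trans k1) (Or.inl rfl) fun t ht => by
      rw [one_mul]; exact h.adm₀.re_pos_left t ⟨ht.1, ht.2.trans_lt h2⟩
  obtain ⟨C₂, hC₂⟩ := h.exists_norm_boundaryError_le k2 h4
    (h5.trans (h6.trans_le h7)).le (Or.inr rfl) fun t ht => by
      linarith [h.adm₀.re_neg t ⟨h3.trans_le ht.1, ht.2.trans_lt h5⟩]
  obtain ⟨C₃, hC₃⟩ := h.exists_norm_boundaryError_le (k2.trans (h4.trans (h5.trans h6).le)) h7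
    le_rfl (Or.inl rfl) fun t ht => by
      rw [one_mul]; exact h.adm₀.re_pos_right t ⟨h6.trans_le ht.1, ht.2⟩
  set ℓ := |Real.log c| with hℓ
  refine ⟨C₁ + C₂ + C₃ + 2 * (C₁ + C₂ + C₃) * ℓ, ?_⟩
  filter_upwards [hC₁, hC₂, hC₃, h.eventually_pos]
    with T ⟨g1, hC₁⟩ ⟨g2, hC₂⟩ ⟨g3, hC₃⟩ hT0 z hz hs hends
  have b1 := hC₁ z fun t ht => hz t ⟨ht.1, ht.2.trans ((h2.trans h3).le.trans k1)⟩
  have b2 := hC₂ z fun t ht => hz t ⟨k2.trans ht.1, ht.2.trans (h5.trans (h6.trans_le h7)).le⟩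
  have b3 := hC₃ z fun t ht => hz t ⟨(k2.trans (h4.trans (h5.trans h6).le)).trans ht.1, ht.2⟩
  have hterm : ∀ t D, ‖thermalPath (u T) (γ T) (p T) T t‖ ≤ D * T → c ≤ ‖sinh (γ T t - z)‖ →
      ‖thermalPath (u T) (γ T) (p T) T t * logSinh (γ T t - z)‖ ≤ D * T * ℓ := by
    intro t D hD ht
    rw [norm_mul, norm_real, Real.norm_eq_abs]
    exact mul_le_mul hD (abs_logSinh_le hc ht) (abs_nonneg _) ((norm_nonneg _).trans hD)
  have d1 := hterm s₁ C₁ (g1 s₁ ⟨h1, le_rfl⟩) (hs s₁ (by simp))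
  have d2 := hterm s₂ C₂ (g2 s₂ ⟨le_rfl, h4⟩) (hs s₂ (by simp))
  have d3 := hterm t₁ C₂ (g2 t₁ ⟨h4, le_rfl⟩) (hs t₁ (by simp))
  have d4 := hterm t₂ C₃ (g3 t₂ ⟨le_rfl, h7⟩) (hs t₂ (by simp))
  have hends' : ‖thermalPath (u T) (γ T) (p T) T m.last * logSinh (γ T m.last - z) -
      thermalPath (u T) (γ T) (p T) T m.first * logSinh (γ T m.first - z)‖ ≤
      C₃ * T * ℓ + C₁ * T * ℓ := by
    have q1 := g1 m.first ⟨le_rfl, h1⟩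
    have q3 := g3 m.last ⟨h7, le_rfl⟩
    rcases hends with he | ⟨he1, he2⟩
    -- For a closed contour the two end terms cancel exactly, since the thermal logarithm depends
    -- only on the point of the contour; hence `z` may come close to the common end point.
    · rw [thermalPath, thermalPath, he, sub_self, norm_zero]
      have := (norm_nonneg _).trans q1
      have := (norm_nonneg _).trans q3
      positivity
    · exact (norm_sub_le _ _).trans (add_le_add (hterm _ _ q3 he2) (hterm _ _ q1 he1))
  simp only [thermalIntegral_eq_boundaryError]
  generalize thermalPath (u T) (γ T) (p T) T s₁ * logSinh (γ T s₁ - z) = x₁ at *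
  generalize thermalPath (u T) (γ T) (p T) T s₂ * logSinh (γ T s₂ - z) = x₂ at *
  generalize thermalPath (u T) (γ T) (p T) T t₁ * logSinh (γ T t₁ - z) = x₃ at *
  generalize thermalPath (u T) (γ T) (p T) T t₂ * logSinh (γ T t₂ - z) = x₄ at *
  generalize thermalPath (u T) (γ T) (p T) T m.first * logSinh (γ T m.first - z) = x₅ at *
  generalize thermalPath (u T) (γ T) (p T) T m.last * logSinh (γ T m.last - z) = x₆ at *
  generalize boundaryError (u T) (γ T) (p T) T z m.first s₁ = y₁ at *
  generalize boundaryError (u T) (γ T) (p T) T z s₂ t₁ = y₂ at *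
  generalize boundaryError (u T) (γ T) (p T) T z t₂ m.last = y₃ at *
  have e : y₁ + (x₁ - x₅) + (y₂ + (x₃ - x₂)) + (y₃ + (x₆ - x₄)) =
      (y₁ + y₂ + y₃) + (x₁ - x₂) + (x₃ - x₄) + (x₆ - x₅) := by ring
  rw [e]
  have n1 := norm_add_le ((y₁ + y₂ + y₃) + (x₁ - x₂) + (x₃ - x₄)) (x₆ - x₅)
  have n2 := norm_add_le ((y₁ + y₂ + y₃) + (x₁ - x₂)) (x₃ - x₄)
  have n3 := norm_add_le (y₁ + y₂ + y₃) (x₁ - x₂)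
  have n4 := norm_add₃_le (a := y₁) (b := y₂) (c := y₃)
  have n5 := norm_sub_le x₁ x₂
  have n6 := norm_sub_le x₃ x₄
  linarith

variable {τ t₀ t₁ t₂ r κ : ℝ} {A e₁ e₂ : ℂ}

theorem exists_norm_near_le (h : IsFamily m U 𝒯 u γ p u₀ γ₀) (hτ : τ = 1 ∨ τ = -1)
    (h1 : m.first ≤ t₁) (h2 : t₂ ≤ m.last) (hκ : 0 < κ)
    (hN : ∀ᶠ T in 𝓝[𝒯] (0 : ℝ), IsNearArc (fun z => τ * uBar (u T) (p T) T z) (γ T) t₁ t₀ t₂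
      (γ T t₀) A r κ e₁ e₂) {c : ℝ} (hc : 0 < c) :
    ∃ C, ∀ᶠ T in 𝓝[𝒯] (0 : ℝ), ∀ z, (∀ w ∈ Metric.closedBall (γ T t₀) r, c ≤ ‖sinh (w - z)‖) →
      ‖thermalIntegral (u T) (γ T) (p T) T z t₁ t₂‖ ≤ C * T := by
  refine ⟨480 * (‖A‖ * r / 16) * ((1 + 1 / c) * (2 / ‖A‖)) / κ, ?_⟩
  filter_upwards [hN, h.eventually_mem, h.eventually_lt (show 0 < κ / 8 by linarith)]
    with T hN hT hTκ z hz
  rw [(h.isPinned hT).thermalIntegral_eq hτ h1 hN.le h2]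
  exact hN.norm_integral_regular_le (h.pos T hT) (by linarith) hc hz

theorem exists_norm_near_add_le (h : IsFamily m U 𝒯 u γ p u₀ γ₀) (hτ : τ = 1 ∨ τ = -1)
    (h1 : m.first ≤ t₁) (h2 : t₂ ≤ m.last) (ht : t₀ ∈ Ioo t₁ t₂) (hκ : 0 < κ) (hr : 0 < r)
    (hA : A ≠ 0)
    (hN : ∀ᶠ T in 𝓝[𝒯] (0 : ℝ), IsNearArc (fun z => τ * uBar (u T) (p T) T z) (γ T) t₁ t₀ t₂
      (γ T t₀) A r κ e₁ e₂)
    (hinc : ∀ t ∈ m.domain, sinh (γ₀ t - γ₀ t₀) = 0 → t = t₀) {ρ₀ : ℝ} (hρ₀ : 0 < ρ₀) :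
    ∃ δ₀ > 0, ∃ c > 0, ∃ C, ∀ᶠ T in 𝓝[𝒯] (0 : ℝ), ∀ δ ≤ δ₀, ∀ σ : ℝ, (σ = 1 ∨ σ = -1) → ∀ z,
      IsOnSide m (γ T) (nbhd U (uBar (u T) (p T) T) δ (γ T t₀)) σ z →
      ‖z - γ T t₀‖ ≤ ρ₀ ∧ (∀ t ∈ m.domain, sinh (γ T t - z) ≠ 0) ∧
      (∀ t ∈ m.domain, t ∉ Ioo t₁ t₂ → c ≤ ‖sinh (γ T t - z)‖) ∧
      ‖thermalIntegral (u T) (γ T) (p T) T z t₁ t₂ +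
        σ * (2 * Real.pi * I) * scaledRemainder T σ (τ * uBar (u T) (p T) T z)‖ ≤ C * T := by
  have hAn := norm_pos_iff.2 hA
  obtain ⟨c, hc, ρ₁, hρ₁, hsinh⟩ := h.exists_le_norm_sinh (s := t₀) (K := m.domain \ Ioo t₁ t₂)
    ⟨h1.trans ht.1.le, ht.2.le.trans h2⟩ (isCompact_Icc.diff isOpen_Ioo) sdiff_subset
    fun t ht' h0 => ht'.2 (by rw [hinc t ht'.1 h0]; exact ht)
  set ρ := min (min ρ₀ ρ₁) r with hρ
  have hρ0 : 0 < ρ := lt_min (lt_min hρ₀ hρ₁) hr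
  -- The first bound keeps `|ū|` below `κ/2` on the neighbourhood, the second confines the
  -- neighbourhood to the disc of radius `ρ`.
  refine ⟨min κ (31 / 16 * ‖A‖ * ρ), lt_min hκ (by positivity), c, hc,
    480 * (‖A‖ * r / 16) * (160 / (‖A‖ * r)) / κ + 960 * (‖A‖ * r / 16) / κ ^ 2, ?_⟩
  filter_upwards [hN, hsinh, h.eventually_mem, h.eventually_lt (show 0 < κ / 8 by linarith)]
    with T hN hsinh hT hTκ δ hδ σ hσ z hside
  have hδκ := hδ.trans (min_le_left _ _)
  have hδρ := hδ.trans (min_le_right _ _)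
  have hnorm : ∀ w, ‖uBar (u T) (p T) T w‖ = ‖τ * uBar (u T) (p T) T w‖ := fun w => by
    rw [norm_mul, norm_real]
    rcases hτ with rfl | rfl <;> simp
  have hVρ := nbhd_subset_ball hN.chart (U := U) hnorm hρ0 (min_le_right _ _) (δ := δ)
    (by linarith)
  set V := nbhd U (uBar (u T) (p T) T) δ (γ T t₀) with hV
  have hVκ : ∀ w ∈ V, ‖τ * uBar (u T) (p T) T w‖ < κ / 2 := fun w hw => by
    have h1 : ‖uBar (u T) (p T) T w‖ < δ / 2 := nbhd_subset hw
    rw [← hnorm]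
    linarith
  have hVn : ∀ w ∈ V, ‖w - γ T t₀‖ ≤ ρ := fun w hw => by
    have := hVρ hw
    rw [Metric.mem_ball, dist_eq_norm] at this
    exact this.le
  have hVr : V ⊆ Metric.closedBall (γ T t₀) r := fun w hw => by
    rw [Metric.mem_closedBall, dist_eq_norm]
    exact (hVn w hw).trans (min_le_right _ _)
  have hfar : ∀ w ∈ V, ∀ t ∈ m.domain, t ∉ Ioo t₁ t₂ → c ≤ ‖sinh (γ T t - w)‖ :=
    fun w hw t htm htn => hsinh w ((hVn w hw).trans ((min_le_left _ _).trans (min_le_right _ _))) t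
      ⟨htm, htn⟩ _ (by rw [sub_self, norm_zero]; exact hρ₁.le)
  obtain ⟨s, hs, hsV, hd, hd0, hjoin⟩ := hside
  -- The base point of the normal lies on the short arc: elsewhere on the contour `sinh (γ s - w)`
  -- is bounded below for `w` in the neighbourhood, which contains `γ s` itself.
  have hs' : s ∈ Ioo t₁ t₂ := by
    by_contra hn
    have := hfar _ hsV s (Ioo_subset_Icc_self hs) hn
    rw [sub_self, sinh_zero, norm_zero] at this
    linarith
  obtain ⟨hzV, hzγ⟩ : z ∈ V \ γ T '' m.domain := hjoin.exists.choose_spec.target_mem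
  refine ⟨(hVn z hzV).trans ((min_le_left _ _).trans (min_le_left _ _)), fun t htm => ?_,
    hfar z hzV, ?_⟩
  · by_cases htI : t ∈ Ioo t₁ t₂
    · have hne : 0 < ‖γ T t - z‖ := norm_pos_iff.2 (sub_ne_zero.2 fun h0 => hzγ ⟨t, htm, h0⟩)
      have hle : ‖γ T t - z‖ ≤ 1 / 2 := by
        have a1 := hN.mem_closedBall (Ioo_subset_Icc_self htI)
        have a2 := hVr hzV
        rw [Metric.mem_closedBall, dist_eq_norm] at a1 a2
        have := norm_sub_le (γ T t - γ T t₀) (z - γ T t₀)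
        rw [sub_sub_sub_cancel_right] at this
        linarith [hN.chart.radius_le]
      have := half_norm_le_norm_sinh hle
      exact norm_pos_iff.1 (by linarith)
    · have := hfar z hzV t htm htI
      exact norm_pos_iff.1 (by linarith)
  · rw [(h.isPinned hT).thermalIntegral_eq hτ h1 hN.le h2]
    refine hN.norm_integral_singular_le (h.pos T hT) (by linarith) hσ hVr hVκ hs' hd hd0 ?_
    filter_upwards [hjoin] with ε hε
    exact hε.mono (sdiff_subset_sdiff_right (image_mono (Icc_subset_Icc h1 h2)))

theorem exists_isNearArc_minus (h : IsFamily m U 𝒯 u γ p u₀ γ₀) {R : ℝ} (hR : 0 < R) :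
    ∃ r > 0, r ≤ R ∧ ∃ t₁ t₂ κ : ℝ, ∃ A e₁ e₂ : ℂ, m.first < t₁ ∧ t₁ < m.tMinus ∧ m.tMinus < t₂ ∧
      t₂ < (m.tMinus + m.tPlus) / 2 ∧ 0 < κ ∧ A ≠ 0 ∧ ∀ᶠ T in 𝓝[𝒯] (0 : ℝ),
        IsNearArc (fun z => (-1 : ℝ) * uBar (u T) (p T) T z) (γ T) t₁ m.tMinus t₂
          (γ T m.tMinus) A r κ e₁ e₂ := by
  have hlt := m.minus_lt_plus
  refine h.exists_isNearArc (Or.inr rfl) le_rfl m.first_lt (by linarith)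
    (by linarith [m.lt_last, show m.last = m.knot m.n from rfl]) ?_ ?_ ?_ ?_
    (fun T hT => (h.isPinned hT).uBar_minus) h.adm₀.simple_minus hR
  · intro T hT t ht
    linarith [(h.adm T hT).re_pos_left t ht]
  · intro T hT t ht
    linarith [(h.adm T hT).re_neg t ⟨ht.1, by linarith [ht.2]⟩]
  · intro t ht
    linarith [h.adm₀.re_pos_left t ht]
  · intro t ht
    linarith [h.adm₀.re_neg t ⟨ht.1, by linarith [ht.2]⟩]

theorem exists_isNearArc_plus (h : IsFamily m U 𝒯 u γ p u₀ γ₀) {R : ℝ} (hR : 0 < R) :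
    ∃ r > 0, r ≤ R ∧ ∃ t₁ t₂ κ : ℝ, ∃ A e₁ e₂ : ℂ, (m.tMinus + m.tPlus) / 2 < t₁ ∧ t₁ < m.tPlus ∧
      m.tPlus < t₂ ∧ t₂ < m.last ∧ 0 < κ ∧ A ≠ 0 ∧ ∀ᶠ T in 𝓝[𝒯] (0 : ℝ),
        IsNearArc (fun z => (1 : ℝ) * uBar (u T) (p T) T z) (γ T) t₁ m.tPlus t₂
          (γ T m.tPlus) A r κ e₁ e₂ := by
  have hlt := m.minus_lt_plus
  refine h.exists_isNearArc (Or.inl rfl)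
    (by linarith [m.first_lt, show m.first = m.knot 0 from rfl]) (by linarith) m.lt_last le_rfl
    ?_ ?_ ?_ ?_ (fun T hT => (h.isPinned hT).uBar_plus) h.adm₀.simple_plus hR
  · intro T hT t ht
    linarith [(h.adm T hT).re_neg t ⟨by linarith [ht.1], ht.2⟩]
  · intro T hT t ht
    linarith [(h.adm T hT).re_pos_right t ht]
  · intro t ht
    linarith [h.adm₀.re_neg t ⟨by linarith [ht.1], ht.2⟩]
  · intro t ht
    linarith [h.adm₀.re_pos_right t ht]

end IsFamily

theorem IsPinned.thermalIntegral_split {m : Mesh} {U : Set ℂ} {u : ℂ → ℂ} {γ : ℝ → ℂ} {p : ℤ}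
    {T : ℝ} {z : ℂ} (h : IsPinned m U u γ p T) (hz : ∀ t ∈ m.domain, sinh (γ t - z) ≠ 0)
    {s₁ s₂ t₁ t₂ : ℝ} (h1 : m.first ≤ s₁) (h2 : s₁ ≤ s₂) (h3 : s₂ ≤ t₁) (h4 : t₁ ≤ t₂)
    (h5 : t₂ ≤ m.last) : thermalIntegral u γ p T z m.first m.last =
      (thermalIntegral u γ p T z m.first s₁ + thermalIntegral u γ p T z s₂ t₁ +
        thermalIntegral u γ p T z t₂ m.last) +
      thermalIntegral u γ p T z s₁ s₂ + thermalIntegral u γ p T z t₁ t₂ := by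
  rw [h.thermalIntegral_add hz le_rfl h1 (h2.trans (h3.trans (h4.trans h5))) le_rfl,
    h.thermalIntegral_add hz h1 h2 (h3.trans (h4.trans h5)) le_rfl,
    h.thermalIntegral_add hz (h1.trans h2) h3 (h4.trans h5) le_rfl,
    h.thermalIntegral_add hz (h1.trans (h2.trans h3)) h4 h5 le_rfl]
  ring

namespace IsFamily

variable {m : Mesh} {U : Set ℂ} {𝒯 : Set ℝ} {u : ℝ → ℂ → ℂ} {γ : ℝ → ℝ → ℂ} {p : ℝ → ℤ}
  {u₀ : ℂ → ℂ} {γ₀ : ℝ → ℂ}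

/-- The expansion uniformly away from the two zeros. -/
theorem exists_far_expansion (h : IsFamily m U 𝒯 u γ p u₀ γ₀) {r : ℝ} (hr : 0 < r) :
    ∃ C, ∀ᶠ T in 𝓝[𝒯] (0 : ℝ), ∀ z, (∀ t ∈ m.domain, sinh (γ T t - z) ≠ 0) →
      IsAwayFrom r z (γ T m.tMinus) → IsAwayFrom r z (γ T m.tPlus) →
      (γ T m.first = γ T m.last ∨
        IsAwayFrom r z (γ T m.first) ∧ IsAwayFrom r z (γ T m.last)) →
      ‖cauchyIntegral m (γ T) (branch m (u T) (γ T) (p T) T) z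
        - farExpansion m (γ T) (uBar (u T) (p T) T) T z‖ ≤ C * T := by
  obtain ⟨r₁, hr₁, hr₁', s₁, s₂, κ₁, A₁, e₁, e₂, a1, a2, a3, a4, hκ₁, -, hN₁⟩ :=
    h.exists_isNearArc_minus (half_pos hr)
  obtain ⟨r₂, hr₂, hr₂', t₁, t₂, κ₂, A₂, f₁, f₂, b1, b2, b3, b4, hκ₂, -, hN₂⟩ :=
    h.exists_isNearArc_plus (half_pos hr)
  have hr4 : 0 < r / 4 := by linarith
  obtain ⟨C₀, hC₀⟩ := h.exists_norm_far_le a1.le a2 a3 (a4.trans b1).le b2 b3 b4.le hr4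
  have hlt := m.minus_lt_plus
  have c1 : s₂ ≤ m.last := (a4.trans b1).le.trans (b2.trans (b3.trans b4)).le
  have c2 : m.first ≤ t₁ := (a1.trans (a2.trans a3)).le.trans (a4.trans b1).le
  obtain ⟨C₁, hC₁⟩ := h.exists_norm_near_le (Or.inr rfl) a1.le c1 hκ₁ hN₁ hr4
  obtain ⟨C₂, hC₂⟩ := h.exists_norm_near_le (Or.inl rfl) c2 b4.le hκ₂ hN₂ hr4
  refine ⟨C₀ + C₁ + C₂, ?_⟩
  filter_upwards [hN₁, hN₂, hC₀, hC₁, hC₂, h.eventually_mem]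
    with T hN₁ hN₂ hC₀ hC₁ hC₂ hT z hz hzm hzp hends
  have hp := h.isPinned hT
  have hb₁ : ∀ w ∈ Metric.closedBall (γ T m.tMinus) r₁, r / 4 ≤ ‖sinh (w - z)‖ := fun w hw => by
    rw [Metric.mem_closedBall, dist_eq_norm] at hw
    exact hzm.le_norm_sinh (hw.trans hr₁')
  have hb₂ : ∀ w ∈ Metric.closedBall (γ T m.tPlus) r₂, r / 4 ≤ ‖sinh (w - z)‖ := fun w hw => by
    rw [Metric.mem_closedBall, dist_eq_norm] at hw
    exact hzp.le_norm_sinh (hw.trans hr₂')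
  have hself : ∀ q : ℂ, IsAwayFrom r z q → r / 4 ≤ ‖sinh (q - z)‖ := fun q hq =>
    hq.le_norm_sinh (by rw [sub_self, norm_zero]; linarith)
  have n0 := hC₀ z hz (by
    rintro t (rfl | rfl | rfl | rfl)
    · exact hb₁ _ (hN₁.mem_closedBall ⟨le_rfl, hN₁.le⟩)
    · exact hb₁ _ (hN₁.mem_closedBall ⟨hN₁.le, le_rfl⟩)
    · exact hb₂ _ (hN₂.mem_closedBall ⟨le_rfl, hN₂.le⟩)
    · exact hb₂ _ (hN₂.mem_closedBall ⟨hN₂.le, le_rfl⟩))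
    (hends.imp_right fun he => ⟨hself _ he.1, hself _ he.2⟩)
  have n1 := hC₁ z hb₁
  have n2 := hC₂ z hb₂
  rw [hp.cauchyIntegral_branch hz, add_sub_cancel_left, hp.thermalIntegral_split hz a1.le hN₁.le
    (a4.trans b1).le hN₂.le b4.le]
  refine norm_add₃_le.trans ?_
  linarith

/-- The expansions close to the two zeros. -/
theorem exists_near_expansion (h : IsFamily m U 𝒯 u γ p u₀ γ₀) :
    ∃ δ > 0, ∃ C, ∀ᶠ T in 𝓝[𝒯] (0 : ℝ), ∀ σ : ℝ, (σ = 1 ∨ σ = -1) → ∀ z : ℂ,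
      (IsOnSide m (γ T) (nbhd U (uBar (u T) (p T) T) δ (γ T m.tPlus)) σ z →
        ∃ ℓ : ℂ, IsLogSinhRatio m (γ T) z ℓ ∧
          ‖cauchyIntegral m (γ T) (branch m (u T) (γ T) (p T) T) z
            - nearPlusExpansion m (γ T) (uBar (u T) (p T) T) T σ z ℓ‖ ≤ C * T) ∧
      (IsOnSide m (γ T) (nbhd U (uBar (u T) (p T) T) δ (γ T m.tMinus)) σ z →
        ∃ ℓ : ℂ, IsLogSinhRatio m (γ T) z ℓ ∧
          ‖cauchyIntegral m (γ T) (branch m (u T) (γ T) (p T) T) z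
            - nearMinusExpansion m (γ T) (uBar (u T) (p T) T) T σ z ℓ‖ ≤ C * T) := by
  have hmm := Ioo_subset_Icc_self m.tMinus_mem
  have hpm := Ioo_subset_Icc_self m.tPlus_mem
  have hlt := m.minus_lt_plus
  -- The two zeros are incongruent modulo `πi`, so a pole close to one of them, and all its
  -- translates, stay away from the arc around the other.
  obtain ⟨k₁, hk₁, ρ₁, hρ₁, hs₁⟩ := h.exists_le_norm_sinh hmm (K := {m.tPlus}) isCompact_singleton
    (singleton_subset_iff.2 hpm) fun t ht h0 => by
      rw [mem_singleton_iff] at ht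
      have := h.adm₀.incongruent_minus t (ht ▸ hpm) h0
      linarith
  obtain ⟨k₂, hk₂, ρ₂, hρ₂, hs₂⟩ := h.exists_le_norm_sinh hpm (K := {m.tMinus}) isCompact_singleton
    (singleton_subset_iff.2 hmm) fun t ht h0 => by
      rw [mem_singleton_iff] at ht
      have := h.adm₀.incongruent_plus t (ht ▸ hmm) h0
      linarith
  set ρ := min ρ₁ ρ₂ with hρ
  have hρ0 : 0 < ρ := lt_min hρ₁ hρ₂
  obtain ⟨r₁, hr₁, hr₁', s₁, s₂, κ₁, A₁, e₁, e₂, a1, a2, a3, a4, hκ₁, hA₁, hN₁⟩ :=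
    h.exists_isNearArc_minus hρ0
  obtain ⟨r₂, hr₂, hr₂', t₁, t₂, κ₂, A₂, f₁, f₂, b1, b2, b3, b4, hκ₂, hA₂, hN₂⟩ :=
    h.exists_isNearArc_plus hρ0
  have c1 : s₂ ≤ m.last := (a4.trans b1).le.trans (b2.trans (b3.trans b4)).le
  have c2 : m.first ≤ t₁ := (a1.trans (a2.trans a3)).le.trans (a4.trans b1).le
  obtain ⟨C₁, hC₁⟩ := h.exists_norm_near_le (Or.inr rfl) a1.le c1 hκ₁ hN₁ hk₂
  obtain ⟨C₂, hC₂⟩ := h.exists_norm_near_le (Or.inl rfl) c2 b4.le hκ₂ hN₂ hk₁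
  obtain ⟨δ₁, hδ₁, d₁, hd₁, D₁, hD₁⟩ := h.exists_norm_near_add_le (Or.inr rfl) a1.le c1 ⟨a2, a3⟩
    hκ₁ hr₁ hA₁ hN₁ h.adm₀.incongruent_minus hρ0
  obtain ⟨δ₂, hδ₂, d₂, hd₂, D₂, hD₂⟩ := h.exists_norm_near_add_le (Or.inl rfl) c2 b4.le ⟨b2, b3⟩
    hκ₂ hr₂ hA₂ hN₂ h.adm₀.incongruent_plus hρ0
  obtain ⟨E₁, hE₁⟩ := h.exists_norm_far_le a1.le a2 a3 (a4.trans b1).le b2 b3 b4.le hd₁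
  obtain ⟨E₂, hE₂⟩ := h.exists_norm_far_le a1.le a2 a3 (a4.trans b1).le b2 b3 b4.le hd₂
  refine ⟨min δ₁ δ₂, lt_min hδ₁ hδ₂, max (E₂ + C₁ + D₂) (E₁ + D₁ + C₂), ?_⟩
  filter_upwards [hs₁, hs₂, hN₁, hN₂, hC₁, hC₂, hD₁, hD₂, hE₁, hE₂, h.eventually_mem]
    with T hs₁ hs₂ hN₁ hN₂ hC₁ hC₂ hD₁ hD₂ hE₁ hE₂ hT σ hσ z
  have hp := h.isPinned hT
  have hT0 := h.pos T hT
  have hs₁d : s₁ ∈ m.domain := ⟨a1.le, (a2.trans a3).le.trans c1⟩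
  have hs₂d : s₂ ∈ m.domain := ⟨(a1.trans (a2.trans a3)).le, c1⟩
  have ht₁d : t₁ ∈ m.domain := ⟨c2, (b2.trans (b3.trans b4)).le⟩
  have ht₂d : t₂ ∈ m.domain := ⟨c2.trans (b2.trans b3).le, b4.le⟩
  have hfd : m.first ∈ m.domain := ⟨le_rfl, m.first_lt_last.le⟩
  have hld : m.last ∈ m.domain := ⟨m.first_lt_last.le, le_rfl⟩
  constructor
  · intro hside
    obtain ⟨hzρ, hz, hfar, hsing⟩ := hD₂ _ (min_le_right _ _) σ hσ z hside
    refine ⟨_, hp.adm.isLogSinhRatio hz, ?_⟩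
    have n0 := hE₂ z hz (by
      rintro t (rfl | rfl | rfl | rfl)
      · exact hfar _ hs₁d fun ht => by linarith [ht.1]
      · exact hfar _ hs₂d fun ht => by linarith [ht.1]
      · exact hfar _ ht₁d fun ht => lt_irrefl _ ht.1
      · exact hfar _ ht₂d fun ht => lt_irrefl _ ht.2)
      -- A pole close to a zero is automatically away from the ends of the contour, so open and
      -- closed contours need no distinction here.
      (Or.inr ⟨hfar _ hfd fun ht => by linarith [ht.1], hfar _ hld fun ht => by linarith [ht.2]⟩)
    have n1 := hC₁ z fun w hw => hs₂ z (hzρ.trans (min_le_right _ _)) _ rfl w (by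
      rw [Metric.mem_closedBall, dist_eq_norm] at hw
      exact hw.trans (hr₁'.trans (min_le_right _ _)))
    rw [ofReal_one, one_mul] at hsing
    rw [hp.cauchyIntegral_branch hz, hp.nearPlusExpansion_eq hz hσ,
      hp.thermalIntegral_split hz a1.le hN₁.le (a4.trans b1).le hN₂.le b4.le, add_sub_sub_cancel,
      add_assoc]
    refine norm_add₃_le.trans ?_
    have := mul_le_mul_of_nonneg_right (le_max_left (E₂ + C₁ + D₂) (E₁ + D₁ + C₂)) hT0.le
    linarith
  · intro hside
    obtain ⟨hzρ, hz, hfar, hsing⟩ := hD₁ _ (min_le_left _ _) σ hσ z hside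
    refine ⟨_, hp.adm.isLogSinhRatio hz, ?_⟩
    have n0 := hE₁ z hz (by
      rintro t (rfl | rfl | rfl | rfl)
      · exact hfar _ hs₁d fun ht => lt_irrefl _ ht.1
      · exact hfar _ hs₂d fun ht => lt_irrefl _ ht.2
      · exact hfar _ ht₁d fun ht => by linarith [ht.2]
      · exact hfar _ ht₂d fun ht => by linarith [ht.2])
      (Or.inr ⟨hfar _ hfd fun ht => by linarith [ht.1], hfar _ hld fun ht => by linarith [ht.2]⟩)
    have n1 := hC₂ z fun w hw => hs₁ z (hzρ.trans (min_le_left _ _)) _ rfl w (by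
      rw [Metric.mem_closedBall, dist_eq_norm] at hw
      exact hw.trans (hr₂'.trans (min_le_left _ _)))
    rw [ofReal_neg, ofReal_one, neg_one_mul] at hsing
    rw [hp.cauchyIntegral_branch hz, hp.nearMinusExpansion_eq hz hσ,
      hp.thermalIntegral_split hz a1.le hN₁.le (a4.trans b1).le hN₂.le b4.le, add_sub_sub_cancel,
      add_right_comm, add_assoc _ _ (_ * _)]
    refine norm_add₃_le.trans ?_
    have := mul_le_mul_of_nonneg_right (le_max_right (E₂ + C₁ + D₂) (E₁ + D₁ + C₂)) hT0.le
    linarith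

end IsFamily

end Sommerfeld

theorem lemma2 (m : Mesh) (U : Set ℂ)
    -- the set of temperatures, and for each of them the function, the contour, the phase
    (𝒯 : Set ℝ) (h𝒯 : ∀ T ∈ 𝒯, 0 < T)
    (u : ℝ → ℂ → ℂ) (γ : ℝ → ℝ → ℂ) (p : ℝ → ℤ)
    (hadm : ∀ T ∈ 𝒯, IsAdmissible m U (u T) (γ T))
    (hminus : ∀ T ∈ 𝒯, (u T (γ T m.tMinus)).im = 2 * Real.pi * p T * T)
    (hplus : ∀ T ∈ 𝒯, (u T (γ T m.tPlus)).im = 2 * Real.pi * p T * T)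
    -- their limits at low temperature (constant families are included)
    (u₀ : ℂ → ℂ) (γ₀ : ℝ → ℂ) (hadm₀ : IsAdmissible m U u₀ γ₀)
    (hu : TendstoUniformlyOn u u₀ (𝓝[𝒯] 0) U) (hγ : TendstoC1 m γ γ₀ (𝓝[𝒯] 0)) :
    -- the branch of the logarithm
    ∃ L : ℝ → ℝ → ℂ,
      (∀ T ∈ 𝒯, IsContinuousLog (fun t => 1 + exp (-(u T (γ T t) / T))) m.first m.last (L T)) ∧
      -- uniformly away from the two zeros
      (∀ r > 0, ∃ C : ℝ, ∃ T₀ > 0, ∀ T ∈ 𝒯, T < T₀ → ∀ z : ℂ,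
        (∀ t ∈ m.domain, sinh (γ T t - z) ≠ 0) →
        IsAwayFrom r z (γ T m.tMinus) → IsAwayFrom r z (γ T m.tPlus) →
        (γ T m.first = γ T m.last ∨
          IsAwayFrom r z (γ T m.first) ∧ IsAwayFrom r z (γ T m.last)) →
        ‖cauchyIntegral m (γ T) (L T) z
          - farExpansion m (γ T) (uBar (u T) (p T) T) T z‖ ≤ C * T) ∧
      -- close to one of the two zeros, above or below the contour
      (∃ δ > 0, ∃ C : ℝ, ∃ T₀ > 0, ∀ T ∈ 𝒯, T < T₀ →
        ∀ σ : ℝ, (σ = 1 ∨ σ = -1) → ∀ z : ℂ,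
        (IsOnSide m (γ T) (nbhd U (uBar (u T) (p T) T) δ (γ T m.tPlus)) σ z →
          ∃ ℓ : ℂ, IsLogSinhRatio m (γ T) z ℓ ∧
            ‖cauchyIntegral m (γ T) (L T) z
              - nearPlusExpansion m (γ T) (uBar (u T) (p T) T) T σ z ℓ‖ ≤ C * T) ∧
        (IsOnSide m (γ T) (nbhd U (uBar (u T) (p T) T) δ (γ T m.tMinus)) σ z →
          ∃ ℓ : ℂ, IsLogSinhRatio m (γ T) z ℓ ∧
            ‖cauchyIntegral m (γ T) (L T) z
              - nearMinusExpansion m (γ T) (uBar (u T) (p T) T) T σ z ℓ‖ ≤ C * T)) := by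

  have h : IsFamily m U 𝒯 u γ p u₀ γ₀ := ⟨h𝒯, hadm, hminus, hplus, hadm₀, hu, hγ⟩
  refine ⟨fun T => branch m (u T) (γ T) (p T) T,
    fun T hT => (h.isPinned hT).isContinuousLog_branch, fun r hr => ?_, ?_⟩
  · obtain ⟨C, hC⟩ := h.exists_far_expansion hr
    exact ⟨C, h.exists_lt_of_eventually hC⟩
  · obtain ⟨δ, hδ, C, hC⟩ := h.exists_near_expansion
    exact ⟨δ, hδ, C, h.exists_lt_of_eventually hC⟩
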